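/- Let $1\le k\le n$ and $N\ge k$ be integers and put $s=n-k+1$, $K=ks$. **Combinatorics.** A $(K,k)$ parking function $\pi$ consists of a lattice path $D$ with north and east unit steps from $(0,0)$ to $(k,K)$ that stays weakly above the diagonal from $(0,0)$ to $(k,K)$, together with a labelling of its $K$ north steps by $1,\dots,K$ (each used once) that increases up each vertical run. Boxes of the $K\times k$ rectangle (height $K$, width $k$) are named by their lower left corners; the box $(x,y)$ is on the diagonal of index $y-sx$. Let $\delta_{K,k}=(k-1)K/2$ be the number of boxes lying fully above the diagonal of the rectangle, and put $\mathrm{dinv}(\pi)=\mathrm{pathdinv}(D)+\mathrm{tdinv}(\pi)-\mathrm{maxtdinv}(D)$, where: - $\mathrm{pathdinv}(D)$ is the number of boxes $b$ above $D$ with $\frac{\mathrm{arm}(b)}{\mathrm{leg}(b)+1}\le \frac kK<\frac{\mathrm{arm}(b)+1}{\mathrm{leg}(b)}$ (the last fraction being $\infty$ if $\mathrm{leg}(b)=0$), $\mathrm{arm}(b)$ and $\mathrm{leg}(b)$ being the numbers of boxes above $D$ to the right of $b$ in its row and below $b$ in its column; - $\mathrm{tdinv}(\pi)$ is the number of pairs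 $(a,b)$ of labelled boxes (those directly to the right of a north step) such that the label of $a$ is smaller than that of $b$ and either $a,b$ have the same index and $a$ is to the left of $b$, or the index of $a$ is one less than that of $b$ and $a$ is to the right of $b$; - $\mathrm{maxtdinv}(D)$ is the maximum of $\mathrm{tdinv}$ over all parking functions with path $D$. An affine permutation is a bijection $\omega:\mathbb Z\to\mathbb Z$ with $\omega(i+K)=\omega(i)+K$. It is positive if $\omega(1),\dots,\omega(K)>0$ and normalized if $1\le\omega^{-1}(1)\le K$. Let $\omega_\pi$ be the affine permutation such that, if the north step with label $i$ goes from $(x,j-1)$ to $(x,j)$, then $\omega_\pi(i)=1+(j-1)k+\lfloor (j-1)/s\rfloor-Kx$. **Geometry.** Let $\mathbb O=\mathbb C[[\epsilon]]$, $\mathbb K=\mathbb C((\epsilon))$, let $e_1,\dots,e_K$ be the standard basis of $\mathbb K^K$, and put $e_{i+K}=\epsilon e_i$ for all $i\in\mathbb Z$. Let $I^-\subset \mathrm{GL}_K(\mathbb O)$ be the subgroup of matrices that are lower triangular at $\epsilon=0$, and $\mathrm{Lie}(I^-)$ the set of all $K\times K$ matrices over $\mathbb O$ that are lower triangular at $\epsilon=0$.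 Let $\widetilde{\mathrm{Fl}}=\mathrm{GL}_K(\mathbb K)/I^-$. For an affine permutation $\omega$, identified with the matrix $e_i\mapsto e_{\omega(i)}$, let $C_\omega=I^-\omega I^- /I^-\subset\widetilde{\mathrm{Fl}}$ be the affine Schubert cell, and let $C$ be the union of the $C_\omega$ over all positive normalized $\omega$. Let $\gamma$ be the $\mathbb O$-linear operator with $\gamma e_i=e_{i+k}$ for $1\le i\le (n-k)k$, $\gamma e_i=e_{i+k+1}$ for $(n-k)k<i<K$, and $\gamma e_K=\epsilon^{N+1}e_1$. Put $$\mathrm{Sp}_\gamma=\{gI^-\in\widetilde{\mathrm{Fl}} : g^{-1}\gamma g\in\mathrm{Lie}(I^-)\},\qquad X_{n,k}=\mathrm{Sp}_\gamma\cap C .$$ **Theorem.** For every $(K,k)$ parking function $\pi$, the intersection $X_{n,k}\cap C_{\omega_\pi}$ is isomorphic to an affine space over $\mathbb C$ of dimension $\delta_{K,k}-\mathrm{dinv}(\pi)$ (in particular this number is nonnegative). Here the isomorphism is one of schemes over $\mathbb C$: for $d=\delta_{K,k}-\mathrm{dinv}(\pi)$ and all commutative $\mathbb C$-algebras $R$ there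 are bijections, natural in $R$, between $R^d$ and the set of $R$-points of $X_{n,k}\cap C_{\omega_\pi}$, which is defined by the formulas above with $R[[\epsilon]]$, $R((\epsilon))$ in place of $\mathbb O$, $\mathbb K$. -/

import Mathlib

open scoped PowerSeries

namespace AffineSpringer

/-! ### Rational Dyck paths, parking functions and dinv

Boxes of the rectangle of width `k` and height `K` are given by the coordinates `(x, y)` of their
lower left corner, `0 ≤ x < k`, `0 ≤ y < K`. -/

/-- A lattice path with north and east steps from `(0, 0)` to `(k, K)` staying weakly above the
diagonal. It is recorded by the abscissa `col j` of its north step from height `j` to `j + 1`;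
staying weakly above the diagonal means that the points `(col j, j)` do. -/
@[ext]
structure DyckPath (K k : ℕ) where
  col : Fin K → ℕ
  mono : Monotone col
  above : ∀ j : Fin K, K * col j ≤ k * (j : ℕ)

/-- A bijective labelling of the north steps (the label of the step in row `j` is
`σ j + 1 ∈ {1, …, K}`) is admissible if the labels increase up each vertical run. -/
def DyckPath.IsLabelling {K k : ℕ} (D : DyckPath K k) (σ : Equiv.Perm (Fin K)) : Prop :=
  ∀ i j : Fin K, i < j → D.col i = D.col j → σ i < σ j

instance {K k : ℕ} (D : DyckPath K k) (σ : Equiv.Perm (Fin K)) : Decidable (D.IsLabelling σ) :=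
  inferInstanceAs (Decidable (∀ i j : Fin K, i < j → D.col i = D.col j → σ i < σ j))

/-- A `(K, k)` parking function with labels `1, …, K`, each used once. The label in row `j`
is `label j + 1`. -/
structure ParkingFunction (K k : ℕ) where
  path : DyckPath K k
  label : Equiv.Perm (Fin K)
  isLabelling : path.IsLabelling label

namespace DyckPath

variable {K k : ℕ} (D : DyckPath K k)

/-- The box `(x, y)` lies above (that is, north-west of) the path. -/
def IsAbove (x : Fin k) (y : Fin K) : Prop := (x : ℕ) < D.col y

instance (x : Fin k) (y : Fin K) : Decidable (D.IsAbove x y) :=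
  inferInstanceAs (Decidable ((x : ℕ) < D.col y))

/-- The number of boxes to the right of `(x, y)` in its row that still lie above the path. -/
def arm (x : Fin k) (y : Fin K) : ℕ :=
  (Finset.univ.filter fun x' : Fin k => x < x' ∧ D.IsAbove x' y).card

/-- The number of boxes below `(x, y)` in its column that still lie above the path. -/
def leg (x : Fin k) (y : Fin K) : ℕ :=
  (Finset.univ.filter fun y' : Fin K => y' < y ∧ D.IsAbove x y').card

/-- The number of boxes above the path with `arm / (leg + 1) ≤ k / K < (arm + 1) / leg`
(where the last fraction is infinite if `leg = 0`), with denominators cleared. -/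
def pathdinv : ℕ :=
  (Finset.univ.filter fun b : Fin k × Fin K => D.IsAbove b.1 b.2 ∧
    K * D.arm b.1 b.2 ≤ k * (D.leg b.1 b.2 + 1) ∧
    k * D.leg b.1 b.2 < K * (D.arm b.1 b.2 + 1)).card

end DyckPath

/-- Two boxes are on the same diagonal if and only if their lower left corners have the same
`diagIndex`; passing to the next higher diagonal raises it by one. -/
def diagIndex (K k : ℕ) (x y : ℕ) : ℤ := (y : ℤ) - ((K / k : ℕ) : ℤ) * (x : ℤ)

/-- The pair `(a, b)` of boxes is attacking: `a` and `b` are on the same diagonal with `a` to the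
left of `b`, or `a` is one diagonal below `b` and to the right of `b`. -/
def IsAttacking (K k : ℕ) (a b : ℕ × ℕ) : Prop :=
  (diagIndex K k a.1 a.2 = diagIndex K k b.1 b.2 ∧ a.1 < b.1) ∨
  (diagIndex K k a.1 a.2 + 1 = diagIndex K k b.1 b.2 ∧ b.1 < a.1)

instance (K k : ℕ) (a b : ℕ × ℕ) : Decidable (IsAttacking K k a b) :=
  inferInstanceAs (Decidable ((_ ∧ _) ∨ (_ ∧ _)))

namespace DyckPath

variable {K k : ℕ} (D : DyckPath K k)

/-- The number of attacking pairs `(a, b)` of labelled boxes (the boxes just to the right of the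
north steps) such that the label of `a` is smaller than that of `b`. -/
def tdinv (σ : Equiv.Perm (Fin K)) : ℕ :=
  (Finset.univ.filter fun p : Fin K × Fin K =>
    IsAttacking K k (D.col p.1, (p.1 : ℕ)) (D.col p.2, (p.2 : ℕ)) ∧ σ p.1 < σ p.2).card

/-- The largest `tdinv` of a parking function with underlying path `D`. -/
def maxtdinv : ℕ := (Finset.univ.filter fun σ : Equiv.Perm (Fin K) => D.IsLabelling σ).sup D.tdinv

end DyckPath

/-- `dinv = pathdinv + tdinv - maxtdinv`. -/
def ParkingFunction.dinv {K k : ℕ} (π : ParkingFunction K k) : ℤ :=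
  (π.path.pathdinv : ℤ) + (π.path.tdinv π.label : ℤ) - (π.path.maxtdinv : ℤ)

/-- The number `δ` of boxes of the rectangle that lie fully above the diagonal, that is, whose
lower right corner `(x + 1, y)` lies weakly above it. -/
def delta (K k : ℕ) : ℕ :=
  (Finset.univ.filter fun b : Fin k × Fin K => K * ((b.1 : ℕ) + 1) ≤ k * (b.2 : ℕ)).card

/-! ### Affine permutations -/

/-- An (extended) affine permutation: a bijection `ω : ℤ → ℤ` with `ω (i + K) = ω i + K`. -/
structure AffinePerm (K : ℕ) where
  toPerm : Equiv.Perm ℤ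
  shift : ∀ i : ℤ, toPerm (i + K) = toPerm i + K

namespace AffinePerm

variable {K : ℕ}

theorem shift_mul (ω : AffinePerm K) (i q : ℤ) : ω.toPerm (i + K * q) = ω.toPerm i + K * q := by
  induction q using Int.induction_on with
  | zero => simp
  | succ n ih =>
    rw [mul_add, mul_one, ← add_assoc, ω.shift, ih, add_assoc]
  | pred n ih =>
    have h := ω.shift (i + K * (-(n : ℤ) - 1))
    have e : i + (K : ℤ) * (-(n : ℤ) - 1) + K = i + K * (-(n : ℤ)) := by ring
    rw [e, ih] at h
    linarith

/-- The inverse affine permutation. -/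
def inv (ω : AffinePerm K) : AffinePerm K where
  toPerm := ω.toPerm.symm
  shift i := by
    rw [Equiv.symm_apply_eq, ω.shift, Equiv.apply_symm_apply]

/-- Positive: all window entries are positive. -/
def IsPositive (ω : AffinePerm K) : Prop := ∀ i : ℤ, 1 ≤ i → i ≤ K → 0 < ω.toPerm i

/-- Normalized: the entry `1` lies in the window. -/
def IsNormalized (ω : AffinePerm K) : Prop :=
  1 ≤ ω.toPerm.symm 1 ∧ ω.toPerm.symm 1 ≤ K

theorem window_lt (hK : 0 < K) (i : ℤ) : ((i - 1) % (K : ℤ)).toNat < K := by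
  have h1 := Int.emod_nonneg (i - 1) (b := (K : ℤ)) (by omega)
  have h2 := Int.emod_lt_of_pos (i - 1) (b := (K : ℤ)) (by omega)
  omega

/-- The function with window `[w 0, …, w (K - 1)]`: it sends `a + 1 + K * q` to `w a + K * q`. -/
def windowFun (hK : 0 < K) (w : Fin K → ℤ) (i : ℤ) : ℤ :=
  w ⟨((i - 1) % (K : ℤ)).toNat, window_lt hK i⟩ + K * ((i - 1) / (K : ℤ))

theorem windowFun_apply (hK : 0 < K) (w : Fin K → ℤ) (a : Fin K) (q : ℤ) :
    windowFun hK w (((a : ℕ) : ℤ) + 1 + K * q) = w a + K * q := by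
  have hK0 : (K : ℤ) ≠ 0 := by omega
  have ha0 : (0 : ℤ) ≤ (a : ℕ) := by omega
  have haK : ((a : ℕ) : ℤ) < K := by exact_mod_cast a.2
  have e1 : (((a : ℕ) : ℤ) + 1 + K * q - 1) % (K : ℤ) = (a : ℕ) := by
    rw [show ((a : ℕ) : ℤ) + 1 + K * q - 1 = (a : ℕ) + K * q by ring,
      Int.add_mul_emod_self_left, Int.emod_eq_of_lt ha0 haK]
  have e2 : (((a : ℕ) : ℤ) + 1 + K * q - 1) / (K : ℤ) = q := by
    rw [show ((a : ℕ) : ℤ) + 1 + K * q - 1 = (a : ℕ) + K * q by ring,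
      Int.add_mul_ediv_left _ _ hK0, Int.ediv_eq_zero_of_lt ha0 haK, zero_add]
  simp only [windowFun, e1, e2, Int.toNat_natCast, Fin.eta]

theorem exists_window (hK : 0 < K) (i : ℤ) :
    ∃ (a : Fin K) (q : ℤ), i = ((a : ℕ) : ℤ) + 1 + K * q := by
  refine ⟨⟨((i - 1) % (K : ℤ)).toNat, window_lt hK i⟩, (i - 1) / (K : ℤ), ?_⟩
  have h1 := Int.emod_nonneg (i - 1) (b := (K : ℤ)) (by omega)
  have h2 := Int.mul_ediv_add_emod (i - 1) K
  rw [Int.toNat_of_nonneg h1]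
  linarith

theorem windowFun_bijective (hK : 0 < K) (w : Fin K → ℤ)
    (hw : ∀ a b : Fin K, (K : ℤ) ∣ w a - w b → a = b) : Function.Bijective (windowFun hK w) := by
  have hK0 : (K : ℤ) ≠ 0 := by omega
  constructor
  · intro i j hij
    obtain ⟨a, q, rfl⟩ := exists_window hK i
    obtain ⟨b, q', rfl⟩ := exists_window hK j
    rw [windowFun_apply, windowFun_apply] at hij
    obtain rfl : a = b := hw a b ⟨q' - q, by linear_combination hij⟩
    have hq : q = q' := mul_left_cancel₀ hK0 (by linarith)
    rw [hq]
  · intro y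
    have : NeZero K := ⟨by omega⟩
    have hinj : Function.Injective (fun a : Fin K => ((w a : ℤ) : ZMod K)) := by
      intro a b hab
      apply hw
      have := (ZMod.intCast_eq_intCast_iff_dvd_sub _ _ _).1 hab
      rw [← dvd_neg, neg_sub]
      exact this
    have hbij := (Fintype.bijective_iff_injective_and_card _).2 ⟨hinj, by simp⟩
    obtain ⟨a, ha⟩ := hbij.2 (y : ZMod K)
    obtain ⟨q, hq⟩ := (ZMod.intCast_eq_intCast_iff_dvd_sub _ _ _).1 ha
    exact ⟨((a : ℕ) : ℤ) + 1 + K * q, by rw [windowFun_apply]; linarith⟩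

/-- The affine permutation with window `[w 0, …, w (K - 1)]`, where the entries `w` have pairwise
distinct remainders modulo `K`. -/
noncomputable def ofWindow (hK : 0 < K) (w : Fin K → ℤ)
    (hw : ∀ a b : Fin K, (K : ℤ) ∣ w a - w b → a = b) : AffinePerm K where
  toPerm := Equiv.ofBijective (windowFun hK w) (windowFun_bijective hK w hw)
  shift i := by
    obtain ⟨a, q, rfl⟩ := exists_window hK i
    rw [Equiv.ofBijective_apply, Equiv.ofBijective_apply, windowFun_apply,
      show ((a : ℕ) : ℤ) + 1 + K * q + K = ((a : ℕ) : ℤ) + 1 + K * (q + 1) by ring,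
      windowFun_apply]
    ring

end AffinePerm

/-- The height `K = k (n - k + 1)`. -/
def height (n k : ℕ) : ℕ := k * (n - k + 1)

theorem height_pos {n k : ℕ} (hk : 0 < k) : 0 < height n k := Nat.mul_pos hk (Nat.succ_pos _)

/-- The rank of the box in column `i` and row `j` (both counted from `1`). -/
def rank (n k : ℕ) (i j : ℤ) : ℤ :=
  1 + (j - 1) * k + (j - 1) / ((n - k + 1 : ℕ) : ℤ) - (height n k : ℤ) * (i - 1)

theorem rank_row_inj {n k : ℕ} (hk : 0 < k) (i i' : ℤ) (j j' : Fin (height n k))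
    (h : (height n k : ℤ) ∣ rank n k i ((j : ℕ) + 1) - rank n k i' ((j' : ℕ) + 1)) : j = j' := by
  obtain ⟨s, hs⟩ : ∃ s : ℕ, s = n - k + 1 := ⟨_, rfl⟩
  have hs0 : 0 < s := by omega
  have hK : height n k = k * s := by rw [hs]; rfl
  have key : ∀ l : Fin (height n k), ∃ q r : ℕ, (l : ℕ) = s * q + r ∧ q < k ∧ r < s ∧
      ∀ i : ℤ, rank n k i ((l : ℕ) + 1) = 1 + (r * k + q) + (height n k : ℤ) * (q - (i - 1)) := by
    intro l
    have hl : (l : ℕ) < s * k := lt_of_lt_of_eq l.2 (hK.trans (mul_comm k s))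
    refine ⟨(l : ℕ) / s, (l : ℕ) % s, (Nat.div_add_mod _ _).symm, Nat.div_lt_of_lt_mul hl,
      Nat.mod_lt _ hs0, fun i => ?_⟩
    have e : ((l : ℕ) : ℤ) = s * (((l : ℕ) / s : ℕ) : ℤ) + (((l : ℕ) % s : ℕ) : ℤ) := by
      exact_mod_cast (Nat.div_add_mod (l : ℕ) s).symm
    unfold rank
    have hK2 : (height n k : ℤ) = k * s := by rw [hK, Nat.cast_mul]
    rw [← hs, add_sub_cancel_right, ← Int.natCast_ediv]
    linear_combination (k : ℤ) * e - (((l : ℕ) / s : ℕ) : ℤ) * hK2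
  obtain ⟨q, r, e, hq, hr, hrk⟩ := key j
  obtain ⟨q', r', e', hq', hr', hrk'⟩ := key j'
  rw [hrk, hrk'] at h
  have h2 : ((k * s : ℕ) : ℤ) ∣ ((r * k + q : ℕ) : ℤ) - ((r' * k + q' : ℕ) : ℤ) := by
    rw [← hK]
    have h3 := dvd_sub h (dvd_mul_right (height n k : ℤ) ((q - (i - 1)) - (q' - (i' - 1))))
    refine (congrArg (fun z : ℤ => (height n k : ℤ) ∣ z) ?_).mp h3
    push_cast
    ring
  have b : ∀ q r : ℕ, q < k → r < s → r * k + q < k * s := by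
    intro q r hq hr
    have : (r + 1) * k ≤ s * k := Nat.mul_le_mul_right _ hr
    nlinarith
  have h4 : r * k + q = r' * k + q' := by
    have h5 := (Nat.modEq_iff_dvd.2 h2)
    have h6 := Nat.ModEq.eq_of_lt_of_lt h5 (b _ _ hq' hr') (b _ _ hq hr)
    exact h6.symm
  have hq2 : q = q' := by
    have := congrArg (· % k) h4
    simpa [Nat.add_mod, Nat.mod_eq_of_lt hq, Nat.mod_eq_of_lt hq'] using this
  have hr2 : r = r' := by
    subst hq2
    exact Nat.eq_of_mul_eq_mul_right hk (by omega)
  apply Fin.ext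
  rw [e, e', hq2, hr2]

/-- The affine permutation `ω_π`: its value at a label is the rank attached to the north step
carrying this label. The rank written to the left of the north step in row `j + 1` with abscissa
`x` is the one of column `x + 1`; in particular it is `1` for the first step of the path. -/
noncomputable def omega {n k : ℕ} (hk : 0 < k) (π : ParkingFunction (height n k) k) :
    AffinePerm (height n k) :=
  AffinePerm.ofWindow (height_pos hk)
    (fun a => rank n k ((π.path.col (π.label.symm a) : ℤ) + 1) (((π.label.symm a : ℕ) : ℤ) + 1))
    (fun _ _ h => π.label.symm.injective (rank_row_inj hk _ _ _ _ h))

/-! ### The affine flag variety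

Everything is defined over an arbitrary commutative ring `R` (later a `ℂ`-algebra), with
`R⟦X⟧` for the power series ring `R[[ε]]` and `LaurentSeries R` for `R((ε))`. For `R = ℂ` these are
the complex points; the other rings record the algebraic structure. -/

/-- The loop group `GL_K(R((ε)))`. -/
abbrev LoopGL (K : ℕ) (R : Type*) [CommRing R] := GL (Fin K) (LaurentSeries R)

/-- The Borel subgroup of lower triangular matrices. -/
def borelMinus (K : ℕ) (R : Type*) [CommRing R] : Subgroup (GL (Fin K) R) where
  carrier := {g | (g : Matrix (Fin K) (Fin K) R).BlockTriangular OrderDual.toDual}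
  mul_mem' {a b} ha hb := by
    simp only [Set.mem_ofPred_eq, Units.val_mul] at *
    exact ha.mul hb
  one_mem' := Matrix.blockTriangular_one
  inv_mem' {a} ha := by
    simp only [Set.mem_ofPred_eq, Matrix.coe_units_inv] at *
    have : Invertible (a : Matrix (Fin K) (Fin K) R) := a.invertible
    exact Matrix.blockTriangular_inv_of_blockTriangular ha

/-- The Iwahori subgroup `I⁻`: the elements of `GL_K(R[[ε]])` that are lower triangular at `ε = 0`,
viewed inside `GL_K(R((ε)))`. -/
noncomputable def iwahori (K : ℕ) (R : Type*) [CommRing R] : Subgroup (LoopGL K R) :=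
  ((borelMinus K R).comap
    (Matrix.GeneralLinearGroup.map (PowerSeries.constantCoeff (R := R)))).map
    (Matrix.GeneralLinearGroup.map (HahnSeries.ofPowerSeries ℤ R))

/-- The Lie algebra of `I⁻`: matrices over `R[[ε]]` that are lower triangular at `ε = 0`. -/
def lieIwahori (K : ℕ) (R : Type*) [CommRing R] : Set (Matrix (Fin K) (Fin K) (LaurentSeries R)) :=
  {A | ∃ B : Matrix (Fin K) (Fin K) R⟦X⟧, A = B.map (HahnSeries.ofPowerSeries ℤ R) ∧
    (B.map (PowerSeries.constantCoeff (R := R))).BlockTriangular OrderDual.toDual}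

/-- The affine flag variety `GL_K(R((ε))) / I⁻`. -/
abbrev AffFlag (K : ℕ) (R : Type*) [CommRing R] := LoopGL K R ⧸ iwahori K R

/-- The ring homomorphism `R((ε)) → S((ε))` applying `f` to all coefficients. -/
noncomputable def laurentMap {R S : Type*} [CommRing R] [CommRing S] (f : R →+* S) :
    LaurentSeries R →+* LaurentSeries S where
  toFun x := HahnSeries.map x f
  map_one' := HahnSeries.map_one f.toMonoidWithZeroHom
  map_mul' _ _ := HahnSeries.map_mul (f : R →ₙ+* S)
  map_zero' := by ext; simp
  map_add' _ _ := by ext; simp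

theorem laurentMap_ofPowerSeries {R S : Type*} [CommRing R] [CommRing S] (f : R →+* S)
    (p : R⟦X⟧) : laurentMap f (HahnSeries.ofPowerSeries ℤ R p) =
      HahnSeries.ofPowerSeries ℤ S (PowerSeries.map f p) := by
  ext m
  rw [show (laurentMap f (HahnSeries.ofPowerSeries ℤ R p)).coeff m =
    f ((HahnSeries.ofPowerSeries ℤ R p).coeff m) from rfl, PowerSeries.coeff_coe, PowerSeries.coeff_coe]
  split_ifs <;> simp

theorem map_mem_iwahori {K : ℕ} {R S : Type*} [CommRing R] [CommRing S] (f : R →+* S)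
    {g : LoopGL K R} (hg : g ∈ iwahori K R) :
    Matrix.GeneralLinearGroup.map (laurentMap f) g ∈ iwahori K S := by
  obtain ⟨h, hh, rfl⟩ := hg
  refine ⟨Matrix.GeneralLinearGroup.map (PowerSeries.map f) h, ?_, ?_⟩
  · intro i j hij
    have := congrArg f (hh hij)
    simp only [RingHom.map_zero] at this
    rw [← this]
    change PowerSeries.constantCoeff (PowerSeries.map f (h.val i j)) =
      f (PowerSeries.constantCoeff (h.val i j))
    rw [← PowerSeries.coeff_zero_eq_constantCoeff_apply, PowerSeries.coeff_map,
      PowerSeries.coeff_zero_eq_constantCoeff_apply]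
  · ext i j : 2
    simp [laurentMap_ofPowerSeries]

/-- The map of affine flag varieties induced by a ring homomorphism, `g I⁻(R) ↦ f(g) I⁻(S)`. -/
noncomputable def AffFlag.map {K : ℕ} {R S : Type*} [CommRing R] [CommRing S] (f : R →+* S) :
    AffFlag K R → AffFlag K S :=
  Quotient.map' (Matrix.GeneralLinearGroup.map (laurentMap f)) (by
    intro a b hab
    rw [QuotientGroup.leftRel_apply] at hab ⊢
    rw [← map_inv, ← map_mul]
    exact map_mem_iwahori f hab)

/-- The vector `e_m ∈ R((ε))^K` for `m ∈ ℤ`: `e_1, …, e_K` is the standard basis (with `e_{r+1}` in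
coordinate `r`), extended by `e_{m + K} = ε e_m`. -/
noncomputable def basisVec (K : ℕ) (R : Type*) [CommRing R] (m : ℤ) : Fin K → LaurentSeries R :=
  fun r => if (K : ℤ) ∣ m - ((r : ℕ) + 1) then
    HahnSeries.single ((m - ((r : ℕ) + 1)) / (K : ℤ)) 1 else 0

/-- The matrix with columns `e_{f 1}, …, e_{f K}`. -/
noncomputable def colMatrix (K : ℕ) (R : Type*) [CommRing R] (f : ℤ → ℤ) :
    Matrix (Fin K) (Fin K) (LaurentSeries R) :=
  Matrix.of fun r c => basisVec K R (f ((c : ℕ) + 1)) r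

theorem AffinePerm.colMatrix_mul_inv {K : ℕ} (R : Type*) [CommRing R] (ω : AffinePerm K) :
    colMatrix K R ω.toPerm * colMatrix K R ω.inv.toPerm = 1 := by
  ext r d : 1
  have hK : 0 < K := r.pos
  have hK0 : (K : ℤ) ≠ 0 := by omega
  set m : ℤ := ω.toPerm.symm ((d : ℕ) + 1) with hm
  have hmod : ((m - 1) % (K : ℤ)).toNat < K := AffinePerm.window_lt hK m
  set c0 : Fin K := ⟨((m - 1) % (K : ℤ)).toNat, hmod⟩ with hc0
  set q : ℤ := (m - 1) / (K : ℤ) with hq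
  have hc : m = ((c0 : ℕ) : ℤ) + 1 + K * q := by
    have h1 := Int.emod_nonneg (m - 1) hK0
    have h2 := Int.mul_ediv_add_emod (m - 1) K
    have h3 : ((c0 : ℕ) : ℤ) = (m - 1) % (K : ℤ) := by
      simp [hc0, Int.toNat_of_nonneg h1]
    rw [h3]; linarith
  have hω : ω.toPerm ((c0 : ℕ) + 1) + K * q = (d : ℕ) + 1 := by
    rw [← ω.shift_mul, ← hc, hm, Equiv.apply_symm_apply]
  rw [Matrix.mul_apply, Finset.sum_eq_single c0]
  · have e1 : colMatrix K R ω.inv.toPerm c0 d = HahnSeries.single q 1 := by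
      change basisVec K R m c0 = _
      have h1 : m - ((c0 : ℕ) + 1) = K * q := by rw [hc]; ring
      rw [basisVec, h1, if_pos (dvd_mul_right _ _), Int.mul_ediv_cancel_left _ hK0]
    rw [e1]
    change basisVec K R (ω.toPerm ((c0 : ℕ) + 1)) r * _ = _
    have h2 : ω.toPerm ((c0 : ℕ) + 1) - ((r : ℕ) + 1) = ((d : ℕ) : ℤ) - (r : ℕ) - K * q := by
      linarith
    rw [basisVec, h2]
    by_cases hrd : r = d
    · subst hrd
      rw [if_pos ⟨-q, by ring⟩, Matrix.one_apply_eq, HahnSeries.single_mul_single,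
        show ((r : ℕ) : ℤ) - (r : ℕ) - K * q = K * (-q) by ring, Int.mul_ediv_cancel_left _ hK0]
      simp
    · rw [if_neg, Matrix.one_apply_ne hrd, zero_mul]
      rintro ⟨t, ht⟩
      apply hrd
      have h3 : (K : ℤ) ∣ ((d : ℕ) : ℤ) - (r : ℕ) := ⟨t + q, by linarith⟩
      have h4 := Nat.ModEq.eq_of_lt_of_lt (Nat.modEq_iff_dvd.2 h3) r.2 d.2
      exact Fin.ext h4
  · intro c _ hcc
    have : colMatrix K R ω.inv.toPerm c d = 0 := by
      change basisVec K R m c = _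
      rw [basisVec, if_neg]
      rintro ⟨t, ht⟩
      apply hcc
      have h3 : (K : ℤ) ∣ ((c0 : ℕ) : ℤ) - (c : ℕ) := ⟨t - q, by linarith⟩
      have h4 := Nat.ModEq.eq_of_lt_of_lt (Nat.modEq_iff_dvd.2 h3) c.2 c0.2
      exact Fin.ext h4
    rw [this, mul_zero]
  · intro h
    exact absurd (Finset.mem_univ _) h

/-- An affine permutation as an element of the loop group: `e_i ↦ e_{ω i}`. -/
noncomputable def AffinePerm.toGL {K : ℕ} (R : Type*) [CommRing R] (ω : AffinePerm K) :
    LoopGL K R where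
  val := colMatrix K R ω.toPerm
  inv := colMatrix K R ω.inv.toPerm
  val_inv := ω.colMatrix_mul_inv R
  inv_val := ω.inv.colMatrix_mul_inv R

/-- The affine Schubert cell `C_ω = I⁻ ω I⁻ / I⁻`. -/
def schubertCell {K : ℕ} (R : Type*) [CommRing R] (ω : AffinePerm K) : Set (AffFlag K R) :=
  {x | ∃ a ∈ iwahori K R, ∃ b ∈ iwahori K R, x = QuotientGroup.mk (a * ω.toGL R * b)}

/-- The union `C` of the Schubert cells of all positive normalized affine permutations. -/
def positiveCells (K : ℕ) (R : Type*) [CommRing R] : Set (AffFlag K R) :=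
  {x | ∃ ω : AffinePerm K, ω.IsPositive ∧ ω.IsNormalized ∧ x ∈ schubertCell R ω}

/-- The values of the affine permutation `γ_{n,k,N}` on `1, …, K`. -/
def gammaWindow (n k N : ℕ) (i : ℤ) : ℤ :=
  if i ≤ (((n - k) * k : ℕ) : ℤ) then i + k
  else if i < (height n k : ℤ) then i + k + 1
  else 1 + (height n k : ℤ) * (N + 1)

/-- The operator `γ_{n,k,N}`, as a matrix: `γ e_i = e_{γ(i)}` for `1 ≤ i ≤ K`. -/
noncomputable def gammaOp (n k N : ℕ) (R : Type*) [CommRing R] :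
    Matrix (Fin (height n k)) (Fin (height n k)) (LaurentSeries R) :=
  colMatrix (height n k) R (gammaWindow n k N)

/-- The affine Springer fiber of an operator `γ`: the cosets `g I⁻` with
`g⁻¹ γ g ∈ Lie(I⁻)`. -/
def springerFiber {K : ℕ} {R : Type*} [CommRing R]
    (γ : Matrix (Fin K) (Fin K) (LaurentSeries R)) : Set (AffFlag K R) :=
  {x | ∃ g : LoopGL K R, x = QuotientGroup.mk g ∧
    (↑g⁻¹ : Matrix (Fin K) (Fin K) (LaurentSeries R)) * γ *
      (g : Matrix (Fin K) (Fin K) (LaurentSeries R)) ∈ lieIwahori K R}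

/-- `X_{n,k,N} = Sp_γ ∩ C`. -/
def varietyX (n k N : ℕ) (R : Type*) [CommRing R] : Set (AffFlag (height n k) R) :=
  springerFiber (gammaOp n k N R) ∩ positiveCells (height n k) R

/-- A family `Z(R)` of subsets of the affine flag varieties over all commutative `ℂ`-algebras `R`
(the `R`-points of a subscheme `Z`) is isomorphic to the affine space of dimension `d` over `ℂ`:
there are bijections `R^d ≃ Z(R)`, natural in `R`. By the Yoneda lemma this is an isomorphism
between `Z` and the affine space as schemes over `ℂ`. -/
def IsoAffineSpace {K : ℕ}
    (Z : (R : Type) → [CommRing R] → [Algebra ℂ R] → Set (AffFlag K R)) (d : ℕ) : Prop :=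
  ∃ Φ : (R : Type) → [CommRing R] → [Algebra ℂ R] → ((Fin d → R) ≃ Z R),
    ∀ (R S : Type) [CommRing R] [Algebra ℂ R] [CommRing S] [Algebra ℂ S] (f : R →ₐ[ℂ] S)
      (x : Fin d → R),
      AffFlag.map (f : R →+* S) (Φ R x : AffFlag K R) = (Φ S (fun i => f (x i)) : AffFlag K S)

end AffineSpringer

open AffineSpringer

/-! A matrix over the Laurent series is treated as a matrix with rows and columns indexed by all
integers, periodic under a simultaneous shift by `K`. Then `Lie(I⁻)` consists of the lower
triangular ones, and `I⁻` of those with unit diagonal as well. A point of the cell of `ω` is a flag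
of lattices with basis vectors `f_c`, the leading position of `f_c` being `ω c` and the `i`-th
lattice being spanned by the `f_c` with `c ≥ i`. Elimination with distinct leading positions gives a
unique reduced basis (`exists_isNormal_of_mem_schubertCell`, `IsNormal.eq_of_mk_eq`), so the cell
has free coordinates at the pairs `(i, m)` with `ω i < m` and `ω⁻¹ m < i`.

The Springer condition says that `γ f_i` has zero remainder modulo the `i`-th lattice. The remainder
at position `γ j` is the coordinate of `f_i` at `j`, minus a sum of products of other coefficients.
A `Weight` orders the coordinates by the weight difference between position and leading position,
ties being broken by the row of the leading position. With respect to this order the subtracted sum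
involves only smaller coordinates (`Weight.sub_gammaCoeff_congr`). Hence every equation with `ω⁻¹(γ
j) < i` and `ω i < j` determines one coordinate from smaller ones, while the other equations hold
automatically. The remaining coordinates, those in `freeIndex`, are arbitrary. Everything is
polynomial and hence natural in the ring (`Weight.isoAffineSpace`). For `ω_π` the weight exists
because `γ` moves each row of the rectangle to the next one. The exceptional jump from the last row
is harmless because the path stays above the diagonal (`parkingWeight`).

For the dimension, a bijection of complements replaces `freeIndex` by the pairs with `γ⁻¹ m < ω i <
m` and `ω⁻¹ m < i` (`Weight.ncard_freeIndex`). Ranks order boxes by diagonals and then from left to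
right, so this betweenness says that the labelled box of rank `ω i` attacks the box of rank `m`. The
other inequality says that the attacked box is right of the path or carries a smaller label. The
count is therefore `attackCount` plus the attacking labelled pairs not counted by `tdinv`. All
labelled attacking pairs together number `maxtdinv` (`maxtdinv_eq`), and `pathdinv + attackCount =
δ` (`DyckPath.pathdinv_add_attackCount`), which leaves `δ - dinv`. -/

namespace AffineSpringer

/-! ### Matrices over Laurent series as periodic matrices indexed by the integers -/

section Entries

variable {K : ℕ} (hK : 0 < K)

/-- The coordinate `r` of the vector `e_m = ε ^ q e_{r+1}`. -/
def winRow (m : ℤ) : Fin K := ⟨((m - 1) % (K : ℤ)).toNat, AffinePerm.window_lt hK m⟩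

theorem winRow_add (m : ℤ) :
    ((winRow hK m : ℕ) : ℤ) + 1 + K * ((m - 1) / (K : ℤ)) = m := by
  have h1 := Int.emod_nonneg (m - 1) (b := (K : ℤ)) (by omega)
  have h2 := Int.mul_ediv_add_emod (m - 1) K
  simp only [winRow, Int.toNat_of_nonneg h1]
  linarith

theorem ediv_window (a : Fin K) (q : ℤ) : (((a : ℕ) : ℤ) + 1 + K * q - 1) / (K : ℤ) = q := by
  have hK0 : (K : ℤ) ≠ 0 := by have := a.pos; omega
  have haK : ((a : ℕ) : ℤ) < K := by exact_mod_cast a.2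
  rw [show ((a : ℕ) : ℤ) + 1 + K * q - 1 = (a : ℕ) + K * q by ring,
    Int.add_mul_ediv_left _ _ hK0, Int.ediv_eq_zero_of_lt (by omega) haK, zero_add]

theorem winRow_window (a : Fin K) (q : ℤ) : winRow hK (((a : ℕ) : ℤ) + 1 + K * q) = a := by
  have h := winRow_add hK (((a : ℕ) : ℤ) + 1 + K * q)
  rw [ediv_window] at h
  apply Fin.ext
  have : ((winRow hK (((a : ℕ) : ℤ) + 1 + K * q) : ℕ) : ℤ) = (a : ℕ) := by linarith
  exact_mod_cast this

/-- Integers correspond to pairs of a position in the window and a shift. -/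
def winEquiv : Fin K × ℤ ≃ ℤ where
  toFun p := ((p.1 : ℕ) : ℤ) + 1 + K * p.2
  invFun m := (winRow hK m, (m - 1) / (K : ℤ))
  left_inv p := by simp only [winRow_window, ediv_window]
  right_inv m := winRow_add hK m

variable {R : Type*} [CommRing R]

/-- The coefficient of `e_m` in `A e_c`. -/
def ent (A : Matrix (Fin K) (Fin K) (LaurentSeries R)) (m c : ℤ) : R :=
  (A (winRow hK m) (winRow hK c)).coeff ((m - 1) / (K : ℤ) - (c - 1) / (K : ℤ))

theorem ent_window (A : Matrix (Fin K) (Fin K) (LaurentSeries R)) (a b : Fin K) (q j : ℤ) :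
    ent hK A (((a : ℕ) : ℤ) + 1 + K * q) (((b : ℕ) : ℤ) + 1 + K * j) = (A a b).coeff (q - j) := by
  simp only [ent, winRow_window, ediv_window]

theorem ent_shift (A : Matrix (Fin K) (Fin K) (LaurentSeries R)) (m c t : ℤ) :
    ent hK A (m + K * t) (c + K * t) = ent hK A m c := by
  obtain ⟨a, q, rfl⟩ := AffinePerm.exists_window hK m
  obtain ⟨b, j, rfl⟩ := AffinePerm.exists_window hK c
  rw [add_assoc _ ((K : ℤ) * q), add_assoc _ ((K : ℤ) * j), ← mul_add, ← mul_add, ent_window,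
    ent_window]
  congr 1
  ring

theorem ent_injective {A B : Matrix (Fin K) (Fin K) (LaurentSeries R)}
    (h : ∀ m c : ℤ, 1 ≤ c → c ≤ K → ent hK A m c = ent hK B m c) : A = B := by
  ext a b q
  have := h (((a : ℕ) : ℤ) + 1 + K * q) (((b : ℕ) : ℤ) + 1 + K * 0) (by omega)
    (by have := b.2; omega)
  rwa [ent_window, ent_window, sub_zero] at this

theorem exists_ent_eq_zero (A : Matrix (Fin K) (Fin K) (LaurentSeries R)) :
    ∃ B : ℤ, ∀ m c, m < c - B → ent hK A m c = 0 := by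
  have h1 : ∀ x : LaurentSeries R, ∃ b : ℕ, ∀ q : ℤ, q < -b → x.coeff q = 0 := by
    intro x
    refine ⟨(-x.order).toNat, fun q hq => HahnSeries.coeff_eq_zero_of_lt_order ?_⟩
    omega
  choose b hb using h1
  have h2 : ∀ r c : Fin K, b (A r c) ≤ ∑ r, ∑ c, b (A r c) := fun r c =>
    (Finset.single_le_sum (f := fun c => b (A r c)) (fun _ _ => Nat.zero_le _)
      (Finset.mem_univ c)).trans (Finset.single_le_sum (f := fun r => ∑ c, b (A r c))
        (fun _ _ => Nat.zero_le _) (Finset.mem_univ r))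
  set M := ∑ r, ∑ c, b (A r c)
  -- `M` bounds the pole orders of all matrix entries; the extra `K` absorbs the difference of the
  -- two positions inside the window.
  refine ⟨K * M + K, fun m c hmc => ?_⟩
  obtain ⟨r, q, rfl⟩ := AffinePerm.exists_window hK m
  obtain ⟨d, j, rfl⟩ := AffinePerm.exists_window hK c
  rw [ent_window]
  apply hb
  have h3 : (b (A r d) : ℤ) ≤ M := by exact_mod_cast h2 r d
  have h4 : ((d : ℕ) : ℤ) < K := by exact_mod_cast d.2
  have h5 : (0 : ℤ) ≤ (r : ℕ) := by omega
  have h6 : (K : ℤ) * (q - j + M) < 0 := by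
    rw [mul_add, mul_sub]; linarith
  have h7 : q - j + M < 0 := by
    by_contra hcon
    exact absurd h6 (not_lt.2 (mul_nonneg (by omega) (not_lt.1 hcon)))
  omega

/-- Frees the Cauchy product from the supports of its factors, so that one index set can serve all
inner indices of a matrix product. -/
theorem coeff_mul_eq_sum (x y : LaurentSeries R) (n : ℤ) (S : Finset ℤ)
    (hS : ∀ t, t ∉ S → x.coeff (n - t) * y.coeff t = 0) :
    (x * y).coeff n = ∑ t ∈ S, x.coeff (n - t) * y.coeff t := by
  rw [HahnSeries.coeff_mul]
  rw [← Finset.sum_subset (Finset.inter_subset_left (s₁ := S)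
    (s₂ := (Finset.antidiagonal x.isPWO_support y.isPWO_support n).image Prod.snd))]
  · symm
    refine Finset.sum_bij_ne_zero (fun t _ _ => (n - t, t)) ?_ ?_ ?_ ?_
    · intro t ht h0
      rw [Finset.mem_antidiagonal]
      exact ⟨fun h => h0 (by rw [h, zero_mul]), fun h => h0 (by rw [h, mul_zero]),
        by simp⟩
    · intro a _ _ b _ _ h
      exact (Prod.mk.inj h).2
    · rintro ⟨i, t⟩ hp h0
      have hp' := (Finset.mem_antidiagonal.1 hp).2.2
      simp only at hp' h0
      have e : n - t = i := by omega
      refine ⟨t, ?_, by rw [e]; exact h0, by rw [e]⟩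
      rw [Finset.mem_inter]
      refine ⟨?_, Finset.mem_image.2 ⟨_, hp, rfl⟩⟩
      by_contra hcon
      exact h0 (by rw [← e]; exact hS t hcon)
    · intros; rfl
  · intro t ht hnt
    by_contra h0
    refine hnt (Finset.mem_inter.2 ⟨ht, Finset.mem_image.2 ⟨(n - t, t), ?_, rfl⟩⟩)
    rw [Finset.mem_antidiagonal]
    exact ⟨fun h => h0 (by rw [h, zero_mul]), fun h => h0 (by rw [h, mul_zero]), by simp⟩

/-- An integer is a window position together with a shift, so the sum over the inner index and the
Cauchy product merge into one sum over integers. It is finite because poles are bounded. Allowing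
every larger `S'` makes it possible to compare with an arbitrary set containing the support. -/
theorem ent_mul_aux (A B : Matrix (Fin K) (Fin K) (LaurentSeries R)) (m c : ℤ) :
    ∃ S : Finset ℤ, ∀ S', S ⊆ S' →
      ent hK (A * B) m c = ∑ l ∈ S', ent hK A m l * ent hK B l c := by
  obtain ⟨bA, hA⟩ := exists_ent_eq_zero hK A
  obtain ⟨bB, hB⟩ := exists_ent_eq_zero hK B
  have hzero : ∀ l, l ∉ Finset.Icc (c - bB) (m + bA) → ent hK A m l * ent hK B l c = 0 := by
    intro l hl
    rw [Finset.mem_Icc, not_and_or, not_le, not_le] at hl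
    rcases hl with hl | hl
    · rw [hB _ _ hl, mul_zero]
    · rw [hA _ _ (by linarith), zero_mul]
  set T : Finset ℤ := (Finset.Icc (c - bB) (m + bA)).image (fun l => (l - 1) / (K : ℤ)) with hT
  refine ⟨(Finset.univ ×ˢ T).map (winEquiv hK).toEmbedding, fun S' hS' => ?_⟩
  rw [← Finset.sum_subset hS', Finset.sum_map, Finset.sum_product]
  · obtain ⟨a, q, rfl⟩ := AffinePerm.exists_window hK m
    obtain ⟨b, j, rfl⟩ := AffinePerm.exists_window hK c
    rw [ent_window, Matrix.mul_apply, HahnSeries.coeff_sum]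
    refine Finset.sum_congr rfl fun x _ => ?_
    have key : ∀ t : ℤ, ent hK A (a + 1 + K * q) ((x : ℕ) + 1 + K * t) *
        ent hK B ((x : ℕ) + 1 + K * t) (b + 1 + K * j) =
        (A a x).coeff (q - j - (t - j)) * (B x b).coeff (t - j) := by
      intro t
      rw [ent_window, ent_window]
      congr 2
      ring
    rw [coeff_mul_eq_sum _ _ _ (T.map (Equiv.subRight j).toEmbedding), Finset.sum_map]
    · exact Finset.sum_congr rfl fun t _ => (key t).symm
    · intro t ht
      have := key (t + j)
      rw [add_sub_cancel_right] at this
      rw [← this]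
      apply hzero
      intro hcon
      apply ht
      rw [Finset.mem_map]
      refine ⟨t + j, ?_, by simp⟩
      rw [hT, Finset.mem_image]
      exact ⟨_, hcon, ediv_window x (t + j)⟩
  · intro l _ hl
    apply hzero
    intro hcon
    apply hl
    rw [Finset.mem_map]
    exact ⟨(winEquiv hK).symm l, Finset.mem_product.2 ⟨Finset.mem_univ _,
      Finset.mem_image.2 ⟨l, hcon, rfl⟩⟩, (winEquiv hK).apply_symm_apply l⟩

theorem ent_mul (A B : Matrix (Fin K) (Fin K) (LaurentSeries R)) (m c : ℤ) (S : Finset ℤ)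
    (hS : ∀ l, l ∉ S → ent hK A m l * ent hK B l c = 0) :
    ent hK (A * B) m c = ∑ l ∈ S, ent hK A m l * ent hK B l c := by
  obtain ⟨T, hT⟩ := ent_mul_aux hK A B m c
  rw [hT (T ∪ S) Finset.subset_union_left]
  exact (Finset.sum_subset Finset.subset_union_right fun l _ hl => hS l hl).symm

theorem ent_colMatrix (f : ℤ → ℤ) (hf : ∀ i q, f (i + K * q) = f i + K * q) (m c : ℤ) :
    ent hK (colMatrix K R f) m c = if m = f c then 1 else 0 := by
  have hK0 : (K : ℤ) ≠ 0 := by omega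
  obtain ⟨a, q, rfl⟩ := AffinePerm.exists_window hK m
  obtain ⟨b, j, rfl⟩ := AffinePerm.exists_window hK c
  rw [ent_window, hf]
  change (basisVec K R (f ((b : ℕ) + 1)) a).coeff (q - j) = _
  rw [basisVec]
  split_ifs with h1 h2 h2
  · have : f ((b : ℕ) + 1) - ((a : ℕ) + 1) = K * (q - j) := by linear_combination -h2
    rw [this, Int.mul_ediv_cancel_left _ hK0, HahnSeries.coeff_single_same]
  · obtain ⟨t, ht⟩ := h1
    rw [ht, Int.mul_ediv_cancel_left _ hK0, HahnSeries.coeff_single_of_ne]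
    rintro rfl
    exact h2 (by linear_combination -ht)
  · exact absurd ⟨q - j, by linear_combination -h2⟩ h1
  · simp

theorem ent_one (m c : ℤ) :
    ent hK (1 : Matrix (Fin K) (Fin K) (LaurentSeries R)) m c = if m = c then 1 else 0 := by
  obtain ⟨a, q, rfl⟩ := AffinePerm.exists_window hK m
  obtain ⟨b, j, rfl⟩ := AffinePerm.exists_window hK c
  have h := (winEquiv hK).injective.eq_iff (a := (a, q)) (b := (b, j))
  simp only [winEquiv, Equiv.coe_fn_mk, Prod.mk.injEq] at h
  rw [ent_window]
  simp only [h, Matrix.one_apply]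
  by_cases hab : a = b
  · simp [hab, HahnSeries.coeff_one, sub_eq_zero]
  · simp [hab]

/-- The matrix with prescribed entries. -/
noncomputable def ofEnt (f : ℤ → ℤ → R) (hf : ∀ c, ∃ B, ∀ m, m < B → f m c = 0) :
    Matrix (Fin K) (Fin K) (LaurentSeries R) := Matrix.of fun a b =>
  HahnSeries.ofSuppBddBelow (fun q : ℤ => f (((a : ℕ) : ℤ) + 1 + K * q) (((b : ℕ) : ℤ) + 1)) (by
    obtain ⟨B, hB⟩ := hf (((b : ℕ) : ℤ) + 1)
    -- For negative `q` one has `K q ≤ q`, so a lower bound on positions gives a lower bound on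
    -- exponents; the minimum with `0` restricts to this case.
    refine ⟨min 0 (B - K), fun q hq => ?_⟩
    by_contra hlt
    rw [not_le] at hlt
    refine hq (hB _ ?_)
    have h1 := a.2
    have h2 : (K : ℤ) * q ≤ 1 * q := mul_le_mul_of_nonpos_right (by have := a.pos; omega) (by omega)
    omega)

/-- Only the columns of the window are read from `f`; the others follow by periodicity, so `f`
itself need not be periodic. -/
theorem ent_ofEnt (f : ℤ → ℤ → R) (hf : ∀ c, ∃ B, ∀ m, m < B → f m c = 0)
    (m : ℤ) {c : ℤ} (h1 : 1 ≤ c) (h2 : c ≤ K) : ent hK (ofEnt hK f hf) m c = f m c := by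
  obtain ⟨a, q, rfl⟩ := AffinePerm.exists_window hK m
  have hc := winRow_add hK c
  have hq : (c - 1) / (K : ℤ) = 0 := Int.ediv_eq_zero_of_lt (by omega) (by omega)
  rw [hq] at hc
  rw [← hc, ent_window, mul_zero, add_zero, sub_zero]
  simp only [ofEnt, Matrix.of_apply, HahnSeries.coeff_ofSuppBddBelow]

theorem exists_shift_window (hK : 0 < K) (c : ℤ) : ∃ t : ℤ, 1 ≤ c + K * t ∧ c + K * t ≤ K := by
  obtain ⟨b, j, rfl⟩ := AffinePerm.exists_window hK c
  refine ⟨-j, ?_, ?_⟩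
  · rw [mul_neg]; omega
  · rw [mul_neg]; have := b.2; omega

theorem ent_sub (A B : Matrix (Fin K) (Fin K) (LaurentSeries R)) (m c : ℤ) :
    ent hK (A - B) m c = ent hK A m c - ent hK B m c := rfl

/-! ### The Iwahori subgroup in terms of entries -/

/-- A position `m` lies before a column `c` of the window exactly when its exponent is negative, or
is zero with the row above the diagonal. Integrality and triangularity at `ε = 0` thus become one
triangularity condition. -/
theorem mem_lieIwahori_iff (A : Matrix (Fin K) (Fin K) (LaurentSeries R)) :
    A ∈ lieIwahori K R ↔ ∀ m c : ℤ, 1 ≤ c → c ≤ K → m < c → ent hK A m c = 0 := by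
  constructor
  · rintro ⟨B, rfl, hB⟩ m c h1 h2 hmc
    obtain ⟨b, j, rfl⟩ := AffinePerm.exists_window hK c
    obtain ⟨a, q, rfl⟩ := AffinePerm.exists_window hK m
    have hj : j = 0 := by
      have h3 := b.2
      by_contra hcon
      rcases lt_or_gt_of_ne hcon with h | h
      · have : (K : ℤ) * j ≤ K * (-1) := mul_le_mul_of_nonneg_left (by omega) (by omega)
        omega
      · have : (K : ℤ) * 1 ≤ K * j := mul_le_mul_of_nonneg_left (by omega) (by omega)
        omega
    subst hj
    rw [ent_window, Matrix.map_apply, sub_zero, PowerSeries.coeff_coe]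
    split_ifs with hq
    · rfl
    · have hq0 : q = 0 := by
        by_contra hcon
        have : (K : ℤ) * 1 ≤ K * q := mul_le_mul_of_nonneg_left (by omega) (by omega)
        have := b.2
        omega
      subst hq0
      have hab : a < b := by rw [Fin.lt_def]; omega
      have := hB (i := a) (j := b) hab
      simpa using this
  · intro h
    have hneg : ∀ a b q, q < 0 → (A a b).coeff q = 0 := by
      intro a b q hq
      have h1 := h (((a : ℕ) : ℤ) + 1 + K * q) (((b : ℕ) : ℤ) + 1 + K * 0) (by omega)
        (by have := b.2; omega) (by
          have : (K : ℤ) * q ≤ K * (-1) := mul_le_mul_of_nonneg_left (by omega) (by omega)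
          have := a.2
          omega)
      rwa [ent_window, sub_zero] at h1
    refine ⟨Matrix.of fun a b => PowerSeries.mk fun n => (A a b).coeff n, ?_, ?_⟩
    · ext a b q
      rw [Matrix.map_apply, PowerSeries.coeff_coe, Matrix.of_apply]
      split_ifs with hq
      · exact hneg a b q hq
      · rw [PowerSeries.coeff_mk, Int.natAbs_of_nonneg (not_lt.1 hq)]
    · intro a b hab
      have h1 := h (((a : ℕ) : ℤ) + 1 + K * 0) (((b : ℕ) : ℤ) + 1 + K * 0) (by omega)
        (by have := b.2; omega) (by
          have h2 : a < b := hab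
          rw [Fin.lt_def] at h2
          omega)
      rw [ent_window, sub_zero] at h1
      simpa [Matrix.map_apply, ← PowerSeries.coeff_zero_eq_constantCoeff_apply] using h1

theorem ent_eq_zero_of_mem_lieIwahori {A : Matrix (Fin K) (Fin K) (LaurentSeries R)}
    (hA : A ∈ lieIwahori K R) {m c : ℤ} (hmc : m < c) : ent hK A m c = 0 := by
  obtain ⟨b, j, rfl⟩ := AffinePerm.exists_window hK c
  rw [← ent_shift hK A _ _ (-j)]
  refine (mem_lieIwahori_iff hK A).1 hA _ _ ?_ ?_ (by omega)
  · rw [mul_neg]; omega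
  · rw [mul_neg]; have := b.2; omega

theorem ent_mul_eq_sum_Icc {A B : Matrix (Fin K) (Fin K) (LaurentSeries R)}
    (hA : A ∈ lieIwahori K R) (hB : B ∈ lieIwahori K R) (m c : ℤ) :
    ent hK (A * B) m c = ∑ l ∈ Finset.Icc c m, ent hK A m l * ent hK B l c := by
  refine ent_mul hK A B m c _ fun l hl => ?_
  rw [Finset.mem_Icc, not_and_or, not_le, not_le] at hl
  rcases hl with hl | hl
  · rw [ent_eq_zero_of_mem_lieIwahori hK hB hl, mul_zero]
  · rw [ent_eq_zero_of_mem_lieIwahori hK hA hl, zero_mul]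

theorem mul_mem_lieIwahori (hK : 0 < K) {A B : Matrix (Fin K) (Fin K) (LaurentSeries R)}
    (hA : A ∈ lieIwahori K R) (hB : B ∈ lieIwahori K R) : A * B ∈ lieIwahori K R := by
  refine (mem_lieIwahori_iff hK _).2 fun m c _ _ hmc => ?_
  rw [ent_mul_eq_sum_Icc hK hA hB, Finset.Icc_eq_empty (not_le.2 hmc), Finset.sum_empty]

theorem mem_lieIwahori_of_mem_iwahori {g : LoopGL K R} (hg : g ∈ iwahori K R) :
    (g : Matrix (Fin K) (Fin K) (LaurentSeries R)) ∈ lieIwahori K R := by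
  obtain ⟨h, hh, rfl⟩ := hg
  exact ⟨h, rfl, hh⟩

theorem isUnit_ent_of_mem_iwahori {g : LoopGL K R} (hg : g ∈ iwahori K R) (m : ℤ) :
    IsUnit (ent hK (g : Matrix (Fin K) (Fin K) (LaurentSeries R)) m m) := by
  have h1 := mem_lieIwahori_of_mem_iwahori hg
  have h2 := mem_lieIwahori_of_mem_iwahori (inv_mem hg)
  have h3 := ent_mul_eq_sum_Icc hK h1 h2 m m
  rw [← Units.val_mul, mul_inv_cancel, Units.val_one, ent_one, if_pos rfl, Finset.Icc_self,
    Finset.sum_singleton] at h3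
  exact IsUnit.of_mul_eq_one _ h3.symm

/-- At `ε = 0` the determinant is the product of the diagonal entries, and a power series with unit
constant term is a unit. -/
theorem exists_iwahori_of_isUnit {A : Matrix (Fin K) (Fin K) (LaurentSeries R)}
    (hA : A ∈ lieIwahori K R) (hd : ∀ m, IsUnit (ent hK A m m)) :
    ∃ g ∈ iwahori K R, (g : Matrix (Fin K) (Fin K) (LaurentSeries R)) = A := by
  obtain ⟨B, rfl, hB⟩ := hA
  have hdet : IsUnit B.det := by
    rw [PowerSeries.isUnit_iff_constantCoeff, RingHom.map_det]
    have e : (PowerSeries.constantCoeff (R := R)).mapMatrix B =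
        B.map (PowerSeries.constantCoeff (R := R)) := rfl
    rw [e, Matrix.det_of_isLowerTriangular _ hB, IsUnit.prod_univ_iff]
    intro a
    have := hd (((a : ℕ) : ℤ) + 1 + K * 0)
    rw [ent_window, sub_zero, Matrix.map_apply, PowerSeries.coeff_coe] at this
    simpa using this
  refine ⟨Matrix.GeneralLinearGroup.map (HahnSeries.ofPowerSeries ℤ R)
    (Matrix.GeneralLinearGroup.mk'' B hdet), ⟨_, ?_, rfl⟩, ?_⟩
  · exact hB
  · rfl

end Entries

/-! ### Reduction of vectors modulo the lattices of a flag -/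

/-- The displacement is periodic. The bound yields starting points for eliminations and finiteness
of the coordinate set. -/
theorem AffinePerm.exists_abs_sub_le {K : ℕ} (hK : 0 < K) (ω : AffinePerm K) :
    ∃ C : ℤ, ∀ m, |ω.toPerm m - m| ≤ C := by
  refine ⟨∑ a : Fin K, |ω.toPerm ((a : ℕ) + 1) - ((a : ℕ) + 1)|, fun m => ?_⟩
  obtain ⟨a, q, rfl⟩ := AffinePerm.exists_window hK m
  rw [ω.shift_mul, add_sub_add_right_eq_sub]
  exact Finset.single_le_sum (f := fun a : Fin K => |ω.toPerm ((a : ℕ) + 1) - ((a : ℕ) + 1)|)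
    (fun _ _ => abs_nonneg _) (Finset.mem_univ a)

section Reduction

variable {R : Type*} [CommRing R]

/-- Coefficients of the reduction of `v` modulo vectors `f m'` with leading coefficient at `m'`,
for `m'` satisfying `P`: quotients at positions satisfying `P`, remainders at the others. -/
noncomputable def reduceCoeff (F : ℤ → ℤ → R) (d : ℤ → R) (P : ℤ → Prop) [DecidablePred P] (v : ℤ → R) (lo : ℤ)
    (m : ℤ) : R :=
  d m * (v m - ∑ m' ∈ (Finset.Ico lo m).attach,
    if P m'.1 then reduceCoeff F d P v lo m'.1 * F m'.1 m else 0)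
termination_by (m - lo).toNat
decreasing_by
  have := Finset.mem_Ico.1 m'.2
  omega

theorem reduceCoeff_eq (F : ℤ → ℤ → R) (d : ℤ → R) (P : ℤ → Prop) [DecidablePred P] (v : ℤ → R) (lo m : ℤ) :
    reduceCoeff F d P v lo m = d m * (v m - ∑ m' ∈ Finset.Ico lo m,
      if P m' then reduceCoeff F d P v lo m' * F m' m else 0) := by
  rw [reduceCoeff, Finset.sum_attach (Finset.Ico lo m)
    (fun m' => if P m' then reduceCoeff F d P v lo m' * F m' m else 0)]

theorem reduceCoeff_of_lt (F : ℤ → ℤ → R) (d : ℤ → R) (P : ℤ → Prop) [DecidablePred P] (v : ℤ → R) {lo m : ℤ}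
    (hv : v m = 0) (hm : m ≤ lo) : reduceCoeff F d P v lo m = 0 := by
  rw [reduceCoeff_eq, Finset.Ico_eq_empty (not_lt.2 hm), hv]
  simp

/-- The recursion uses ring operations only. This gives naturality in the ring; `n` bounds the
distance to `lo` for the induction. -/
theorem map_reduceCoeff {S : Type*} [CommRing S] (f : R →+* S) (F : ℤ → ℤ → R) (d : ℤ → R)
    (P : ℤ → Prop) [DecidablePred P] (v : ℤ → R) (lo : ℤ) (n : ℕ) : ∀ m : ℤ, m < lo + n →
    f (reduceCoeff F d P v lo m) =
      reduceCoeff (fun a b => f (F a b)) (fun a => f (d a)) P (fun a => f (v a)) lo m := by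
  induction n with
  | zero =>
    intro m hm
    rw [reduceCoeff_eq, reduceCoeff_eq, Finset.Ico_eq_empty (by omega)]
    simp
  | succ n ih =>
    intro m hm
    rw [reduceCoeff_eq, reduceCoeff_eq, map_mul, map_sub, map_sum]
    congr 2
    refine Finset.sum_congr rfl fun m' hm' => ?_
    rw [Finset.mem_Ico] at hm'
    split_ifs
    · rw [map_mul, ih m' (by omega)]
    · rw [map_zero]

/-- At a quotient position the newest term was chosen, by means of the inverse `d m` of the leading
coefficient, to make up exactly what the earlier terms leave. -/
theorem sum_reduceCoeff (F : ℤ → ℤ → R) (d : ℤ → R) (P : ℤ → Prop) [DecidablePred P] (v : ℤ → R) (lo m : ℤ)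
    (hd : d m * F m m = 1) (hv : ∀ m, m < lo → v m = 0) (hP : P m) :
    ∑ m' ∈ Finset.Icc lo m, (if P m' then reduceCoeff F d P v lo m' * F m' m else 0) = v m := by
  by_cases h : lo ≤ m
  · rw [← Finset.Ico_insert_right h, Finset.sum_insert (by simp), if_pos hP]
    nth_rewrite 1 [reduceCoeff_eq]
    linear_combination (v m - ∑ m' ∈ Finset.Ico lo m,
      if P m' then reduceCoeff F d P v lo m' * F m' m else 0) * hd
  · rw [Finset.Icc_eq_empty h, Finset.sum_empty, hv m (by omega)]

theorem sum_reduceCoeff_of_not (F : ℤ → ℤ → R) (d : ℤ → R) (P : ℤ → Prop) [DecidablePred P] (v : ℤ → R) (lo m : ℤ)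
    (hv : ∀ m, m < lo → v m = 0) (hP : ¬ P m) :
    d m * (v m - ∑ m' ∈ Finset.Icc lo m,
      (if P m' then reduceCoeff F d P v lo m' * F m' m else 0)) = reduceCoeff F d P v lo m := by
  by_cases h : lo ≤ m
  · rw [← Finset.Ico_insert_right h, Finset.sum_insert (by simp), if_neg hP, zero_add,
      ← reduceCoeff_eq]
  · rw [Finset.Icc_eq_empty h, Finset.sum_empty, hv m (by omega),
      reduceCoeff_of_lt _ _ _ _ (hv m (by omega)) (by omega)]
    simp

variable {K : ℕ} (hK : 0 < K) (ω : AffinePerm K)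

/-- The column `A e_c` has its leading coefficient at position `ω c`. -/
def IsLeading (A : Matrix (Fin K) (Fin K) (LaurentSeries R)) : Prop :=
  ∀ c m, m < ω.toPerm c → ent hK A m c = 0

variable {hK ω}

/-- Indexing the columns of `G` by their leading positions cuts the sum off at `m` from above. -/
theorem IsLeading.ent_mul {G W : Matrix (Fin K) (Fin K) (LaurentSeries R)}
    (hG : IsLeading hK ω G) {lo i : ℤ} (hW : ∀ l, ω.toPerm l < lo → ent hK W l i = 0) (m : ℤ) :
    ent hK (G * W) m i =
      ∑ m' ∈ Finset.Icc lo m, ent hK G m (ω.toPerm.symm m') * ent hK W (ω.toPerm.symm m') i := by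
  rw [AffineSpringer.ent_mul hK G W m i ((Finset.Icc lo m).map ω.toPerm.symm.toEmbedding),
    Finset.sum_map]
  · rfl
  · intro l hl
    rw [Finset.mem_map_equiv, Equiv.symm_symm, Finset.mem_Icc, not_and_or, not_le, not_le] at hl
    rcases hl with hl | hl
    · rw [hW l hl, mul_zero]
    · rw [hG l m hl, zero_mul]

/-- Division with remainder of the `i`-th column of `V` by the columns `l ≥ i` of `G`. Leading
positions are distinct and bounded below, so elimination proceeds upwards: `W` collects the
quotients, and up to the factors `d m` the remainder lives at the positions `m` with `ω⁻¹ m < i`. -/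
theorem IsLeading.exists_reduction {G : Matrix (Fin K) (Fin K) (LaurentSeries R)}
    (hG : IsLeading hK ω G) (d : ℤ → R) (hd : ∀ m, d m * ent hK G m (ω.toPerm.symm m) = 1)
    (V : Matrix (Fin K) (Fin K) (LaurentSeries R)) (lo : ℤ → ℤ)
    (hV : ∀ i m, m < lo i → ent hK V m i = 0) :
    ∃ W : Matrix (Fin K) (Fin K) (LaurentSeries R), ∀ i : ℤ, 1 ≤ i → i ≤ K →
      (∀ l, l < i → ent hK W l i = 0) ∧
      (∀ l, i ≤ l → ent hK W l i = reduceCoeff (fun a b => ent hK G b (ω.toPerm.symm a)) d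
        (fun m => i ≤ ω.toPerm.symm m) (fun m => ent hK V m i) (lo i) (ω.toPerm l)) ∧
      (∀ m, i ≤ ω.toPerm.symm m → ent hK (G * W) m i = ent hK V m i) ∧
      (∀ m, ω.toPerm.symm m < i → d m * (ent hK V m i - ent hK (G * W) m i) =
        reduceCoeff (fun a b => ent hK G b (ω.toPerm.symm a)) d
        (fun m => i ≤ ω.toPerm.symm m) (fun m => ent hK V m i) (lo i) m) := by
  set c : ℤ → ℤ → R := fun i => reduceCoeff (fun a b => ent hK G b (ω.toPerm.symm a)) d
        (fun m => i ≤ ω.toPerm.symm m) (fun m => ent hK V m i) (lo i) with hc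
  set W := ofEnt hK (fun l i => if i ≤ l then c i (ω.toPerm l) else 0)
    (fun i => ⟨i, fun l hl => if_neg (not_le.2 hl)⟩) with hW
  have hWe : ∀ l i : ℤ, 1 ≤ i → i ≤ K →
      ent hK W l i = if i ≤ l then c i (ω.toPerm l) else 0 := fun l i h1 h2 =>
    ent_ofEnt hK _ _ l h1 h2
  have hsum : ∀ i : ℤ, 1 ≤ i → i ≤ K → ∀ m, ent hK (G * W) m i = ∑ m' ∈ Finset.Icc (lo i) m,
      (if i ≤ ω.toPerm.symm m' then c i m' * ent hK G m (ω.toPerm.symm m') else 0) := by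
    intro i h1 h2 m
    rw [hG.ent_mul (lo := lo i)]
    · refine Finset.sum_congr rfl fun m' _ => ?_
      rw [hWe _ _ h1 h2, Equiv.apply_symm_apply]
      split_ifs
      · rw [mul_comm]
      · rw [mul_zero]
    · intro l hl
      rw [hWe _ _ h1 h2]
      split_ifs
      · exact reduceCoeff_of_lt _ _ _ _ (hV _ _ hl) hl.le
      · rfl
  refine ⟨W, fun i h1 h2 => ⟨fun l hl => ?_, fun l hl => ?_, fun m hm => ?_, fun m hm => ?_⟩⟩
  · rw [hWe _ _ h1 h2, if_neg (not_le.2 hl)]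
  · rw [hWe _ _ h1 h2, if_pos hl]
  · rw [hsum i h1 h2]
    exact sum_reduceCoeff (fun a b => ent hK G b (ω.toPerm.symm a)) d (fun m => i ≤ ω.toPerm.symm m)
      (fun m => ent hK V m i) (lo i) m (hd m) (hV i) hm
  · rw [hsum i h1 h2]
    exact sum_reduceCoeff_of_not (fun a b => ent hK G b (ω.toPerm.symm a)) d
      (fun m => i ≤ ω.toPerm.symm m)
      (fun m => ent hK V m i) (lo i) m (hV i) (not_le.2 hm)

/-- Uniqueness of the quotients: at the lowest leading position with a nonzero quotient, nothing
else could cancel it. -/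
theorem IsLeading.eq_zero_of_ent_mul {G W : Matrix (Fin K) (Fin K) (LaurentSeries R)}
    (hG : IsLeading hK ω G) (hd : ∀ m, IsUnit (ent hK G m (ω.toPerm.symm m))) {i : ℤ}
    (hW : ∀ l, l < i → ent hK W l i = 0)
    (hGW : ∀ m, i ≤ ω.toPerm.symm m → ent hK (G * W) m i = 0) (l : ℤ) : ent hK W l i = 0 := by
  obtain ⟨C, hC⟩ := ω.exists_abs_sub_le hK
  have hlo : ∀ l, ω.toPerm l < i - C → ent hK W l i = 0 := by
    intro l hl
    apply hW
    have := (abs_le.1 (hC l)).1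
    omega
  have key : ∀ n : ℕ, ∀ m, m < i - C + n → ent hK W (ω.toPerm.symm m) i = 0 := by
    intro n
    induction n with
    | zero =>
      intro m hm
      exact hlo _ (by simpa using hm)
    | succ n ih =>
      intro m hm
      by_cases hmi : i ≤ ω.toPerm.symm m
      · by_cases hm2 : i - C ≤ m
        · have h := hGW m hmi
          rw [hG.ent_mul hlo, ← Finset.Ico_insert_right hm2, Finset.sum_insert (by simp),
            Finset.sum_eq_zero, add_zero] at h
          · exact (hd m).mul_right_eq_zero.1 h
          · intro m' hm'
            rw [Finset.mem_Ico] at hm'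
            rw [ih m' (by omega), mul_zero]
        · exact ih m (by omega)
      · exact hW _ (not_le.1 hmi)
  have := key (ω.toPerm l - (i - C) + 1).toNat (ω.toPerm l) (by omega)
  rwa [Equiv.symm_apply_apply] at this

/-! ### Normal forms of the points of a Schubert cell -/

variable (hK ω)

/-- The normal form of a matrix representing a point of the Schubert cell of `ω`. -/
structure IsNormal (A : Matrix (Fin K) (Fin K) (LaurentSeries R)) : Prop where
  leading : IsLeading hK ω A
  diag : ∀ c, ent hK A (ω.toPerm c) c = 1
  reduced : ∀ c m, ω.toPerm c < m → c ≤ ω.toPerm.symm m → ent hK A m c = 0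

theorem AffinePerm.symm_shift_mul (ω : AffinePerm K) (m t : ℤ) :
    ω.toPerm.symm (m + K * t) = ω.toPerm.symm m + K * t := ω.inv.shift_mul m t

theorem isNormal_of_window {A : Matrix (Fin K) (Fin K) (LaurentSeries R)}
    (h : ∀ c m : ℤ, 1 ≤ c → c ≤ K → (m < ω.toPerm c → ent hK A m c = 0) ∧
      ent hK A (ω.toPerm c) c = 1 ∧
      (ω.toPerm c < m → c ≤ ω.toPerm.symm m → ent hK A m c = 0)) : IsNormal hK ω A := by
  refine ⟨fun c m hm => ?_, fun c => ?_, fun c m h1 h2 => ?_⟩ <;>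
    obtain ⟨t, ht1, ht2⟩ := exists_shift_window hK c
  · rw [← ent_shift hK A m c t]
    refine (h _ _ ht1 ht2).1 ?_
    rw [ω.shift_mul]; omega
  · rw [← ent_shift hK A _ c t, ← ω.shift_mul]
    exact (h _ 0 ht1 ht2).2.1
  · rw [← ent_shift hK A m c t]
    refine (h _ _ ht1 ht2).2.2 ?_ ?_
    · rw [ω.shift_mul]; omega
    · rw [ω.symm_shift_mul]; omega

theorem ent_toGL (m c : ℤ) : ent hK (ω.toGL R : Matrix (Fin K) (Fin K) (LaurentSeries R)) m c =
    if m = ω.toPerm c then 1 else 0 := ent_colMatrix hK _ ω.shift_mul m c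

theorem ent_mul_toGL (A : Matrix (Fin K) (Fin K) (LaurentSeries R)) (m c : ℤ) :
    ent hK (A * (ω.toGL R : Matrix (Fin K) (Fin K) (LaurentSeries R))) m c =
      ent hK A m (ω.toPerm c) := by
  rw [ent_mul hK _ _ m c {ω.toPerm c}, Finset.sum_singleton, ent_toGL, if_pos rfl, mul_one]
  intro l hl
  rw [Finset.mem_singleton] at hl
  rw [ent_toGL, if_neg hl, mul_zero]

theorem ent_toGL_mul (A : Matrix (Fin K) (Fin K) (LaurentSeries R)) (m c : ℤ) :
    ent hK ((ω.toGL R : Matrix (Fin K) (Fin K) (LaurentSeries R)) * A) m c =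
      ent hK A (ω.toPerm.symm m) c := by
  rw [ent_mul hK _ _ m c {ω.toPerm.symm m}, Finset.sum_singleton, ent_toGL, if_pos (by simp),
    one_mul]
  intro l hl
  rw [Finset.mem_singleton, eq_comm, Equiv.symm_apply_eq] at hl
  rw [ent_toGL, if_neg hl, zero_mul]

variable {hK ω}

theorem IsNormal.isUnit_ent {A : Matrix (Fin K) (Fin K) (LaurentSeries R)}
    (hA : IsNormal hK ω A) (m : ℤ) : ent hK A m (ω.toPerm.symm m) = 1 := by
  have := hA.diag (ω.toPerm.symm m)
  rwa [Equiv.apply_symm_apply] at this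

/-- Reindexing columns by leading positions, that is, multiplying by `ω⁻¹` on the right, turns a
normal form into a lower triangular matrix with diagonal `1`. -/
theorem IsNormal.exists_mem_schubertCell {A : Matrix (Fin K) (Fin K) (LaurentSeries R)}
    (hA : IsNormal hK ω A) : ∃ g : LoopGL K R,
      (g : Matrix (Fin K) (Fin K) (LaurentSeries R)) = A ∧
      (QuotientGroup.mk g : AffFlag K R) ∈ schubertCell R ω := by
  have hinv : ((ω.toGL R)⁻¹ : LoopGL K R) = ω.inv.toGL R := by
    rw [inv_eq_iff_mul_eq_one]
    apply Units.ext
    exact ω.colMatrix_mul_inv R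
  obtain ⟨a, ha, ha'⟩ := exists_iwahori_of_isUnit hK
    (A := A * (ω.inv.toGL R : Matrix (Fin K) (Fin K) (LaurentSeries R))) (by
      refine (mem_lieIwahori_iff hK _).2 fun m c _ _ hmc => ?_
      rw [ent_mul_toGL]
      refine hA.leading _ _ ?_
      change m < ω.toPerm (ω.toPerm.symm c)
      simpa using hmc) (by
      intro m
      rw [ent_mul_toGL]
      exact (hA.isUnit_ent m).symm ▸ isUnit_one)
  refine ⟨a * ω.toGL R, ?_, a, ha, 1, one_mem _, by rw [mul_one]⟩
  rw [Units.val_mul, ha', Matrix.mul_assoc, ← hinv, ← Units.val_mul, inv_mul_cancel,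
    Units.val_one, Matrix.mul_one]

/-- The right factor in `a ω b'` does not affect the coset. For `G = a ω`, dividing `e_{ω i}` by the
`i`-th lattice gives an element of that lattice which agrees with `e_{ω i}` at all positions `ω l`
with `l ≥ i`: this is the reduced basis vector. -/
theorem exists_isNormal_of_mem_schubertCell (hK : 0 < K) {x : AffFlag K R}
    (hx : x ∈ schubertCell R ω) : ∃ g : LoopGL K R, x = QuotientGroup.mk g ∧
      IsNormal hK ω (g : Matrix (Fin K) (Fin K) (LaurentSeries R)) := by
  obtain ⟨a, ha, b', hb', rfl⟩ := hx
  have haL := mem_lieIwahori_of_mem_iwahori ha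
  choose u hu using fun m => isUnit_ent_of_mem_iwahori hK ha m
  set G : Matrix (Fin K) (Fin K) (LaurentSeries R) := (a * ω.toGL R : LoopGL K R).val with hGdef
  have hGe : ∀ m c, ent hK G m c =
      ent hK (a : Matrix (Fin K) (Fin K) (LaurentSeries R)) m (ω.toPerm c) := fun m c => by
    rw [hGdef, Units.val_mul, ent_mul_toGL]
  have hG : IsLeading hK ω G := fun c m hm => by
    rw [hGe]
    exact ent_eq_zero_of_mem_lieIwahori hK haL hm
  obtain ⟨W, hW⟩ := hG.exists_reduction (fun m => ((u m)⁻¹ : Rˣ)) (fun m => by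
    rw [hGe, Equiv.apply_symm_apply, ← hu, Units.inv_mul])
    (ω.toGL R : Matrix (Fin K) (Fin K) (LaurentSeries R)) (fun i => ω.toPerm i) (fun i m hm => by
      rw [ent_toGL, if_neg (by omega)])
  have hWlo : ∀ i l : ℤ, 1 ≤ i → i ≤ K → ω.toPerm l < ω.toPerm i → ent hK W l i = 0 := by
    intro i l h1 h2 hl
    rcases lt_or_ge l i with h | h
    · exact (hW i h1 h2).1 l h
    · rw [(hW i h1 h2).2.1 l h]
      refine reduceCoeff_of_lt _ _ _ _ ?_ hl.le
      rw [ent_toGL, if_neg (by omega)]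
  have hGW : ∀ i m : ℤ, 1 ≤ i → i ≤ K → m < ω.toPerm i → ent hK (G * W) m i = 0 := by
    intro i m h1 h2 hm
    rw [hG.ent_mul (hWlo i · h1 h2), Finset.Icc_eq_empty (by omega), Finset.sum_empty]
  have hGW1 : ∀ i : ℤ, 1 ≤ i → i ≤ K → ent hK (G * W) (ω.toPerm i) i = 1 := by
    intro i h1 h2
    rw [(hW i h1 h2).2.2.1 _ (by simp), ent_toGL, if_pos rfl]
  -- The quotient matrix is the change of basis. Its diagonal entries are units, since times the
  -- leading coefficients of `G` they give the leading coefficients `1` of `G * W`.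
  obtain ⟨b, hb, hbW⟩ := exists_iwahori_of_isUnit hK (A := W)
    ((mem_lieIwahori_iff hK W).2 fun m c h1 h2 hmc => (hW c h1 h2).1 m hmc) (by
      intro m
      obtain ⟨t, ht1, ht2⟩ := exists_shift_window hK m
      rw [← ent_shift hK W m m t]
      have h := hGW1 _ ht1 ht2
      rw [hG.ent_mul (hWlo _ · ht1 ht2), Finset.Icc_self, Finset.sum_singleton,
        Equiv.symm_apply_apply, mul_comm] at h
      exact IsUnit.of_mul_eq_one _ h)
  refine ⟨a * ω.toGL R * b, ?_, ?_⟩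
  · rw [QuotientGroup.eq]
    have : (a * ω.toGL R * b')⁻¹ * (a * ω.toGL R * b) = b'⁻¹ * b := by group
    rw [this]
    exact mul_mem (inv_mem hb') hb
  · refine isNormal_of_window hK ω fun c m h1 h2 => ?_
    rw [Units.val_mul, hbW]
    refine ⟨hGW c m h1 h2, hGW1 c h1 h2, fun h3 h4 => ?_⟩
    rw [(hW c h1 h2).2.2.1 m h4, ent_toGL, if_neg h3.ne']

/-- The difference `g' - g = g (g⁻¹ g' - 1)` vanishes at every position where a quotient is read
off, so uniqueness of the quotients forces `g⁻¹ g' = 1`. -/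
theorem IsNormal.eq_of_mk_eq {g g' : LoopGL K R}
    (hg : IsNormal hK ω (g : Matrix (Fin K) (Fin K) (LaurentSeries R)))
    (hg' : IsNormal hK ω (g' : Matrix (Fin K) (Fin K) (LaurentSeries R)))
    (h : (QuotientGroup.mk g : AffFlag K R) = QuotientGroup.mk g') : g = g' := by
  rw [QuotientGroup.eq] at h
  have hL := mem_lieIwahori_of_mem_iwahori h
  have key : ∀ l i, ent hK ((g⁻¹ * g' : LoopGL K R).val - 1) l i = 0 := by
    intro l i
    refine hg.leading.eq_zero_of_ent_mul (fun m => (hg.isUnit_ent m).symm ▸ isUnit_one)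
      (fun l hl => ?_) (fun m hm => ?_) l
    · rw [ent_sub, ent_eq_zero_of_mem_lieIwahori hK hL hl, ent_one, if_neg hl.ne, sub_zero]
    · rw [mul_sub, mul_one, ← Units.val_mul, mul_inv_cancel_left, ent_sub]
      rcases lt_trichotomy m (ω.toPerm i) with h1 | rfl | h1
      · rw [hg.leading _ _ h1, hg'.leading _ _ h1, sub_zero]
      · rw [hg.diag, hg'.diag, sub_self]
      · rw [hg.reduced _ _ h1 hm, hg'.reduced _ _ h1 hm, sub_zero]
  have : ((g⁻¹ * g' : LoopGL K R) : Matrix (Fin K) (Fin K) (LaurentSeries R)) = 1 := by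
    refine ent_injective hK fun m c _ _ => ?_
    rw [← sub_eq_zero, ← ent_sub, key]
  have h2 : g⁻¹ * g' = 1 := Units.ext this
  exact (inv_mul_eq_one.1 h2)

theorem mk_mem_springerFiber_iff (hK : 0 < K) (γ : Matrix (Fin K) (Fin K) (LaurentSeries R))
    (g : LoopGL K R) : (QuotientGroup.mk g : AffFlag K R) ∈ springerFiber γ ↔
      (↑g⁻¹ : Matrix (Fin K) (Fin K) (LaurentSeries R)) * γ *
        (g : Matrix (Fin K) (Fin K) (LaurentSeries R)) ∈ lieIwahori K R := by
  refine ⟨fun ⟨g', h1, h2⟩ => ?_, fun h => ⟨g, rfl, h⟩⟩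
  rw [QuotientGroup.eq] at h1
  have h3 := mul_mem_lieIwahori hK (mul_mem_lieIwahori hK (mem_lieIwahori_of_mem_iwahori h1) h2)
    (mem_lieIwahori_of_mem_iwahori (inv_mem h1))
  have e1 : (↑g⁻¹ : Matrix (Fin K) (Fin K) (LaurentSeries R)) =
      (g⁻¹ * g').val * (↑g'⁻¹ : Matrix (Fin K) (Fin K) (LaurentSeries R)) := by
    rw [← Units.val_mul, mul_inv_cancel_right]
  have e2 : (g : Matrix (Fin K) (Fin K) (LaurentSeries R)) =
      (g' : Matrix (Fin K) (Fin K) (LaurentSeries R)) * ((g⁻¹ * g')⁻¹).val := by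
    rw [← Units.val_mul, mul_inv_rev, inv_inv, mul_inv_cancel_left]
  rw [e1, e2]
  simpa only [Matrix.mul_assoc] using h3

/-- A normal form lies in the Springer fiber of the permutation `γ` if and only if the remainders
of the vectors `γ f_i` modulo the `i`-th lattice vanish. -/
theorem IsNormal.mem_springerFiber_iff {g : LoopGL K R}
    (hg : IsNormal hK ω (g : Matrix (Fin K) (Fin K) (LaurentSeries R))) (γ : AffinePerm K)
    (hγ : ∀ m, γ.toPerm.symm m < m) :
    (QuotientGroup.mk g : AffFlag K R) ∈ springerFiber (γ.toGL R).val ↔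
      ∀ i m : ℤ, 1 ≤ i → i ≤ K → ω.toPerm.symm m < i →
        reduceCoeff (fun a b => ent hK (g : Matrix (Fin K) (Fin K) (LaurentSeries R)) b
          (ω.toPerm.symm a)) 1 (fun m => i ≤ ω.toPerm.symm m)
          (fun m => ent hK (g : Matrix (Fin K) (Fin K) (LaurentSeries R)) (γ.toPerm.symm m) i)
          (ω.toPerm i) m = 0 := by
  set G : Matrix (Fin K) (Fin K) (LaurentSeries R) := g.val with hGdef
  rw [mk_mem_springerFiber_iff hK]
  -- Since `γ` raises positions, column `i` of `γ G` is still zero before `ω i`. If `g⁻¹ γ g` is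
  -- lower triangular, it must be the quotient matrix `W`, and the division leaves no remainder;
  -- conversely, zero remainders give `γ G = G W` with `W` lower triangular.
  obtain ⟨W, hW⟩ := hg.leading.exists_reduction 1 (fun m => by
    rw [hg.isUnit_ent, Pi.one_apply, one_mul]) ((γ.toGL R).val * G) (fun i => ω.toPerm i)
    (fun i m hm => by rw [ent_toGL_mul]; exact hg.leading _ _ (lt_trans (hγ m) hm))
  simp only [ent_toGL_mul, Pi.one_apply, one_mul] at hW
  have hmul : G * ((↑g⁻¹ : Matrix (Fin K) (Fin K) (LaurentSeries R)) * (γ.toGL R).val * G) =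
      (γ.toGL R).val * G := by
    rw [Matrix.mul_assoc, ← Matrix.mul_assoc, hGdef, ← Units.val_mul, mul_inv_cancel,
      Units.val_one, Matrix.one_mul]
  constructor
  · intro h i m h1 h2 hm
    have key : ∀ l, ent hK (W - (↑g⁻¹ : Matrix (Fin K) (Fin K) (LaurentSeries R)) *
        (γ.toGL R).val * G) l i = 0 := by
      refine fun l => hg.leading.eq_zero_of_ent_mul (fun m => (hg.isUnit_ent m).symm ▸ isUnit_one)
        (fun l hl => ?_) (fun m hm => ?_) l
      · rw [ent_sub, (hW i h1 h2).1 l hl, ent_eq_zero_of_mem_lieIwahori hK h hl, sub_zero]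
      · rw [mul_sub, hmul, ent_sub, (hW i h1 h2).2.2.1 m hm, ent_toGL_mul, sub_self]
    have h3 : ent hK (G * W) m i - ent hK ((γ.toGL R).val * G) m i = 0 := by
      rw [← ent_sub, ← hmul, ← mul_sub, ent_mul hK _ _ _ _ ∅, Finset.sum_empty]
      intro l _
      rw [key, mul_zero]
    rw [← (hW i h1 h2).2.2.2 m hm, ← ent_toGL_mul, ← neg_sub, h3, neg_zero]
  · intro h
    have h3 : G * W = (γ.toGL R).val * G := by
      refine ent_injective hK fun m c h1 h2 => ?_
      rw [ent_toGL_mul]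
      rcases lt_or_ge (ω.toPerm.symm m) c with hm | hm
      · have h4 := (hW c h1 h2).2.2.2 m hm
        have h5 := h c m h1 h2 hm
        exact (sub_eq_zero.1 (h4.trans h5)).symm
      · exact (hW c h1 h2).2.2.1 m hm
    rw [Matrix.mul_assoc, ← h3, ← Matrix.mul_assoc, hGdef, ← Units.val_mul, inv_mul_cancel,
      Units.val_one, Matrix.one_mul]
    exact (mem_lieIwahori_iff hK W).2 fun m c h1 h2 hmc => (hW c h1 h2).1 m hmc

end Reduction

/-! ### Triangular systems of equations -/

/-- Iterating `T` from zero, the value at `e` is stable after `μ e + 1` steps; uniqueness is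
induction on `μ`. -/
theorem existsUnique_of_triangular {ι R : Type*} [Zero R] (μ : ι → ℕ)
    (T : ι → (ι → R) → R)
    (hT : ∀ e x y, (∀ e', μ e' < μ e → x e' = y e') → T e x = T e y) :
    ∃! x : ι → R, ∀ e, x e = T e x := by
  set it : ℕ → ι → R := fun n => Nat.rec (fun _ => 0) (fun _ x e => T e x) n with hit
  have hs : ∀ n e, it (n + 1) e = T e (it n) := fun n e => rfl
  have stable : ∀ N e, μ e = N → ∀ n, N < n → it n e = it (N + 1) e := by
    intro N
    induction N using Nat.strong_induction_on with
    | _ N ih =>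
      intro e he n hn
      obtain ⟨n, rfl⟩ : ∃ n', n = n' + 1 := ⟨n - 1, by omega⟩
      rw [hs, hs]
      refine hT e _ _ fun e' he' => ?_
      rw [ih (μ e') (by omega) e' rfl n (by omega), ih (μ e') (by omega) e' rfl N (by omega)]
  refine ⟨fun e => it (μ e + 1) e, fun e => ?_, fun y hy => ?_⟩
  · change it (μ e + 1) e = _
    rw [hs]
    exact hT e _ _ fun e' he' => stable _ e' rfl _ he'
  · funext e
    induction h : μ e using Nat.strong_induction_on generalizing e with
    | _ N ih =>
      subst h
      rw [hs, hy e]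
      refine hT e _ _ fun e' he' => ?_
      rw [ih _ he' e' rfl]
      exact (stable _ e' rfl _ he').symm

/-- A weight function which makes the equations of the fixed flags of `γ` in the cell of `ω`
triangular. -/
structure Weight {K : ℕ} (ω γ : AffinePerm K) where
  p : ℤ → ℤ
  strictMono : StrictMono p
  b : ℤ
  p_shift : ∀ m t : ℤ, p (m + K * t) = p m + b * t
  row : ℤ → ℕ
  row_shift : ∀ m t : ℤ, row (m + K * t) = row m
  M : ℕ
  row_le : ∀ m, row m ≤ M
  a : ℤ
  a_pos : 0 < a
  symm_lt : ∀ m, ω.toPerm.symm m < ω.toPerm.symm (γ.toPerm m)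
  p_add_le : ∀ m, p m + a ≤ p (γ.toPerm m)
  row_lt : ∀ m, p (γ.toPerm m) = p m + a → row m < row (γ.toPerm m)
  -- Where `γ` raises the weight by more than `a`, this keeps the equation at `γ m` from having
  -- anything to determine: it is relevant only for leading positions from `γ m` on, where it is
  -- automatic.
  singular : ∀ m m0, p m + a < p (γ.toPerm m) →
    ω.toPerm.symm (γ.toPerm m) < ω.toPerm.symm m0 → γ.toPerm m ≤ m0

/-! ### Triangularity of the Springer equations -/

namespace Weight

variable {K : ℕ} {ω γ : AffinePerm K} (w : Weight ω γ)

theorem lt_apply (w : Weight ω γ) (m : ℤ) : m < γ.toPerm m := by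
  rw [← w.strictMono.lt_iff_lt]
  have := w.p_add_le m
  have := w.a_pos
  omega

theorem symm_lt_self (w : Weight ω γ) (m : ℤ) : γ.toPerm.symm m < m := by
  have := w.lt_apply (γ.toPerm.symm m)
  rwa [Equiv.apply_symm_apply] at this

theorem p_symm_le (m : ℤ) : w.p (γ.toPerm.symm m) ≤ w.p m - w.a := by
  have := w.p_add_le (γ.toPerm.symm m)
  rw [Equiv.apply_symm_apply] at this
  omega

/-- The lexicographic combination of the weight and the row. -/
def measure (m0 m : ℤ) : ℤ := (w.p m - w.p m0) * (w.M + 1) + (w.M - w.row m0)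

theorem measure_shift (m0 m t : ℤ) : w.measure (m0 + K * t) (m + K * t) = w.measure m0 m := by
  simp only [measure, w.p_shift, w.row_shift]
  ring

theorem measure_pos {m0 m : ℤ} (h : m0 ≤ m) : 0 ≤ w.measure m0 m := by
  have h1 := w.strictMono.monotone h
  have h2 := w.row_le m0
  have : 0 ≤ (w.p m - w.p m0) * (w.M + 1) := mul_nonneg (by omega) (by omega)
  unfold measure
  omega

theorem measure_lt_of_weight_lt {m0 m m0' m' : ℤ} (h : w.p m - w.p m0 < w.p m' - w.p m0') :
    w.measure m0 m < w.measure m0' m' := by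
  have h2 := w.row_le m0
  have h3 := w.row_le m0'
  have : (w.p m - w.p m0 + 1) * (w.M + 1) ≤ (w.p m' - w.p m0') * (w.M + 1) :=
    mul_le_mul_of_nonneg_right (by omega) (by omega)
  unfold measure
  rw [add_mul] at this
  omega

theorem measure_lt_of_row_lt {m0 m m0' m' : ℤ} (h : w.p m - w.p m0 = w.p m' - w.p m0')
    (hr : w.row m0' < w.row m0) : w.measure m0 m < w.measure m0' m' := by
  unfold measure
  rw [h]
  omega

variable {R : Type*} [CommRing R]

/-- The coefficients of the reduction of `γ f` for the vector `f` with leading position `m0`. -/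
noncomputable def gammaCoeff (ω γ : AffinePerm K) (F : ℤ → ℤ → R) (m0 : ℤ) : ℤ → R :=
  reduceCoeff F 1 (fun m => ω.toPerm.symm m0 ≤ ω.toPerm.symm m)
    (fun m => F m0 (γ.toPerm.symm m)) m0

theorem gammaCoeff_eq (F : ℤ → ℤ → R) (m0 m : ℤ) : gammaCoeff ω γ F m0 m =
    F m0 (γ.toPerm.symm m) - ∑ m' ∈ Finset.Ico m0 m,
      if ω.toPerm.symm m0 ≤ ω.toPerm.symm m' then gammaCoeff ω γ F m0 m' * F m' m else 0 := by
  unfold gammaCoeff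
  rw [reduceCoeff_eq, Pi.one_apply, one_mul]

/-- Going back along `γ` lowers the weight by at least `a`, hence to a position before `m0`, where
`f` vanishes. So the quotient of `γ f` begins at `γ m0`, and any other nonzero coefficient has
weight above `p m0 + a`. -/
theorem gammaCoeff_eq_zero {F : ℤ → ℤ → R} (hF : ∀ m0 m, m < m0 → F m0 m = 0) {m0 m : ℤ}
    (h1 : w.p m ≤ w.p m0 + w.a) (h2 : m ≠ γ.toPerm m0) : gammaCoeff ω γ F m0 m = 0 := by
  have key : ∀ n : ℕ, ∀ m, m < m0 + n → w.p m ≤ w.p m0 + w.a → m ≠ γ.toPerm m0 →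
      gammaCoeff ω γ F m0 m = 0 := by
    intro n
    induction n with
    | zero =>
      intro m hm _ _
      rw [gammaCoeff_eq, Finset.Ico_eq_empty (by omega), Finset.sum_empty, sub_zero]
      refine hF _ _ ?_
      have := w.symm_lt_self m
      omega
    | succ n ih =>
      intro m hm h1 h2
      rw [gammaCoeff_eq, Finset.sum_eq_zero, sub_zero]
      · apply hF
        refine lt_of_le_of_ne ?_ fun h => h2 ((Equiv.symm_apply_eq _).1 h)
        rw [← w.strictMono.le_iff_le]
        have := w.p_symm_le m
        omega
      · intro m' hm'
        rw [Finset.mem_Ico] at hm'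
        have h3 := w.strictMono hm'.2
        rw [ih m' (by omega) (by omega), zero_mul, ite_self]
        rintro rfl
        have := w.p_add_le m0
        omega
  exact key (m - m0 + 1).toNat m (by omega) h1 h2

/-- Weights are subadditive along the recursion: a nonzero quotient at `m'` already uses up at least
`a`, so the factor `F m' m` has weight difference at most `p m - p m0 - a`. -/
theorem gammaCoeff_congr {F F' : ℤ → ℤ → R} (hF : ∀ m0 m, m < m0 → F m0 m = 0)
    (hF' : ∀ m0 m, m < m0 → F' m0 m = 0) (hd : ∀ m, F m m = F' m m) {W : ℤ}
    (h : ∀ m1 m2, m1 < m2 → w.p m2 - w.p m1 < W → F m1 m2 = F' m1 m2) {m0 m : ℤ}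
    (hm : w.p m - w.p m0 - w.a < W) : gammaCoeff ω γ F m0 m = gammaCoeff ω γ F' m0 m := by
  have h' : ∀ m1 m2, w.p m2 - w.p m1 < W → F m1 m2 = F' m1 m2 := by
    intro m1 m2 h12
    rcases lt_trichotomy m1 m2 with hlt | rfl | hlt
    · exact h _ _ hlt h12
    · exact hd _
    · rw [hF _ _ hlt, hF' _ _ hlt]
  have key : ∀ n : ℕ, ∀ m, m < m0 + n → w.p m - w.p m0 - w.a < W →
      gammaCoeff ω γ F m0 m = gammaCoeff ω γ F' m0 m := by
    intro n
    induction n with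
    | zero =>
      intro m hm hW
      rw [gammaCoeff_eq, gammaCoeff_eq, Finset.Ico_eq_empty (by omega), Finset.sum_empty,
        Finset.sum_empty]
      have := w.symm_lt_self m
      rw [hF _ _ (by omega), hF' _ _ (by omega)]
    | succ n ih =>
      intro m hm hW
      rw [gammaCoeff_eq, gammaCoeff_eq]
      congr 1
      · apply h'
        have := w.p_symm_le m
        omega
      · refine Finset.sum_congr rfl fun m' hm' => ?_
        rw [Finset.mem_Ico] at hm'
        have h3 := w.strictMono hm'.2
        rw [← ih m' (by omega) (by omega)]
        rcases lt_or_ge (w.p m') (w.p m0 + w.a) with hlt | hge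
        · rw [w.gammaCoeff_eq_zero hF hlt.le, zero_mul, zero_mul]
          rintro rfl
          have := w.p_add_le m0
          omega
        · rw [h' m' m (by omega)]
  exact key (m - m0 + 1).toNat m (by omega) hm

/-- An excessive jump at `j` would give `γ j ≤ m0 < j`, although `γ` raises positions. -/
theorem p_apply_eq (w : Weight ω γ) {m0 j : ℤ} (hj : m0 < j)
    (hu : ω.toPerm.symm (γ.toPerm j) < ω.toPerm.symm m0) : w.p (γ.toPerm j) = w.p j + w.a := by
  by_contra hcon
  have h1 := w.singular j m0 (lt_of_le_of_ne (w.p_add_le j) (Ne.symm hcon)) hu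
  have h2 := w.lt_apply j
  omega

/-- The unknown `F m0 j` enters its own equation with coefficient one. Of the terms subtracted, only
`F (γ m0) (γ j)` can have the same weight difference, and then its leading position lies in a later
row, so its measure is smaller. -/
theorem sub_gammaCoeff_congr {F F' : ℤ → ℤ → R} (hF : ∀ m0 m, m < m0 → F m0 m = 0)
    (hF' : ∀ m0 m, m < m0 → F' m0 m = 0) (hd : ∀ m, F m m = F' m m) {m0 j : ℤ} (hj : m0 < j)
    (hu : ω.toPerm.symm (γ.toPerm j) < ω.toPerm.symm m0)
    (h : ∀ m1 m2, m1 < m2 → w.measure m1 m2 < w.measure m0 j → F m1 m2 = F' m1 m2) :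
    F m0 j - gammaCoeff ω γ F m0 (γ.toPerm j) = F' m0 j - gammaCoeff ω γ F' m0 (γ.toPerm j) := by
  have hp := w.p_apply_eq hj hu
  have hW : ∀ m1 m2, m1 < m2 → w.p m2 - w.p m1 < w.p j - w.p m0 → F m1 m2 = F' m1 m2 :=
    fun m1 m2 h1 h2 => h m1 m2 h1 (w.measure_lt_of_weight_lt h2)
  rw [gammaCoeff_eq, gammaCoeff_eq, Equiv.symm_apply_apply, sub_sub_cancel, sub_sub_cancel]
  refine Finset.sum_congr rfl fun m' hm' => ?_
  rw [Finset.mem_Ico] at hm'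
  have h3 := w.strictMono hm'.2
  rw [← w.gammaCoeff_congr hF hF' hd hW (m0 := m0) (m := m') (by omega)]
  by_cases hg : m' = γ.toPerm m0
  · have h4 : F m' (γ.toPerm j) = F' m' (γ.toPerm j) := by
      apply h _ _ hm'.2
      have h5 := w.p_add_le m0
      rw [← hg] at h5
      rcases eq_or_lt_of_le h5 with h6 | h6
      · refine w.measure_lt_of_row_lt (by omega) ?_
        rw [hg]
        exact w.row_lt m0 (by rw [← hg]; exact h6.symm)
      · exact w.measure_lt_of_weight_lt (by omega)
    rw [h4]
  · rcases le_or_gt (w.p m') (w.p m0 + w.a) with hle | hgt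
    · rw [w.gammaCoeff_eq_zero hF hle hg, zero_mul, zero_mul]
    · rw [hW m' (γ.toPerm j) hm'.2 (by omega)]

end Weight

/-! ### The coordinates of a Schubert cell -/

section Coordinates

variable {K : ℕ} (hK : 0 < K) (ω γ : AffinePerm K)

/-- The positions of the coordinates of the Schubert cell of `ω`. -/
def cellIndex : Set (ℤ × ℤ) :=
  {e | 1 ≤ e.1 ∧ e.1 ≤ K ∧ ω.toPerm e.1 < e.2 ∧ ω.toPerm.symm e.2 < e.1}

/-- The positions of the coordinates of the intersection with the fixed flags of `γ`. -/
def freeIndex : Set (ℤ × ℤ) :=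
  {e | e ∈ cellIndex ω ∧ e.1 < ω.toPerm.symm (γ.toPerm e.2)}

variable {ω γ} in
theorem freeIndex_subset : freeIndex ω γ ⊆ cellIndex ω := fun _ he => he.1

theorem cellIndex_finite (hK : 0 < K) : (cellIndex ω).Finite := by
  obtain ⟨C, hC⟩ := ω.exists_abs_sub_le hK
  refine ((Finset.Icc (1 : ℤ) K) ×ˢ (Finset.Icc (1 - C) (K + C))).finite_toSet.subset ?_
  rintro ⟨i, m⟩ ⟨h1, h2, h3, h4⟩
  simp only at h1 h2 h3 h4
  have h5 := (abs_le.1 (hC i)).1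
  have h6 := (abs_le.1 (hC (ω.toPerm.symm m))).2
  rw [Equiv.apply_symm_apply] at h6
  simp only [Finset.coe_product, Finset.coe_Icc, Set.mem_prod, Set.mem_Icc]
  omega

variable {R : Type*} [CommRing R]

open Classical in
/-- The normal form with given coordinates. -/
noncomputable def cellMatrix (x : cellIndex ω → R) : Matrix (Fin K) (Fin K) (LaurentSeries R) :=
  ofEnt hK (fun m c => if m = ω.toPerm c then 1 else
    if h : (c, m) ∈ cellIndex ω then x ⟨(c, m), h⟩ else 0) (fun c => ⟨ω.toPerm c, fun m hm => by
      rw [if_neg hm.ne, dif_neg]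
      exact fun h => absurd h.2.2.1 (not_lt.2 hm.le)⟩)

open Classical in
theorem ent_cellMatrix (x : cellIndex ω → R) (m : ℤ) {c : ℤ} (h1 : 1 ≤ c) (h2 : c ≤ K) :
    ent hK (cellMatrix hK ω x) m c = if m = ω.toPerm c then 1 else
      if h : (c, m) ∈ cellIndex ω then x ⟨(c, m), h⟩ else 0 :=
  ent_ofEnt hK _ _ m h1 h2

theorem ent_cellMatrix_index (x : cellIndex ω → R) (e : cellIndex ω) :
    ent hK (cellMatrix hK ω x) e.1.2 e.1.1 = x e := by
  rw [ent_cellMatrix hK ω x _ e.2.1 e.2.2.1, if_neg e.2.2.2.1.ne', dif_pos e.2]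

theorem isNormal_cellMatrix (x : cellIndex ω → R) : IsNormal hK ω (cellMatrix hK ω x) := by
  refine isNormal_of_window hK ω fun c m h1 h2 => ⟨fun h => ?_, ?_, fun h h' => ?_⟩
  · rw [ent_cellMatrix hK ω x _ h1 h2, if_neg h.ne, dif_neg]
    exact fun h3 => absurd h3.2.2.1 (not_lt.2 h.le)
  · rw [ent_cellMatrix hK ω x _ h1 h2, if_pos rfl]
  · rw [ent_cellMatrix hK ω x _ h1 h2, if_neg h.ne', dif_neg]
    exact fun h3 => absurd h3.2.2.2 (not_lt.2 h')

theorem IsNormal.eq_cellMatrix {A : Matrix (Fin K) (Fin K) (LaurentSeries R)}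
    (hA : IsNormal hK ω A) : A = cellMatrix hK ω fun e => ent hK A e.1.2 e.1.1 := by
  refine ent_injective hK fun m c h1 h2 => ?_
  rw [ent_cellMatrix hK ω _ _ h1 h2]
  split_ifs with h h'
  · rw [h, hA.diag]
  · rfl
  · rcases lt_or_gt_of_ne h with h3 | h3
    · exact hA.leading _ _ h3
    · exact hA.reduced _ _ h3 (not_lt.1 fun h4 => h' ⟨h1, h2, h3, h4⟩)

/-- The coefficients of the basis of the flag, indexed by their leading positions. -/
noncomputable def cellCoeff (x : cellIndex ω → R) (m0 m : ℤ) : R :=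
  ent hK (cellMatrix hK ω x) m (ω.toPerm.symm m0)

theorem cellCoeff_of_lt (x : cellIndex ω → R) {m0 m : ℤ} (h : m < m0) :
    cellCoeff hK ω x m0 m = 0 :=
  (isNormal_cellMatrix hK ω x).leading _ _ (by simpa using h)

theorem cellCoeff_self (x : cellIndex ω → R) (m : ℤ) : cellCoeff hK ω x m m = 1 :=
  (isNormal_cellMatrix hK ω x).isUnit_ent m

theorem cellCoeff_index (x : cellIndex ω → R) (e : cellIndex ω) :
    cellCoeff hK ω x (ω.toPerm e.1.1) e.1.2 = x e := by
  rw [cellCoeff, Equiv.symm_apply_apply, ent_cellMatrix_index]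

theorem exists_cellCoeff_shift (m0 m : ℤ) : ∃ t i : ℤ, 1 ≤ i ∧ i ≤ K ∧
    ω.toPerm i = m0 + K * t ∧ ∀ {R : Type _} [CommRing R] (x : cellIndex ω → R),
      cellCoeff hK ω x m0 m = ent hK (cellMatrix hK ω x) (m + K * t) i := by
  obtain ⟨t, h1, h2⟩ := exists_shift_window hK (ω.toPerm.symm m0)
  refine ⟨t, _, h1, h2, ?_, fun x => ?_⟩
  · rw [ω.shift_mul, Equiv.apply_symm_apply]
  · rw [ent_shift]; rfl

/-- After a shift into the window, which preserves the measure, a coefficient is a constant or a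
single coordinate. -/
theorem cellCoeff_congr (w : Weight ω γ) {x y : cellIndex ω → R} {W : ℤ}
    (h : ∀ e : cellIndex ω, w.measure (ω.toPerm e.1.1) e.1.2 < W → x e = y e) {m0 m : ℤ}
    (hm : w.measure m0 m < W) : cellCoeff hK ω x m0 m = cellCoeff hK ω y m0 m := by
  obtain ⟨t, i, h1, h2, h3, h4⟩ := exists_cellCoeff_shift hK ω m0 m
  rw [h4, h4, ent_cellMatrix hK ω _ _ h1 h2, ent_cellMatrix hK ω _ _ h1 h2]
  split_ifs with h5 h6
  · rfl
  · apply h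
    simp only
    rwa [h3, w.measure_shift]
  · rfl

theorem map_cellCoeff {S : Type*} [CommRing S] (f : R →+* S) (x : cellIndex ω → R) (m0 m : ℤ) :
    f (cellCoeff hK ω x m0 m) = cellCoeff hK ω (fun e => f (x e)) m0 m := by
  obtain ⟨t, h1, h2⟩ := exists_shift_window hK (ω.toPerm.symm m0)
  simp only [cellCoeff]
  rw [← ent_shift hK _ m _ t, ← ent_shift hK (cellMatrix hK ω fun e => f (x e)) m _ t,
    ent_cellMatrix hK ω _ _ h1 h2, ent_cellMatrix hK ω _ _ h1 h2]
  split_ifs <;> simp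

theorem map_cellMatrix {S : Type*} [CommRing S] (f : R →+* S) (x : cellIndex ω → R) :
    (cellMatrix hK ω x).map (laurentMap f) = cellMatrix hK ω fun e => f (x e) := by
  refine ent_injective hK fun m c h1 h2 => ?_
  have := map_cellCoeff hK ω f x (ω.toPerm c) m
  rwa [cellCoeff, cellCoeff, Equiv.symm_apply_apply] at this

/-- The element of the loop group with given coordinates. -/
noncomputable def cellGL (x : cellIndex ω → R) : LoopGL K R :=
  (isNormal_cellMatrix hK ω x).exists_mem_schubertCell.choose

theorem cellGL_val (x : cellIndex ω → R) : (cellGL hK ω x).val = cellMatrix hK ω x :=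
  (isNormal_cellMatrix hK ω x).exists_mem_schubertCell.choose_spec.1

theorem mk_cellGL_mem (x : cellIndex ω → R) :
    (QuotientGroup.mk (cellGL hK ω x) : AffFlag K R) ∈ schubertCell R ω :=
  (isNormal_cellMatrix hK ω x).exists_mem_schubertCell.choose_spec.2

theorem isNormal_cellGL (x : cellIndex ω → R) : IsNormal hK ω (cellGL hK ω x).val :=
  (cellGL_val hK ω x).symm ▸ isNormal_cellMatrix hK ω x

theorem mk_cellGL_injective {x y : cellIndex ω → R}
    (h : (QuotientGroup.mk (cellGL hK ω x) : AffFlag K R) = QuotientGroup.mk (cellGL hK ω y)) :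
    x = y := by
  have h1 := (isNormal_cellGL hK ω x).eq_of_mk_eq (isNormal_cellGL hK ω y) h
  funext e
  rw [← ent_cellMatrix_index hK ω x, ← ent_cellMatrix_index hK ω y, ← cellGL_val, ← cellGL_val, h1]

theorem exists_cellGL_of_mem {z : AffFlag K R} (hz : z ∈ schubertCell R ω) :
    ∃ x : cellIndex ω → R, z = QuotientGroup.mk (cellGL hK ω x) := by
  obtain ⟨g, rfl, hg⟩ := exists_isNormal_of_mem_schubertCell hK hz
  refine ⟨fun e => ent hK g.val e.1.2 e.1.1, ?_⟩
  congr 1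
  apply Units.ext
  rw [cellGL_val]
  exact hg.eq_cellMatrix hK ω

theorem map_mk_cellGL {S : Type*} [CommRing S] (f : R →+* S) (x : cellIndex ω → R) :
    AffFlag.map f (QuotientGroup.mk (cellGL hK ω x)) =
      QuotientGroup.mk (cellGL hK ω fun e => f (x e)) := by
  change (QuotientGroup.mk (Matrix.GeneralLinearGroup.map (laurentMap f) (cellGL hK ω x)) :
    AffFlag K S) = _
  congr 1
  apply Units.ext
  rw [cellGL_val, ← map_cellMatrix, ← cellGL_val]
  rfl

variable {γ}

/-- Every position is `γ j`. When `ω i < j`, growth of `ω⁻¹` along `γ` makes `(i, j)` a coordinate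
position that is not free; the other equations are automatic. -/
theorem mk_cellGL_mem_springerFiber_iff (w : Weight ω γ) (x : cellIndex ω → R) :
    (QuotientGroup.mk (cellGL hK ω x) : AffFlag K R) ∈ springerFiber (γ.toGL R).val ↔
      ∀ e : cellIndex ω, e.1 ∉ freeIndex ω γ →
        Weight.gammaCoeff ω γ (cellCoeff hK ω x) (ω.toPerm e.1.1) (γ.toPerm e.1.2) = 0 := by
  have key : ∀ i m, Weight.gammaCoeff ω γ (cellCoeff hK ω x) (ω.toPerm i) m =
      reduceCoeff (fun a b => ent hK (cellGL hK ω x).val b (ω.toPerm.symm a)) 1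
        (fun m => i ≤ ω.toPerm.symm m)
        (fun m => ent hK (cellGL hK ω x).val (γ.toPerm.symm m) i) (ω.toPerm i) m := by
    intro i m
    simp only [Weight.gammaCoeff, Equiv.symm_apply_apply, cellGL_val]
    congr 1
    simp only [cellCoeff, Equiv.symm_apply_apply]
  rw [(isNormal_cellGL hK ω x).mem_springerFiber_iff γ w.symm_lt_self]
  simp only [← key]
  constructor
  · intro h e he
    refine h _ _ e.2.1 e.2.2.1 ?_
    by_contra hcon
    refine he ⟨e.2, lt_of_le_of_ne (not_lt.1 hcon) fun h1 => ?_⟩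
    have h2 := e.2.2.2.1
    have h3 := w.lt_apply e.1.2
    rw [eq_comm, Equiv.symm_apply_eq] at h1
    omega
  · intro h i m h1 h2 hm
    obtain ⟨j, rfl⟩ := γ.toPerm.surjective m
    rcases lt_or_ge (ω.toPerm i) j with hj | hj
    · exact h ⟨(i, j), h1, h2, hj, (w.symm_lt j).trans hm⟩ fun hf => absurd hf.2 (not_lt.2 hm.le)
    · refine w.gammaCoeff_eq_zero (fun _ _ => cellCoeff_of_lt hK ω x) ?_ ?_
      · by_cases hs : w.p (γ.toPerm j) = w.p j + w.a
        · rw [hs]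
          have := w.strictMono.monotone hj
          omega
        · have h3 := w.singular j (ω.toPerm i) (lt_of_le_of_ne (w.p_add_le j) (Ne.symm hs))
            (by simpa using hm)
          have := w.strictMono.monotone h3
          have := w.a_pos
          omega
      · intro heq
        have h3 := w.symm_lt (ω.toPerm i)
        rw [← heq, Equiv.symm_apply_apply] at h3
        omega

/-- Adding the unknown to both sides turns each equation at a non-free position into a fixed point
equation whose right side involves only coordinates of smaller measure. -/
theorem existsUnique_coordinates (w : Weight ω γ) (φ : freeIndex ω γ → R) : ∃! x : cellIndex ω → R,
    (∀ e (he : e ∈ freeIndex ω γ), x ⟨e, freeIndex_subset he⟩ = φ ⟨e, he⟩) ∧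
    (QuotientGroup.mk (cellGL hK ω x) : AffFlag K R) ∈ springerFiber (γ.toGL R).val := by
  classical
  have h := existsUnique_of_triangular (R := R)
    (fun e : cellIndex ω => (w.measure (ω.toPerm e.1.1) e.1.2).toNat)
    (fun e x => if he : e.1 ∈ freeIndex ω γ then φ ⟨e.1, he⟩ else
      cellCoeff hK ω x (ω.toPerm e.1.1) e.1.2 -
        Weight.gammaCoeff ω γ (cellCoeff hK ω x) (ω.toPerm e.1.1) (γ.toPerm e.1.2)) (by
    intro e x y hxy
    split_ifs with he
    · rfl
    · have hu : ω.toPerm.symm (γ.toPerm e.1.2) < ω.toPerm.symm (ω.toPerm e.1.1) := by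
        rw [Equiv.symm_apply_apply]
        by_contra hcon
        refine he ⟨e.2, lt_of_le_of_ne (not_lt.1 hcon) fun h1 => ?_⟩
        have h2 := e.2.2.2.1
        have h3 := w.lt_apply e.1.2
        rw [eq_comm, Equiv.symm_apply_eq] at h1
        omega
      refine w.sub_gammaCoeff_congr (fun _ _ => cellCoeff_of_lt hK ω x)
        (fun _ _ => cellCoeff_of_lt hK ω y)
        (fun m => by rw [cellCoeff_self, cellCoeff_self]) e.2.2.2.1 hu fun m1 m2 _ hm => ?_
      refine cellCoeff_congr hK ω γ w (fun e' he' => hxy e' ?_) hm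
      -- Measures of coordinates are nonnegative, so truncation to natural numbers preserves the
      -- strict comparison.
      have := w.measure_pos e'.2.2.2.1.le
      omega)
  have hiff : ∀ x : cellIndex ω → R, ((∀ e (he : e ∈ freeIndex ω γ), x ⟨e, freeIndex_subset he⟩ = φ ⟨e, he⟩) ∧
      (QuotientGroup.mk (cellGL hK ω x) : AffFlag K R) ∈ springerFiber (γ.toGL R).val) ↔
      ∀ e, x e = if he : e.1 ∈ freeIndex ω γ then φ ⟨e.1, he⟩ else
      cellCoeff hK ω x (ω.toPerm e.1.1) e.1.2 -
        Weight.gammaCoeff ω γ (cellCoeff hK ω x) (ω.toPerm e.1.1) (γ.toPerm e.1.2) := by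
    intro x
    rw [mk_cellGL_mem_springerFiber_iff hK ω w]
    constructor
    · rintro ⟨h1, h2⟩ e
      split_ifs with he
      · exact h1 e.1 he
      · rw [h2 e he, sub_zero, cellCoeff_index]
    · intro h
      refine ⟨fun e he => ?_, fun e he => ?_⟩
      · rw [h ⟨e, freeIndex_subset he⟩, dif_pos he]
      · have := h e
        rw [dif_neg he, cellCoeff_index] at this
        exact sub_eq_self.1 this.symm
  simpa only [hiff] using h

/-- The fixed flags of `γ` in the Schubert cell of `ω` form an affine space. -/
theorem Weight.isoAffineSpace (hK : 0 < K) (w : Weight ω γ) : IsoAffineSpace (K := K)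
    (fun R _ _ => springerFiber (γ.toGL R).val ∩ schubertCell R ω) (freeIndex ω γ).ncard := by
  have hfin : (freeIndex ω γ).Finite := (cellIndex_finite ω hK).subset freeIndex_subset
  have : Finite (freeIndex ω γ) := hfin
  obtain ⟨E⟩ : Nonempty (freeIndex ω γ ≃ Fin (freeIndex ω γ).ncard) :=
    ⟨Finite.equivFinOfCardEq (Nat.card_coe_set_eq _)⟩
  set sol : (R : Type) → [CommRing R] → (Fin (freeIndex ω γ).ncard → R) → cellIndex ω → R :=
    fun R _ x => (existsUnique_coordinates hK ω w fun e => x (E e)).choose with hsol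
  have sol1 : ∀ (R : Type) [CommRing R] (x : Fin (freeIndex ω γ).ncard → R),
      ∀ e (he : e ∈ freeIndex ω γ), sol R x ⟨e, freeIndex_subset he⟩ = x (E ⟨e, he⟩) := fun R _ x =>
    (existsUnique_coordinates hK ω w fun e => x (E e)).choose_spec.1.1
  have sol2 : ∀ (R : Type) [CommRing R] (x : Fin (freeIndex ω γ).ncard → R),
      (QuotientGroup.mk (cellGL hK ω (sol R x)) : AffFlag K R) ∈ springerFiber (γ.toGL R).val :=
    fun R _ x => (existsUnique_coordinates hK ω w fun e => x (E e)).choose_spec.1.2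
  have sol3 : ∀ (R : Type) [CommRing R] (x : Fin (freeIndex ω γ).ncard → R)
      (y : cellIndex ω → R), (∀ e (he : e ∈ freeIndex ω γ), y ⟨e, freeIndex_subset he⟩ = x (E ⟨e, he⟩)) →
      (QuotientGroup.mk (cellGL hK ω y) : AffFlag K R) ∈ springerFiber (γ.toGL R).val →
      y = sol R x := fun R _ x y h1 h2 =>
    (existsUnique_coordinates hK ω w fun e => x (E e)).choose_spec.2 y ⟨h1, h2⟩
  refine ⟨fun R _ _ => Equiv.ofBijective (fun x => ⟨QuotientGroup.mk (cellGL hK ω (sol R x)),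
    sol2 R x, mk_cellGL_mem hK ω _⟩) ⟨fun x y hxy => ?_, ?_⟩, ?_⟩
  · have h1 := mk_cellGL_injective hK ω (congrArg Subtype.val hxy)
    funext i
    obtain ⟨⟨e, he⟩, rfl⟩ := E.surjective i
    rw [← sol1 R x e he, ← sol1 R y e he, h1]
  · rintro ⟨z, hz1, hz2⟩
    obtain ⟨y, rfl⟩ := exists_cellGL_of_mem hK ω hz2
    have h := sol3 R (fun i => y ⟨(E.symm i).1, freeIndex_subset (E.symm i).2⟩) y
      (fun e he => by simp only [Equiv.symm_apply_apply]) hz1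
    exact ⟨fun i => y ⟨(E.symm i).1, freeIndex_subset (E.symm i).2⟩,
      Subtype.ext (congrArg (fun y => (QuotientGroup.mk (cellGL hK ω y) : AffFlag K R))
      h.symm)⟩
  · intro R S _ _ _ _ f x
    change AffFlag.map (f : R →+* S) (QuotientGroup.mk (cellGL hK ω (sol R x))) =
      (QuotientGroup.mk (cellGL hK ω (sol S fun i => f (x i))) : AffFlag K S)
    rw [map_mk_cellGL]
    congr 2
    refine sol3 S (fun i => f (x i)) (fun e => f (sol R x e)) (fun e he => ?_) ?_
    · rw [sol1 R x e he]
    · have h1 := (mk_cellGL_mem_springerFiber_iff hK ω w _).1 (sol2 R x)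
      refine (mk_cellGL_mem_springerFiber_iff hK ω w _).2 fun e he => ?_
      have h2 := congrArg (f : R →+* S) (h1 e he)
      rw [map_zero, Weight.gammaCoeff,
        map_reduceCoeff (f : R →+* S) _ _ _ _ _
          (γ.toPerm e.1.2 - ω.toPerm e.1.1 + 1).toNat _ (by omega)] at h2
      rw [← h2, Weight.gammaCoeff]
      simp only [map_cellCoeff, Pi.one_apply, map_one]
      rfl

end Coordinates

/-! ### The area and `pathdinv` of a Dyck path -/

namespace DyckPath

variable {K k : ℕ} (D : DyckPath K k)

/-- The number of north steps with abscissa at most `x`. -/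
def colHeight (x : ℕ) : ℕ := (Finset.univ.filter fun y : Fin K => D.col y ≤ x).card

/-- By monotonicity the rows with abscissa at most `x` form an initial segment. -/
theorem lt_colHeight_iff (x : ℕ) (y : Fin K) : (y : ℕ) < D.colHeight x ↔ D.col y ≤ x := by
  constructor
  · intro h
    by_contra hcon
    have h1 : (Finset.univ.filter fun y : Fin K => D.col y ≤ x) ⊆ Finset.Iio y := by
      intro y' hy'
      rw [Finset.mem_filter] at hy'
      rw [Finset.mem_Iio]
      by_contra hlt
      have := D.mono (not_lt.1 hlt)
      omega
    have h2 := Finset.card_le_card h1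
    rw [Fin.card_Iio] at h2
    unfold colHeight at h
    omega
  · intro h
    have h1 : Finset.Iic y ⊆ (Finset.univ.filter fun y : Fin K => D.col y ≤ x) := by
      intro y' hy'
      rw [Finset.mem_Iic] at hy'
      exact Finset.mem_filter.2 ⟨Finset.mem_univ _, (D.mono hy').trans h⟩
    have h2 := Finset.card_le_card h1
    rw [Fin.card_Iic] at h2
    unfold colHeight
    omega

theorem colHeight_le (x : ℕ) : D.colHeight x ≤ K := by
  simpa [colHeight] using Finset.card_filter_le (Finset.univ : Finset (Fin K)) _

variable {D} {s : ℕ}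

theorem mul_col_le (hK : K = k * s) (hk : 0 < k) (y : Fin K) : s * D.col y ≤ y := by
  have h : k * (s * D.col y) ≤ k * (y : ℕ) := by
    rw [← mul_assoc, ← hK]
    exact D.above y
  exact Nat.le_of_mul_le_mul_left h hk

theorem col_lt (hK : K = k * s) (hk : 0 < k) (y : Fin K) : D.col y < k := by
  have h := mul_col_le hK hk (D := D) y
  have h2 : s * D.col y < s * k := by
    rw [mul_comm s k, ← hK]
    exact lt_of_le_of_lt h y.2
  exact Nat.lt_of_mul_lt_mul_left h2

theorem mul_succ_le_colHeight (hK : K = k * s) (hk : 0 < k) (hs : 0 < s) {x : ℕ}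
    (hx : x < k) : s * (x + 1) ≤ D.colHeight x := by
  have h1 : s * (x + 1) ≤ K := by rw [hK, mul_comm k s]; exact Nat.mul_le_mul_left _ hx
  have h2 : 0 < s * (x + 1) := Nat.mul_pos hs (Nat.succ_pos _)
  have h3 := (D.lt_colHeight_iff x ⟨s * (x + 1) - 1, by omega⟩).2 (by
    have h := mul_col_le hK hk (D := D) ⟨s * (x + 1) - 1, by omega⟩
    simp only at h
    have h4 : s * D.col ⟨s * (x + 1) - 1, by omega⟩ < s * (x + 1) := by omega
    exact Nat.lt_succ_iff.1 (Nat.lt_of_mul_lt_mul_left h4))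
  simp only at h3
  omega

theorem colHeight_last (hK : K = k * s) (hk : 0 < k) : D.colHeight (k - 1) = K := by
  unfold colHeight
  rw [Finset.filter_true_of_mem, Finset.card_univ, Fintype.card_fin]
  intro y _
  have := col_lt hK hk (D := D) y
  omega

variable (D s) in
/-- The level of the end of column `x` of the path with respect to the diagonal. -/
def colLevel (x : ℕ) : ℤ := (D.colHeight x : ℤ) - s * x

variable (D s) in
/-- The level of a north step with respect to the diagonal. -/
def level (a : Fin K) : ℤ := ((a : ℕ) : ℤ) - s * D.col a

theorem sum_ite_lt (m : ℕ) (hm : m ≤ K) (t : ℤ) (ht : 0 ≤ t) :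
    ∑ a : Fin K, (if (a : ℕ) < m ∧ ((a : ℕ) : ℤ) < t then (1 : ℤ) else 0) = min (m : ℤ) t := by
  rw [Finset.sum_boole]
  have : (Finset.univ.filter fun a : Fin K => (a : ℕ) < m ∧ ((a : ℕ) : ℤ) < t).card =
      (Finset.range (min m t.toNat)).card := by
    refine Finset.card_bij (fun a _ => (a : ℕ)) ?_ ?_ ?_
    · intro a ha
      simp only [Finset.mem_filter, Finset.mem_univ, true_and, Finset.mem_range] at ha ⊢
      omega
    · intro a _ b _ h
      exact Fin.ext h
    · intro b hb
      rw [Finset.mem_range] at hb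
      refine ⟨⟨b, by omega⟩, ?_, rfl⟩
      simp only [Finset.mem_filter, Finset.mem_univ, true_and]
      omega
  rw [this, Finset.card_range]
  omega

/-- The north steps in one column have consecutive levels, starting at the end level of the previous
column minus `s` (at `0` in the first column). Each column thus contributes a difference of two
minima, and the sum is regrouped by end levels. -/
theorem sum_ite_level_lt (t : ℤ) (ht : 0 ≤ t) (x : ℕ) :
    ∑ a : Fin K, (if D.col a ≤ x ∧ D.level s a < t then (1 : ℤ) else 0) =
      min (D.colLevel s x) t +
        ∑ p ∈ Finset.range x, (min (D.colLevel s p) t - min (D.colLevel s p - s) t) := by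
  induction x with
  | zero =>
    rw [Finset.range_zero, Finset.sum_empty, add_zero]
    have e : D.colLevel s 0 = (D.colHeight 0 : ℤ) := by simp [colLevel]
    rw [e, ← sum_ite_lt _ (D.colHeight_le 0) t ht]
    refine Finset.sum_congr rfl fun a _ => ?_
    simp only [lt_colHeight_iff]
    refine if_congr ?_ rfl rfl
    refine and_congr_right fun h => ?_
    have : D.col a = 0 := by omega
    simp [level, this]
  | succ x ih =>
    rw [Finset.sum_range_succ]
    have ht' : 0 ≤ t + s * (x + 1) := by positivity
    have h1 := sum_ite_lt (D.colHeight (x + 1)) (D.colHeight_le _) (t + s * (x + 1)) ht'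
    have h2 := sum_ite_lt (D.colHeight x) (D.colHeight_le _) (t + s * (x + 1)) ht'
    have h3 : ∑ a : Fin K, (if D.col a ≤ x + 1 ∧ D.level s a < t then (1 : ℤ) else 0) =
        ∑ a : Fin K, (if D.col a ≤ x ∧ D.level s a < t then (1 : ℤ) else 0) +
        (∑ a : Fin K, (if (a : ℕ) < D.colHeight (x + 1) ∧
            ((a : ℕ) : ℤ) < t + s * (x + 1) then (1 : ℤ) else 0) -
          ∑ a : Fin K, (if (a : ℕ) < D.colHeight x ∧
            ((a : ℕ) : ℤ) < t + s * (x + 1) then (1 : ℤ) else 0)) := by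
      rw [← Finset.sum_sub_distrib, ← Finset.sum_add_distrib]
      refine Finset.sum_congr rfl fun a _ => ?_
      simp only [lt_colHeight_iff]
      by_cases hx : D.col a ≤ x
      · have hx' : D.col a ≤ x + 1 := by omega
        simp only [hx, hx', true_and]
        omega
      · by_cases hx' : D.col a = x + 1
        · have : D.level s a < t ↔ ((a : ℕ) : ℤ) < t + s * (x + 1) := by
            unfold level
            rw [hx']
            push_cast
            constructor <;> intro h <;> linarith
          simp [hx', this]
        · have hx'' : ¬ D.col a ≤ x + 1 := by omega
          simp [hx, hx'']
    rw [h3, ih, h1, h2]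
    have e1 : (D.colHeight (x + 1) : ℤ) = D.colLevel s (x + 1) + s * (x + 1) := by
      unfold colLevel; push_cast; ring
    have e2 : (D.colHeight x : ℤ) = D.colLevel s x - s + s * (x + 1) := by
      unfold colLevel; ring
    rw [e1, e2, min_add_add_right, min_add_add_right]
    ring

theorem le_colLevel (hK : K = k * s) (hk : 0 < k) (hs : 0 < s) {x : ℕ} (hx : x < k) : (s : ℤ) ≤ D.colLevel s x := by
  have := mul_succ_le_colHeight hK hk hs (D := D) hx
  unfold colLevel
  zify at this
  linarith

theorem colLevel_last (hK : K = k * s) (hk : 0 < k) : D.colLevel s (k - 1) = s := by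
  unfold colLevel
  rw [colHeight_last hK hk, hK]
  push_cast [Nat.cast_sub hk]
  ring

/-- Complementary counting: the steps to the right of `x` at level at least `t` are obtained from
all steps, the steps up to `x`, and the steps below level `t`. The path ends on the diagonal, so its
last column has end level `s`, which closes the sum over columns. -/
theorem sum_ite_le_level (hK : K = k * s) (hk : 0 < k) (hs : 0 < s) {x : ℕ} (hx : x < k) :
    ∑ a : Fin K, (if x < D.col a ∧ D.colLevel s x ≤ D.level s a then (1 : ℤ) else 0) =
      ∑ q ∈ Finset.range k, if x < q then (min (D.colLevel s x) (D.colLevel s q - s) -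
        min (D.colLevel s x - s) (D.colLevel s q - s)) else 0 := by
  have hE := le_colLevel hK hk hs (D := D) hx
  set t := D.colLevel s x with ht
  have h1 := sum_ite_level_lt (D := D) (s := s) t (by omega) x
  have h2 := sum_ite_level_lt (D := D) (s := s) t (by omega) (k - 1)
  have h3 : ∑ p ∈ Finset.range k, (min (D.colLevel s p) t - min (D.colLevel s p - s) t) =
      ∑ p ∈ Finset.range (k - 1), (min (D.colLevel s p) t - min (D.colLevel s p - s) t) +
      min (D.colLevel s (k - 1)) t := by
    nth_rewrite 1 [show k = k - 1 + 1 by omega]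
    rw [Finset.sum_range_succ, colLevel_last hK hk, sub_self, min_eq_left (a := (0 : ℤ)) (by omega),
      sub_zero]
  have h4 : ∑ a : Fin K, (if x < D.col a ∧ t ≤ D.level s a then (1 : ℤ) else 0) +
      ∑ a : Fin K, (if D.col a ≤ k - 1 ∧ D.level s a < t then (1 : ℤ) else 0) +
      ∑ a : Fin K, (if (a : ℕ) < D.colHeight x ∧ ((a : ℕ) : ℤ) < K then (1 : ℤ) else 0) =
      ∑ a : Fin K, (if D.col a ≤ x ∧ D.level s a < t then (1 : ℤ) else 0) +
      ∑ a : Fin K, (if (a : ℕ) < K ∧ ((a : ℕ) : ℤ) < K then (1 : ℤ) else 0) := by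
    rw [← Finset.sum_add_distrib, ← Finset.sum_add_distrib, ← Finset.sum_add_distrib]
    refine Finset.sum_congr rfl fun a _ => ?_
    have hak := col_lt hK hk (D := D) a
    have haK := a.2
    simp only [lt_colHeight_iff]
    split_ifs <;> omega
  rw [sum_ite_lt _ (D.colHeight_le x) _ (by omega), sum_ite_lt _ le_rfl _ (by omega), h1, h2,
    min_self, min_self,
    min_eq_left (a := (D.colHeight x : ℤ)) (by exact_mod_cast D.colHeight_le x)] at h4
  have h5 : (D.colHeight x : ℤ) = t + s * x := by rw [ht]; unfold colLevel; ring
  have h6 : (K : ℤ) = ∑ q ∈ Finset.range k, (s : ℤ) := by simp [hK]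
  have h7 : ((x : ℤ)) * s + ∑ p ∈ Finset.range x, (min (D.colLevel s p) t -
      min (D.colLevel s p - s) t - s) = ∑ p ∈ Finset.range x, (min (D.colLevel s p) t -
      min (D.colLevel s p - s) t) := by
    rw [Finset.sum_sub_distrib (f := fun p => min (D.colLevel s p) t -
      min (D.colLevel s p - s) t)]
    simp
  have h8 : ∑ p ∈ Finset.range x, (min (D.colLevel s p) t - min (D.colLevel s p - s) t - s) =
      ∑ q ∈ Finset.range k, if q < x then
        (min (D.colLevel s q) t - min (D.colLevel s q - s) t - s) else 0 := by
    rw [← Finset.sum_filter]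
    congr 1
    ext p
    simp only [Finset.mem_range, Finset.mem_filter]
    omega
  have h9 : ∑ a : Fin K, (if x < D.col a ∧ t ≤ D.level s a then (1 : ℤ) else 0) =
      ∑ q ∈ Finset.range k, (s : ℤ) +
      (∑ q ∈ Finset.range k, if q < x then
        (min (D.colLevel s q) t - min (D.colLevel s q - s) t - s) else 0) -
      ∑ p ∈ Finset.range k, (min (D.colLevel s p) t - min (D.colLevel s p - s) t) := by
    rw [← h6, ← h8, h3]
    linarith
  rw [h9, ← Finset.sum_add_distrib, ← Finset.sum_sub_distrib]
  refine Finset.sum_congr rfl fun q _ => ?_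
  rcases lt_trichotomy q x with h | rfl | h
  · rw [if_pos h, if_neg (by omega)]; ring
  · rw [if_neg (by omega), if_neg (by omega), ← ht]; omega
  · rw [if_neg (by omega), if_pos h]; omega

/-- Counting pairs of a north step and an east step in two ways by the levels of the path. -/
theorem sum_level_identity (hK : K = k * s) (hk : 0 < k) (hs : 0 < s) :
    ∑ x ∈ Finset.range k, ∑ a : Fin K,
      (if D.col a ≤ x ∧ D.level s a + s < D.colLevel s x then (1 : ℤ) else 0) =
    ∑ x ∈ Finset.range k, ∑ a : Fin K,
      (if D.col a ≤ x ∧ s * (x + 1) ≤ (a : ℕ) then (1 : ℤ) else 0) +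
    ∑ x ∈ Finset.range k, ∑ a : Fin K,
      (if x < D.col a ∧ D.colLevel s x ≤ D.level s a then (1 : ℤ) else 0) := by
  have h1 : ∀ x ∈ Finset.range k, ∑ a : Fin K,
      (if D.col a ≤ x ∧ D.level s a + s < D.colLevel s x then (1 : ℤ) else 0) =
      (D.colLevel s x - s) + ∑ p ∈ Finset.range k, if p < x then
        (min (D.colLevel s p) (D.colLevel s x - s) -
          min (D.colLevel s p - s) (D.colLevel s x - s)) else 0 := by
    intro x hx
    rw [Finset.mem_range] at hx
    have hE := le_colLevel hK hk hs (D := D) hx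
    have h := sum_ite_level_lt (D := D) (s := s) (D.colLevel s x - s) (by omega) x
    simp only [lt_sub_iff_add_lt] at h
    rw [h, min_eq_right (by omega), ← Finset.sum_filter]
    congr 2
    ext p
    simp only [Finset.mem_range, Finset.mem_filter]
    omega
  have h2 : ∀ x ∈ Finset.range k, ∑ a : Fin K,
      (if D.col a ≤ x ∧ s * (x + 1) ≤ (a : ℕ) then (1 : ℤ) else 0) = D.colLevel s x - s := by
    intro x hx
    rw [Finset.mem_range] at hx
    have h3 := mul_succ_le_colHeight hK hk hs (D := D) hx
    have h4 := sum_ite_lt (K := K) (D.colHeight x) (D.colHeight_le x) (D.colHeight x) (by omega)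
    have h5 := sum_ite_lt (K := K) (D.colHeight x) (D.colHeight_le x) ((s * (x + 1) : ℕ) : ℤ)
      (by omega)
    rw [min_self] at h4
    rw [min_eq_right (by exact_mod_cast h3)] at h5
    have h6 : D.colLevel s x - s = (D.colHeight x : ℤ) - ((s * (x + 1) : ℕ) : ℤ) := by
      unfold colLevel; push_cast; ring
    rw [h6, ← h4, ← h5, ← Finset.sum_sub_distrib]
    refine Finset.sum_congr rfl fun a _ => ?_
    simp only [lt_colHeight_iff, Nat.cast_lt]
    by_cases hc : D.col a ≤ x
    · have := (D.lt_colHeight_iff x a).2 hc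
      simp only [hc, true_and]
      split_ifs <;> omega
    · simp [hc]
  rw [Finset.sum_congr rfl h1, Finset.sum_congr rfl h2, Finset.sum_add_distrib]
  congr 1
  -- Both sides have become the same sum over pairs of columns `p < x`, namely of the overlap of the
  -- level interval from `E_p - s` to `E_p` with the levels below `E_x - s`, where `E` denotes
  -- `colLevel`.
  rw [Finset.sum_comm]
  exact Finset.sum_congr rfl fun x hx =>
    (sum_ite_le_level hK hk hs (Finset.mem_range.1 hx)).symm

end DyckPath

namespace DyckPath

variable {K k : ℕ} {D : DyckPath K k} {s : ℕ}

theorem arm_eq (hK : K = k * s) (hk : 0 < k) (x : Fin k) (y : Fin K) :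
    D.arm x y = D.col y - 1 - x := by
  have hy := col_lt hK hk (D := D) y
  have : D.arm x y = (Finset.Ioo (x : ℕ) (D.col y)).card := by
    refine Finset.card_bij (fun a _ => (a : ℕ)) ?_ ?_ ?_
    · intro a ha
      simp only [Finset.mem_filter, Finset.mem_univ, true_and, IsAbove, Fin.lt_def] at ha
      exact Finset.mem_Ioo.2 ha
    · intro a _ b _ h
      exact Fin.ext h
    · intro b hb
      rw [Finset.mem_Ioo] at hb
      refine ⟨⟨b, by omega⟩, ?_, rfl⟩
      simpa only [Finset.mem_filter, Finset.mem_univ, true_and, IsAbove, Fin.lt_def] using hb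
  rw [this, Nat.card_Ioo]
  omega

theorem leg_eq (x : Fin k) (y : Fin K) : D.leg x y = y - D.colHeight x := by
  have : D.leg x y = (Finset.Ico (D.colHeight x) (y : ℕ)).card := by
    refine Finset.card_bij (fun a _ => (a : ℕ)) ?_ ?_ ?_
    · intro a ha
      simp only [Finset.mem_filter, Finset.mem_univ, true_and, IsAbove, Fin.lt_def] at ha
      rw [Finset.mem_Ico, ← not_lt, lt_colHeight_iff]
      exact ⟨not_le.2 ha.2, ha.1⟩
    · intro a _ b _ h
      exact Fin.ext h
    · intro b hb
      rw [Finset.mem_Ico] at hb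
      have hbK : b < K := hb.2.trans y.2
      refine ⟨⟨b, hbK⟩, ?_, rfl⟩
      simp only [Finset.mem_filter, Finset.mem_univ, true_and, IsAbove, Fin.lt_def]
      refine ⟨hb.2, not_le.1 fun h => ?_⟩
      have := (D.lt_colHeight_iff x ⟨b, hbK⟩).2 h
      simp only at this
      omega
  rw [this, Nat.card_Ico]

theorem card_filter_prod_eq {α β : Type*} [Fintype α] [Fintype β] (P : α × β → Prop)
    [DecidablePred P] : ((Finset.univ.filter P).card : ℤ) =
      ∑ x : α, ∑ y : β, if P (x, y) then (1 : ℤ) else 0 := by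
  rw [Finset.card_filter, Nat.cast_sum, ← Finset.univ_product_univ, Finset.sum_product]
  simp

/-- All boxes above the path are above the diagonal. Such a box misses `pathdinv` in one of two
exclusive ways, its leg being too long or its arm too long, which are comparisons of levels. The
second sum counts the boxes between path and diagonal. -/
theorem delta_eq_pathdinv_add (hK : K = k * s) (hk : 0 < k) :
    (delta K k : ℤ) = (D.pathdinv : ℤ) + ∑ x ∈ Finset.range k, ∑ a : Fin K,
      (if D.col a ≤ x ∧ s * (x + 1) ≤ (a : ℕ) then (1 : ℤ) else 0) +
    ∑ x ∈ Finset.range k, ∑ a : Fin K,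
      (if x < D.col a ∧ D.colLevel s x ≤ D.level s a then (1 : ℤ) else 0) +
    ∑ x ∈ Finset.range k, ∑ a : Fin K,
      (if x < D.col a ∧ D.level s a + 1 + s < D.colLevel s x then (1 : ℤ) else 0) := by
  unfold delta pathdinv
  rw [card_filter_prod_eq, card_filter_prod_eq]
  simp only [Finset.sum_range]
  rw [← Finset.sum_add_distrib, ← Finset.sum_add_distrib, ← Finset.sum_add_distrib]
  refine Finset.sum_congr rfl fun x _ => ?_
  rw [← Finset.sum_add_distrib, ← Finset.sum_add_distrib, ← Finset.sum_add_distrib]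
  refine Finset.sum_congr rfl fun a _ => ?_
  simp only [arm_eq hK hk, leg_eq, IsAbove]
  have e2 : ∀ A L : ℕ, K * A ≤ k * L ↔ s * A ≤ L := fun A L => by
    rw [hK, mul_assoc]
    exact Nat.mul_le_mul_left_iff hk
  have e3 : ∀ A L : ℕ, k * L < K * A ↔ L < s * A := fun A L => by
    rw [← not_le, e2, not_le]
  simp only [e2, e3]
  have h1 := mul_col_le hK hk (D := D) a
  by_cases hx : (x : ℕ) < D.col a
  · have h2 : D.colHeight x ≤ a := by
      rw [← not_lt, lt_colHeight_iff]; omega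
    have h3 : s * ((x : ℕ) + 1) ≤ a := (Nat.mul_le_mul_left s hx).trans h1
    obtain ⟨A, hA⟩ : ∃ A, D.col a = x + 1 + A := ⟨D.col a - (x + 1), by omega⟩
    obtain ⟨L, hL⟩ : ∃ L, (a : ℕ) = D.colHeight x + L := ⟨a - D.colHeight x, by omega⟩
    have eA : D.col a - 1 - x = A := by omega
    have eL : (a : ℕ) - D.colHeight x = L := by omega
    rw [eA, eL]
    have c2 : D.colLevel s x ≤ D.level s a ↔ s * (A + 1) ≤ L := by
      unfold colLevel level
      rw [hA, hL]
      zify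
      constructor <;> intro h <;> linarith
    have c1 : D.level s a + 1 + s < D.colLevel s x ↔ L + 1 < s * A := by
      unfold colLevel level
      rw [hA, hL]
      zify
      constructor <;> intro h <;> linarith
    have h4 : s * A ≤ s * (A + 1) := Nat.mul_le_mul_left s (Nat.le_succ A)
    simp only [c1, c2, hx, h3, true_and, if_true, not_le.2 hx, false_and, if_false]
    split_ifs <;> omega
  · simp only [hx, not_lt.1 hx, true_and, false_and, if_false]
    simp

/-- The pairs of a labelled box and an unlabelled box below the path which it attacks. -/
def attackCount (D : DyckPath K k) : ℕ :=
  (Finset.univ.filter fun p : Fin K × Fin k × Fin K =>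
    D.col p.2.2 < p.2.1 ∧ IsAttacking K k (D.col p.1, p.1) (p.2.1, p.2.2)).card

theorem isAttacking_iff (hK : K = k * s) (hk : 0 < k) (x y x' y' : ℕ) :
    IsAttacking K k (x, y) (x', y') ↔ ((y : ℤ) - s * x = y' - s * x' ∧ x < x') ∨
      ((y : ℤ) - s * x + 1 = y' - s * x' ∧ x' < x) := by
  have : K / k = s := by rw [hK, Nat.mul_div_cancel_left _ hk]
  simp only [IsAttacking, diagIndex, this]

/-- In a column other than its own a box attacks at most one height: on its own diagonal to the
right, on the next diagonal to the left. The attacked box is below the path when that height is less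
than `colHeight x`. -/
theorem sum_attacking (hK : K = k * s) (hk : 0 < k) (x : ℕ) (a : Fin K) : (∑ y : Fin K,
      if D.col y < x + 1 ∧ IsAttacking K k (D.col a, a) (x + 1, y) then (1 : ℤ) else 0) =
    (if D.col a ≤ x ∧ D.level s a + s < D.colLevel s x then (1 : ℤ) else 0) +
    (if x < D.col a ∧ D.level s a + 1 + s < D.colLevel s x then (1 : ℤ) else 0) := by
  have h1 := mul_col_le hK hk (D := D) a
  have hlev : D.level s a = ((a : ℕ) - s * D.col a : ℕ) := by
    unfold level; push_cast [Nat.cast_sub h1]; ring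
  obtain ⟨I, hI⟩ : ∃ I : ℕ, I = (a : ℕ) - s * D.col a := ⟨_, rfl⟩
  have hIa : ((a : ℕ) : ℤ) - s * D.col a = I := by
    rw [hI]; push_cast [Nat.cast_sub h1]; ring
  have key : ∀ Y : ℕ, (∑ y : Fin K, if (y : ℕ) < D.colHeight x ∧ (y : ℕ) = Y then (1 : ℤ) else 0) =
      if Y < D.colHeight x then 1 else 0 := by
    intro Y
    split_ifs with h
    · have hYK : Y < K := h.trans_le (D.colHeight_le x)
      rw [Finset.sum_eq_single ⟨Y, hYK⟩]
      · simp [h]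
      · intro b _ hb
        rw [if_neg]
        rintro ⟨_, rfl⟩
        exact hb rfl
      · simp
    · refine Finset.sum_eq_zero fun y _ => if_neg ?_
      rintro ⟨h1, rfl⟩
      exact h h1
  simp only [isAttacking_iff hK hk, Nat.lt_succ_iff, hIa, ← lt_colHeight_iff]
  rw [hlev, ← hI]
  rcases lt_trichotomy (D.col a) (x + 1) with h | h | h
  · have h2 : (a : ℕ) < D.colHeight x := (D.lt_colHeight_iff x a).2 (by omega)
    rw [if_neg (c := x < D.col a ∧ _) (by omega), add_zero]
    have h3 := key (I + s * (x + 1))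
    refine Eq.trans (Finset.sum_congr rfl fun y _ =>
      if_congr (and_congr_right fun _ => ?_) rfl rfl) (h3.trans (if_congr ?_ rfl rfl))
    · zify
      constructor
      · rintro (⟨h4, _⟩ | ⟨_, h5⟩)
        · linarith
        · omega
      · intro h4
        exact Or.inl ⟨by linarith, by omega⟩
    · symm
      unfold colLevel
      simp only [h2, true_and]
      zify
      constructor <;> intro h4 <;> linarith
  · have h2 : D.colHeight x ≤ a := by rw [← not_lt, lt_colHeight_iff]; omega
    rw [if_neg (by omega), if_neg, add_zero]
    · refine Finset.sum_eq_zero fun y _ => if_neg ?_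
      omega
    · rintro ⟨_, h3⟩
      unfold colLevel at h3
      rw [h] at hIa
      push_cast at hIa
      have : (D.colHeight x : ℤ) ≤ (a : ℕ) := by exact_mod_cast h2
      linarith
  · have h2 : D.colHeight x ≤ a := by rw [← not_lt, lt_colHeight_iff]; omega
    rw [if_neg (by omega), zero_add]
    have h3 := key (I + 1 + s * (x + 1))
    refine Eq.trans (Finset.sum_congr rfl fun y _ =>
      if_congr (and_congr_right fun _ => ?_) rfl rfl) (h3.trans (if_congr ?_ rfl rfl))
    · zify
      constructor
      · rintro (⟨_, h5⟩ | ⟨h4, _⟩)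
        · omega
        · linarith
      · intro h4
        exact Or.inr ⟨by linarith, by omega⟩
    · symm
      have h4 : x < D.col a := by omega
      unfold colLevel
      simp only [h4, true_and]
      zify
      constructor <;> intro h4 <;> linarith

/-- The number of boxes above the diagonal is the sum of `pathdinv` and the number of attacking
pairs of a labelled box and a box to the right of the path. -/
theorem pathdinv_add_attackCount (hK : K = k * s) (hk : 0 < k) (hs : 0 < s) :
    (D.pathdinv : ℤ) + D.attackCount = delta K k := by
  set g : Fin K → ℕ → ℤ := fun a x => ∑ y : Fin K,
    if D.col y < x ∧ IsAttacking K k (D.col a, a) (x, y) then (1 : ℤ) else 0 with hg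
  have h1 : (D.attackCount : ℤ) = ∑ a : Fin K, ∑ x ∈ Finset.range k, g a x := by
    unfold attackCount
    rw [card_filter_prod_eq]
    refine Finset.sum_congr rfl fun a _ => ?_
    rw [← Finset.univ_product_univ, Finset.sum_product, Finset.sum_range]
  -- Boxes in column `x + 1` below the path are bounded by the end of column `x`, hence the shift.
  -- The added column `k` has negative diagonal indices and is not attacked; the dropped column `0`
  -- has no box to the right of the path.
  have h2 : ∀ a, ∑ x ∈ Finset.range k, g a x = ∑ x ∈ Finset.range k, g a (x + 1) := by
    intro a
    have e0 : g a 0 = 0 := Finset.sum_eq_zero fun y _ => if_neg (by omega)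
    have ek : g a k = 0 := by
      refine Finset.sum_eq_zero fun y _ => if_neg ?_
      rw [isAttacking_iff hK hk]
      have h3 := mul_col_le hK hk (D := D) a
      have h4 := col_lt hK hk (D := D) a
      have h5 := y.2
      have h6 : (K : ℤ) = s * k := by rw [hK]; push_cast; ring
      zify at h3
      omega
    have := Finset.sum_range_succ (g a) k
    rw [Finset.sum_range_succ', e0, ek, add_zero, add_zero] at this
    exact this.symm
  rw [h1, Finset.sum_congr rfl fun a _ => h2 a, Finset.sum_comm,
    delta_eq_pathdinv_add (D := D) hK hk]
  have h3 := sum_level_identity hK hk hs (D := D)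
  have h4 : ∑ x ∈ Finset.range k, ∑ a : Fin K, g a (x + 1) =
      ∑ x ∈ Finset.range k, ∑ a : Fin K,
        (if D.col a ≤ x ∧ D.level s a + s < D.colLevel s x then (1 : ℤ) else 0) +
      ∑ x ∈ Finset.range k, ∑ a : Fin K,
        (if x < D.col a ∧ D.level s a + 1 + s < D.colLevel s x then (1 : ℤ) else 0) := by
    rw [← Finset.sum_add_distrib]
    refine Finset.sum_congr rfl fun x _ => ?_
    rw [← Finset.sum_add_distrib]
    exact Finset.sum_congr rfl fun a _ => sum_attacking hK hk x a
  rw [h4, h3]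
  ring

end DyckPath

/-! ### The affine permutations `γ` and `ω_π` -/

section Permutations

variable {n k : ℕ}

theorem height_cast (n k : ℕ) : (height n k : ℤ) = k * ((n - k + 1 : ℕ) : ℤ) := by
  unfold height; push_cast; ring

/-- Every integer is `1 + r k + q₀` modulo the height. -/
theorem exists_position (hk : 0 < k) (m : ℤ) : ∃ (r q₀ : ℕ) (q : ℤ), r < n - k + 1 ∧ q₀ < k ∧
    m = 1 + r * k + q₀ + height n k * q := by
  obtain ⟨a, q, rfl⟩ := AffinePerm.exists_window (height_pos (n := n) hk) m
  refine ⟨(a : ℕ) / k, (a : ℕ) % k, q, ?_, Nat.mod_lt _ hk, ?_⟩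
  · exact Nat.div_lt_of_lt_mul a.2
  · have h : ((a : ℕ) : ℤ) = k * (((a : ℕ) / k : ℕ) : ℤ) + (((a : ℕ) % k : ℕ) : ℤ) := by
      exact_mod_cast (Nat.div_add_mod (a : ℕ) k).symm
    linear_combination h

theorem position_lt {r q₀ : ℕ} (hr : r < n - k + 1) (hq : q₀ < k) : r * k + q₀ < height n k := by
  have h1 : (r + 1) * k ≤ (n - k + 1) * k := Nat.mul_le_mul_right _ hr
  have h2 : height n k = (n - k + 1) * k := mul_comm _ _
  rw [add_mul] at h1
  omega

theorem row_lt_height {r q₀ : ℕ} (hr : r < n - k + 1) (hq : q₀ < k) :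
    (n - k + 1) * q₀ + r < height n k := by
  have h1 : (n - k + 1) * (q₀ + 1) ≤ (n - k + 1) * k := Nat.mul_le_mul_left _ hq
  have h2 : height n k = (n - k + 1) * k := mul_comm _ _
  rw [mul_add] at h1
  omega

variable (N : ℕ)

theorem gammaWindow_of_lt {r q₀ : ℕ} (hr : r + 1 < n - k + 1) (hq : q₀ < k) :
    gammaWindow n k N (1 + r * k + q₀) = 1 + (r + 1 : ℕ) * k + q₀ := by
  unfold gammaWindow
  have h : (r + 1) * k ≤ (n - k) * k := Nat.mul_le_mul_right _ (by omega)
  rw [add_mul] at h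
  rw [if_pos]
  · push_cast; ring
  · zify at h ⊢
    omega

theorem gammaWindow_of_last {r q₀ : ℕ} (hr : r = n - k) (hq : q₀ + 1 < k) :
    gammaWindow n k N (1 + r * k + q₀) = 1 + (q₀ + 1 : ℕ) + height n k := by
  have h2 : height n k = (n - k) * k + k := by unfold height; ring
  have h3 : (height n k : ℤ) = ((n - k) * k : ℕ) + k := by rw [h2]; push_cast; ring
  have h4 : ((r : ℤ)) * k = ((n - k) * k : ℕ) := by rw [hr]; push_cast; ring
  unfold gammaWindow
  rw [h3, h4, if_neg (by omega), if_pos (by omega)]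
  push_cast
  ring

theorem gammaWindow_of_end {r q₀ : ℕ} (hr : r = n - k) (hq : q₀ + 1 = k) :
    gammaWindow n k N (1 + r * k + q₀) = 1 + height n k * (N + 1) := by
  have h2 : height n k = (n - k) * k + k := by unfold height; ring
  have h3 : (height n k : ℤ) = ((n - k) * k : ℕ) + k := by rw [h2]; push_cast; ring
  have h4 : ((r : ℤ)) * k = ((n - k) * k : ℕ) := by rw [hr]; push_cast; ring
  unfold gammaWindow
  rw [h4, if_neg (by omega), if_neg (by omega)]

theorem position_inj {r q₀ r' q₀' : ℕ} (hr : r < n - k + 1) (hq : q₀ < k)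
    (hr' : r' < n - k + 1) (hq' : q₀' < k)
    (h : (height n k : ℤ) ∣ (r * k + q₀ : ℤ) - (r' * k + q₀')) : r = r' ∧ q₀ = q₀' := by
  have h1 : ((height n k : ℕ) : ℤ) ∣ ((r * k + q₀ : ℕ) : ℤ) - ((r' * k + q₀' : ℕ) : ℤ) := by
    push_cast; exact h
  have h2 := Nat.ModEq.eq_of_lt_of_lt (Nat.modEq_iff_dvd.2 h1) (position_lt hr' hq')
    (position_lt hr hq)
  have hq2 : q₀ = q₀' := by
    have := congrArg (· % k) h2
    simpa [Nat.add_mod, Nat.mod_eq_of_lt hq, Nat.mod_eq_of_lt hq'] using this.symm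
  subst hq2
  have h3 : r * k = r' * k := by omega
  exact ⟨Nat.eq_of_mul_eq_mul_right (by omega : 0 < k) h3, rfl⟩

/-- In the coordinates `(r, q₀)` of a position, `γ` passes from row `s q₀ + r` to the next one, and
from the last row to row `0` with the large shift `N + 1`. -/
theorem gammaWindow_form {r q₀ : ℕ} (hr : r < n - k + 1) (hq : q₀ < k) :
    ∃ (r' q₀' : ℕ) (t : ℤ), r' < n - k + 1 ∧ q₀' < k ∧
      gammaWindow n k N (1 + r * k + q₀) = 1 + r' * k + q₀' + height n k * t ∧
      ((r' = r + 1 ∧ q₀' = q₀ ∧ t = 0) ∨ (r = n - k ∧ r' = 0 ∧ q₀' = q₀ + 1 ∧ t = 1) ∨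
        (r = n - k ∧ r' = 0 ∧ q₀ + 1 = k ∧ q₀' = 0 ∧ t = N + 1)) := by
  by_cases h1 : r + 1 < n - k + 1
  · refine ⟨r + 1, q₀, 0, h1, hq, ?_, Or.inl ⟨rfl, rfl, rfl⟩⟩
    rw [gammaWindow_of_lt N h1 hq]; ring
  · by_cases h2 : q₀ + 1 < k
    · refine ⟨0, q₀ + 1, 1, by omega, h2, ?_, Or.inr (Or.inl ⟨by omega, rfl, rfl, rfl⟩)⟩
      rw [gammaWindow_of_last N (by omega) h2]; push_cast; ring
    · refine ⟨0, 0, N + 1, by omega, by omega, ?_, Or.inr (Or.inr ⟨by omega, rfl, by omega, rfl, rfl⟩)⟩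
      rw [gammaWindow_of_end N (by omega) (by omega)]; push_cast; ring

/-- The affine permutation `γ_{n,k,N}`. -/
noncomputable def gammaPerm (n : ℕ) {k : ℕ} (N : ℕ) (hk : 0 < k) : AffinePerm (height n k) :=
  AffinePerm.ofWindow (height_pos hk) (fun a => gammaWindow n k N (((a : ℕ) : ℤ) + 1)) (by
    intro a b h
    have hpos : ∀ a : Fin (height n k), ∃ r q₀ : ℕ, r < n - k + 1 ∧ q₀ < k ∧
        (a : ℕ) = r * k + q₀ := fun a => ⟨(a : ℕ) / k, (a : ℕ) % k, Nat.div_lt_of_lt_mul a.2,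
      Nat.mod_lt _ hk, by rw [mul_comm, Nat.div_add_mod]⟩
    obtain ⟨r, q, hr, hq, ha⟩ := hpos a
    obtain ⟨r₁, q₁, hr₁, hq₁, hb⟩ := hpos b
    have ea : ((a : ℕ) : ℤ) + 1 = 1 + r * k + q := by rw [ha]; push_cast; ring
    have eb : ((b : ℕ) : ℤ) + 1 = 1 + r₁ * k + q₁ := by rw [hb]; push_cast; ring
    obtain ⟨r', q', t, hr', hq', e, hc⟩ := gammaWindow_form N hr hq
    obtain ⟨r₁', q₁', t₁, hr₁', hq₁', e₁, hc₁⟩ := gammaWindow_form N hr₁ hq₁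
    simp only [ea, eb, e, e₁] at h
    have h2 := position_inj hr' hq' hr₁' hq₁' (by
      have h3 := dvd_sub h (dvd_mul_right (height n k : ℤ) (t - t₁))
      refine (congrArg (fun z : ℤ => (height n k : ℤ) ∣ z) ?_).mp h3
      ring)
    have h3 : r = r₁ ∧ q = q₁ := by omega
    apply Fin.ext
    rw [ha, hb, h3.1, h3.2])

theorem gammaPerm_apply (hk : 0 < k) {r q₀ : ℕ} (hr : r < n - k + 1) (hq : q₀ < k) (q : ℤ) :
    (gammaPerm n N hk).toPerm (1 + r * k + q₀ + height n k * q) =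
      gammaWindow n k N (1 + r * k + q₀) + height n k * q := by
  have h := AffinePerm.windowFun_apply (height_pos (n := n) hk)
    (fun a => gammaWindow n k N (((a : ℕ) : ℤ) + 1)) ⟨r * k + q₀, position_lt hr hq⟩ q
  have e : (((r * k + q₀ : ℕ) : ℤ)) + 1 = 1 + r * k + q₀ := by push_cast; ring
  simp only [e] at h
  exact h

theorem gammaOp_eq (hk : 0 < k) (R : Type*) [CommRing R] :
    gammaOp n k N R = ((gammaPerm n N hk).toGL R).val := by
  ext r c : 1
  have h := AffinePerm.windowFun_apply (height_pos (n := n) hk)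
    (fun a => gammaWindow n k N (((a : ℕ) : ℤ) + 1)) c 0
  rw [mul_zero, add_zero, add_zero] at h
  exact congrArg (fun m => basisVec (height n k) R m r) h.symm

variable (π : ParkingFunction (height n k) k)

theorem rank_row {r q₀ : ℕ} (hr : r < n - k + 1) (x : ℤ) :
    rank n k (x + 1) (((((n - k + 1) * q₀ + r : ℕ) : ℤ)) + 1) =
      1 + r * k + q₀ + height n k * (q₀ - x) := by
  unfold rank
  rw [add_sub_cancel_right, height_cast, ← Int.natCast_ediv, Nat.mul_add_div (by omega),
    Nat.div_eq_of_lt hr]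
  push_cast
  ring

theorem omega_apply (hk : 0 < k) (a : Fin (height n k)) (t : ℤ) :
    (omega hk π).toPerm (((π.label a : ℕ) : ℤ) + 1 + height n k * t) =
      rank n k ((π.path.col a : ℤ) + 1) (((a : ℕ) : ℤ) + 1) + height n k * t := by
  have h := AffinePerm.windowFun_apply (height_pos (n := n) hk)
    (fun a => rank n k ((π.path.col (π.label.symm a) : ℤ) + 1)
      (((π.label.symm a : ℕ) : ℤ) + 1)) (π.label a) t
  simp only [Equiv.symm_apply_apply] at h
  exact h

theorem omega_symm_apply (hk : 0 < k) {r q₀ : ℕ} (hr : r < n - k + 1) (q : ℤ)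
    (a : Fin (height n k)) (ha : (a : ℕ) = (n - k + 1) * q₀ + r) :
    (omega hk π).toPerm.symm (1 + r * k + q₀ + height n k * q) =
      ((π.label a : ℕ) : ℤ) + 1 + height n k * (π.path.col a + q - q₀) := by
  rw [Equiv.symm_apply_eq, omega_apply, ha, rank_row hr]
  ring

theorem omega_symm_rank (hk : 0 < k) (x : ℤ) (y : Fin (height n k)) :
    (omega hk π).toPerm.symm (rank n k (x + 1) (((y : ℕ) : ℤ) + 1)) =
      ((π.label y : ℕ) : ℤ) + 1 + height n k * (π.path.col y - x) := by
  rw [Equiv.symm_apply_eq, omega_apply]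
  unfold rank
  ring

theorem omega_isPositive (hk : 0 < k) : (omega hk π).IsPositive := by
  intro i h1 h2
  obtain ⟨a, rfl⟩ : ∃ a : Fin (height n k), i = ((a : ℕ) : ℤ) + 1 :=
    ⟨⟨(i - 1).toNat, by omega⟩, by simp; omega⟩
  obtain ⟨y, rfl⟩ := π.label.surjective a
  have h := omega_apply π hk y 0
  rw [mul_zero, add_zero, add_zero] at h
  rw [h]
  unfold rank
  have h3 : (height n k : ℤ) * π.path.col y ≤ k * (y : ℕ) := by exact_mod_cast π.path.above y
  have h4 : (0 : ℤ) ≤ ((y : ℕ) : ℤ) / ((n - k + 1 : ℕ) : ℤ) := by positivity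
  simp only [add_sub_cancel_right]
  linarith

theorem col_zero (y : Fin (height n k)) (hy : (y : ℕ) = 0) : π.path.col y = 0 := by
  have h := π.path.above y
  rw [hy, mul_zero] at h
  have := y.pos
  have h2 := Nat.eq_zero_of_le_zero h
  rcases Nat.mul_eq_zero.1 h2 with h3 | h3
  · omega
  · exact h3

theorem omega_isNormalized (hk : 0 < k) : (omega hk π).IsNormalized := by
  have hK := height_pos (n := n) hk
  have h := omega_symm_rank π hk 0 ⟨0, hK⟩
  have h1 : rank n k (0 + 1) (((0 : ℕ) : ℤ) + 1) = 1 := by simp [rank]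
  simp only [h1, col_zero π ⟨0, hK⟩ rfl] at h
  simp only [Nat.cast_zero, sub_zero, mul_zero, add_zero] at h
  unfold AffinePerm.IsNormalized
  rw [h]
  have := (π.label ⟨0, hK⟩).2
  omega

/-- Passing to the next row either stays in a vertical run, where labels increase, or moves right,
which adds at least `K` and outweighs any label. From the last row the shift `N + 1` more than
suffices. -/
theorem omega_symm_lt (hk : 0 < k) (m : ℤ) : (omega hk π).toPerm.symm m <
    (omega hk π).toPerm.symm ((gammaPerm n N hk).toPerm m) := by
  have hK := height_pos (n := n) hk
  obtain ⟨r, q₀, q, hr, hq, rfl⟩ := exists_position (n := n) hk m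
  obtain ⟨r', q₀', t, hr', hq', e, hc⟩ := gammaWindow_form N hr hq
  have e2 : 1 + (r' : ℤ) * k + q₀' + height n k * t + height n k * q =
      1 + r' * k + q₀' + height n k * (t + q) := by ring
  rw [gammaPerm_apply N hk hr hq, e, e2,
    omega_symm_apply π hk hr q ⟨(n - k + 1) * q₀ + r, row_lt_height hr hq⟩ rfl,
    omega_symm_apply π hk hr' _ ⟨(n - k + 1) * q₀' + r', row_lt_height hr' hq'⟩ rfl]
  set y : Fin (height n k) := ⟨(n - k + 1) * q₀ + r, row_lt_height hr hq⟩ with hy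
  set y' : Fin (height n k) := ⟨(n - k + 1) * q₀' + r', row_lt_height hr' hq'⟩ with hy'
  have hl := (π.label y).2
  have hl' := (π.label y').2
  have hcol := DyckPath.col_lt (D := π.path) (K := height n k) (k := k) (s := n - k + 1) rfl hk y
  have hmono : ∀ A B : ℤ, A + 1 ≤ B →
      (height n k : ℤ) * A + height n k ≤ height n k * B := by
    intro A B h
    have := mul_le_mul_of_nonneg_left h (Int.natCast_nonneg (height n k))
    linarith
  have hnext : (y' : ℕ) = y + 1 → t = q₀' - q₀ → ((π.label y : ℕ) : ℤ) + 1 +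
      height n k * (π.path.col y + q - q₀) <
      ((π.label y' : ℕ) : ℤ) + 1 + height n k * (π.path.col y' + (t + q) - q₀') := by
    intro h1 h2
    have hlt : y < y' := by rw [Fin.lt_def]; omega
    rcases eq_or_lt_of_le (π.path.mono hlt.le) with h3 | h3
    · have h4 := π.isLabelling y y' hlt h3
      rw [Fin.lt_def] at h4
      rw [h3, h2]
      have : (π.path.col y' : ℤ) + (q₀' - q₀ + q) - q₀' = π.path.col y' + q - q₀ := by ring
      rw [this]
      omega
    · have := hmono (π.path.col y + q - q₀) (π.path.col y' + (t + q) - q₀') (by omega)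
      omega
  rcases hc with ⟨h1, h2, h3⟩ | ⟨h1, h2, h3, h4⟩ | ⟨h1, h2, h3, h4, h5⟩
  · refine hnext ?_ (by omega)
    simp only [hy, hy', h1, h2]
    ring
  · refine hnext ?_ (by omega)
    simp only [hy, hy', h1, h2, h3]
    ring
  · have := hmono (π.path.col y + q - q₀) (π.path.col y' + (t + q) - q₀') (by omega)
    omega

end Permutations

/-! ### The weight attached to a parking function -/

section SpringerWeight

variable {n k : ℕ}

/-- The weight of a position. -/
def posWeight (n k : ℕ) (m : ℤ) : ℤ := m + 2 * ((m - 1) / (k : ℤ)) - (m - 1) / (height n k : ℤ)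

/-- The row of a position along its orbit under `γ`. -/
def posRow (n k : ℕ) (m : ℤ) : ℕ :=
  (n - k + 1) * (((m - 1) % (height n k : ℤ)).toNat % k) + ((m - 1) % (height n k : ℤ)).toNat / k

theorem posWeight_position {r q₀ : ℕ} (hr : r < n - k + 1) (hq : q₀ < k) (q : ℤ) :
    posWeight n k (1 + r * k + q₀ + height n k * q) =
      1 + r * k + q₀ + height n k * q + 2 * (r + (n - k + 1 : ℕ) * q) - q := by
  have hlt := position_lt hr hq
  have e1 : 1 + (r : ℤ) * k + q₀ + height n k * q - 1 = ((r * k + q₀ : ℕ) : ℤ) + height n k * q := by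
    push_cast; ring
  have e2 : 1 + (r : ℤ) * k + q₀ + height n k * q - 1 = (q₀ : ℤ) + k * (r + (n - k + 1 : ℕ) * q) := by
    rw [height_cast]; ring
  have h1 : (1 + (r : ℤ) * k + q₀ + height n k * q - 1) / (height n k : ℤ) = q := by
    rw [e1, Int.add_mul_ediv_left _ _ (by omega), Int.ediv_eq_zero_of_lt (by omega) (by omega),
      zero_add]
  have h2 : (1 + (r : ℤ) * k + q₀ + height n k * q - 1) / (k : ℤ) = r + (n - k + 1 : ℕ) * q := by
    rw [e2, Int.add_mul_ediv_left _ _ (by omega), Int.ediv_eq_zero_of_lt (by omega) (by omega),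
      zero_add]
  rw [posWeight, h1, h2]

theorem posRow_position {r q₀ : ℕ} (hr : r < n - k + 1) (hq : q₀ < k) (q : ℤ) :
    posRow n k (1 + r * k + q₀ + height n k * q) = (n - k + 1) * q₀ + r := by
  have hlt := position_lt hr hq
  have e1 : 1 + (r : ℤ) * k + q₀ + height n k * q - 1 = ((r * k + q₀ : ℕ) : ℤ) + height n k * q := by
    push_cast; ring
  have h1 : ((1 + (r : ℤ) * k + q₀ + height n k * q - 1) % (height n k : ℤ)).toNat = r * k + q₀ := by
    rw [e1, Int.add_mul_emod_self_left, Int.emod_eq_of_lt (by omega) (by omega), Int.toNat_natCast]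
  rw [posRow, h1, mul_comm r k, Nat.mul_add_mod, Nat.mod_eq_of_lt hq, Nat.mul_add_div (by omega),
    Nat.div_eq_of_lt hq, add_zero]

/-- The subtracted quotient grows only at multiples of `K`, where the other quotient grows as well,
since `k` divides `K`. -/
theorem posWeight_strictMono (hk : 0 < k) : StrictMono (posWeight n k) := by
  refine strictMono_int_of_lt_succ fun m => ?_
  obtain ⟨r, q₀, q, hr, hq, rfl⟩ := exists_position (n := n) hk m
  rw [posWeight_position hr hq]
  by_cases h1 : q₀ + 1 < k
  · have e : 1 + (r : ℤ) * k + q₀ + height n k * q + 1 =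
        1 + r * k + (q₀ + 1 : ℕ) + height n k * q := by push_cast; ring
    rw [e, posWeight_position hr h1]
    push_cast
    linarith
  · have hk1 : (k : ℤ) = q₀ + 1 := by omega
    by_cases h2 : r + 1 < n - k + 1
    · have e : 1 + (r : ℤ) * k + q₀ + height n k * q + 1 =
          1 + (r + 1 : ℕ) * k + (0 : ℕ) + height n k * q := by
        push_cast; linear_combination -hk1
      rw [e, posWeight_position h2 hk]
      push_cast
      linarith
    · have hs : ((n - k + 1 : ℕ) : ℤ) = r + 1 := by omega
      have hK := height_cast n k
      rw [hs] at hK ⊢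
      have e : 1 + (r : ℤ) * k + q₀ + height n k * q + 1 =
          1 + (0 : ℕ) * k + (0 : ℕ) + height n k * (q + 1) := by
        push_cast; linear_combination -hk1 - hK
      rw [e, posWeight_position (by omega) hk, hs]
      push_cast
      linarith

/-- A shift by `k` passes one multiple of `k` and adds `k + 2`. At the end of a block the shift is
`k + 1`, and the correction by the quotient modulo `K` restores the same increment. Only the jump
from the last row back to row `0` is larger. -/
theorem gammaPerm_cases (N : ℕ) (hk : 0 < k) (hN : k ≤ N) (m : ℤ) :
    (posWeight n k ((gammaPerm n N hk).toPerm m) = posWeight n k m + (k + 2) ∧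
      posRow n k ((gammaPerm n N hk).toPerm m) = posRow n k m + 1) ∨
    (posWeight n k m + (k + 2) < posWeight n k ((gammaPerm n N hk).toPerm m) ∧
      ∃ q, (gammaPerm n N hk).toPerm m = 1 + height n k * q) := by
  obtain ⟨r, q₀, q, hr, hq, rfl⟩ := exists_position (n := n) hk m
  obtain ⟨r', q₀', t, hr', hq', e, hc⟩ := gammaWindow_form N hr hq
  have e2 : 1 + (r' : ℤ) * k + q₀' + height n k * t + height n k * q =
      1 + r' * k + q₀' + height n k * (t + q) := by ring
  rw [gammaPerm_apply N hk hr hq, e, e2, posWeight_position hr hq, posWeight_position hr' hq',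
    posRow_position hr hq, posRow_position hr' hq']
  have hK := height_cast n k
  rcases hc with ⟨rfl, rfl, rfl⟩ | ⟨h1, rfl, rfl, rfl⟩ | ⟨h1, rfl, h2, rfl, rfl⟩
  · left
    refine ⟨?_, by ring⟩
    push_cast
    ring
  · left
    have hs : ((n - k + 1 : ℕ) : ℤ) = r + 1 := by omega
    rw [hs] at hK ⊢
    refine ⟨?_, ?_⟩
    · push_cast
      linear_combination hK
    · rw [h1]; ring
  · right
    have hs : ((n - k + 1 : ℕ) : ℤ) = r + 1 := by omega
    have hkq : (k : ℤ) = q₀ + 1 := by omega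
    rw [hs] at hK ⊢
    refine ⟨?_, N + 1 + q, by push_cast; ring⟩
    have h3 : (k : ℤ) ≤ k * (r + 1) := le_mul_of_one_le_right (by omega) (by omega)
    have h4 : (k : ℤ) * N ≤ height n k * N := by
      rw [hK]; exact mul_le_mul_of_nonneg_right h3 (by omega)
    have h5 : (k : ℤ) * 1 ≤ k * N := mul_le_mul_of_nonneg_left (by omega) (by omega)
    have h6 : (0 : ℤ) ≤ r * N := by positivity
    have h7 : (0 : ℤ) < N := by omega
    push_cast
    linarith

/-- The weight for the cell of a parking function. -/
noncomputable def parkingWeight (N : ℕ) (hk : 0 < k) (hN : k ≤ N)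
    (π : ParkingFunction (height n k) k) : Weight (omega hk π) (gammaPerm n N hk) where
  p := posWeight n k
  strictMono := posWeight_strictMono hk
  b := height n k + 2 * (n - k + 1 : ℕ) - 1
  p_shift m t := by
    obtain ⟨r, q₀, q, hr, hq, rfl⟩ := exists_position (n := n) hk m
    rw [add_assoc _ ((height n k : ℤ) * q), ← mul_add, posWeight_position hr hq,
      posWeight_position hr hq]
    ring
  row := posRow n k
  row_shift m t := by
    obtain ⟨r, q₀, q, hr, hq, rfl⟩ := exists_position (n := n) hk m
    rw [add_assoc _ ((height n k : ℤ) * q), ← mul_add, posRow_position hr hq,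
      posRow_position hr hq]
  M := height n k
  row_le m := by
    obtain ⟨r, q₀, q, hr, hq, rfl⟩ := exists_position (n := n) hk m
    rw [posRow_position hr hq]
    exact (row_lt_height hr hq).le
  a := k + 2
  a_pos := by omega
  symm_lt := omega_symm_lt N π hk
  p_add_le m := by
    rcases gammaPerm_cases (n := n) N hk hN m with h | h
    · exact h.1.ge
    · exact h.1.le
  row_lt m hm := by
    rcases gammaPerm_cases (n := n) N hk hN m with h | h
    · omega
    · omega
  singular m m0 hm := by
    rcases gammaPerm_cases (n := n) N hk hN m with h | ⟨_, Q, hQ⟩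
    · omega
    rw [hQ]
    obtain ⟨r, q₀, q, hr, hq, rfl⟩ := exists_position (n := n) hk m0
    have e : 1 + (height n k : ℤ) * Q = 1 + (0 : ℕ) * k + (0 : ℕ) + height n k * Q := by simp
    set y : Fin (height n k) := ⟨(n - k + 1) * q₀ + r, row_lt_height hr hq⟩ with hy
    set y₀ : Fin (height n k) := ⟨0, height_pos hk⟩ with hy₀
    -- The hypothesis bounds `Q` by `col y + q - q₀`. Since the path is above the diagonal, `K col y
    -- ≤ K q₀ + r k`, and this gives `K Q ≤ r k + K q`.
    intro h
    rw [e, omega_symm_apply π hk hr q y rfl,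
      omega_symm_apply π hk (by omega) Q y₀ (by simp [hy₀]), col_zero π y₀ rfl] at h
    have h1 := (π.label y).2
    have h2 : (height n k : ℤ) * Q < height n k * (π.path.col y + q - q₀ + 1) := by
      push_cast at h
      rw [mul_add _ _ (1 : ℤ)]
      rw [zero_add, sub_zero] at h
      omega
    have h3 := lt_of_mul_lt_mul_left h2 (Int.natCast_nonneg _)
    have h4 : (height n k : ℤ) * Q ≤ height n k * (π.path.col y + q - q₀) :=
      mul_le_mul_of_nonneg_left (by omega) (Int.natCast_nonneg _)
    have h5 : (height n k : ℤ) * π.path.col y ≤ k * ((n - k + 1 : ℕ) * q₀ + r) := by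
      have := π.path.above y
      exact_mod_cast this
    have h6 := height_cast n k
    rw [mul_sub, mul_add] at h4
    have h7 : (k : ℤ) * ((n - k + 1 : ℕ) * q₀ + r) = height n k * q₀ + r * k := by
      rw [h6]; ring
    linarith

end SpringerWeight

/-! ### The dimension -/

/-- The complements in the cell correspond under `(i, j) ↦ (i, γ j)`, because `γ` raises positions
and `ω⁻¹` grows along `γ`. Finiteness of the cell then compares the sets themselves. -/
theorem Weight.ncard_freeIndex {K : ℕ} (hK : 0 < K) {ω γ : AffinePerm K} (w : Weight ω γ) :
    (freeIndex ω γ).ncard =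
      {e ∈ cellIndex ω | γ.toPerm.symm e.2 < ω.toPerm e.1}.ncard := by
  have hfin := cellIndex_finite ω hK
  have h1 := Set.ncard_sdiff_add_ncard_of_subset (freeIndex_subset (ω := ω) (γ := γ)) hfin
  have h2 := Set.ncard_sdiff_add_ncard_of_subset
    (Set.sep_subset (cellIndex ω) fun e => γ.toPerm.symm e.2 < ω.toPerm e.1) hfin
  have h3 : (fun e : ℤ × ℤ => (e.1, γ.toPerm e.2)) '' (cellIndex ω \ freeIndex ω γ) =
      cellIndex ω \ {e ∈ cellIndex ω | γ.toPerm.symm e.2 < ω.toPerm e.1} := by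
    ext ⟨i, m⟩
    constructor
    · rintro ⟨⟨i', j⟩, ⟨⟨h1, h2, h3, h4⟩, h5⟩, heq⟩
      simp only [Prod.mk.injEq] at heq
      obtain ⟨rfl, rfl⟩ := heq
      simp only at h1 h2 h3 h4
      have h6 := w.lt_apply j
      refine ⟨⟨h1, h2, h3.trans h6, ?_⟩, fun h7 => ?_⟩
      · refine lt_of_le_of_ne (not_lt.1 fun h7 => h5 ⟨⟨h1, h2, h3, h4⟩, h7⟩) fun h7 => ?_
        simp only at h7
        rw [Equiv.symm_apply_eq] at h7
        omega
      · have := h7.2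
        simp only [Equiv.symm_apply_apply] at this
        omega
    · rintro ⟨⟨h1, h2, h3, h4⟩, h5⟩
      simp only at h1 h2 h3 h4
      have h6 := w.symm_lt (γ.toPerm.symm m)
      rw [Equiv.apply_symm_apply] at h6
      refine ⟨(i, γ.toPerm.symm m), ⟨⟨h1, h2, ?_, h6.trans h4⟩, fun h7 => ?_⟩, by simp⟩
      · refine lt_of_le_of_ne (not_lt.1 fun h7 => h5 ⟨⟨h1, h2, h3, h4⟩, h7⟩) fun h7 => ?_
        simp only at h7
        rw [← h7, Equiv.symm_apply_apply] at h6
        omega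
      · have := h7.2
        simp only [Equiv.apply_symm_apply] at this
        omega
  have h4 := Set.ncard_image_of_injective (cellIndex ω \ freeIndex ω γ)
    (f := fun e : ℤ × ℤ => (e.1, γ.toPerm e.2)) (by
      rintro ⟨a, b⟩ ⟨c, d⟩ h
      simpa using h)
  rw [h3] at h4
  omega

/-! ### Free coordinates as attacking pairs of boxes -/

section Count

variable {n k : ℕ}

theorem rank_eq (x : ℤ) (y : ℕ) : rank n k (x + 1) ((y : ℤ) + 1) =
    1 + k * ((y : ℤ) - (n - k + 1 : ℕ) * x) + (y / (n - k + 1) : ℕ) := by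
  unfold rank
  rw [add_sub_cancel_right, add_sub_cancel_right, height_cast, ← Int.natCast_ediv]
  ring

theorem row_div_lt {y : ℕ} (hy : y < height n k) : y / (n - k + 1) < k :=
  Nat.div_lt_of_lt_mul (hy.trans_eq (mul_comm _ _))

theorem natDiv_sub {y y' s : ℕ} (hs : 0 < s) {t : ℤ} (h : (y : ℤ) - y' = s * t) :
    ((y / s : ℕ) : ℤ) - (y' / s : ℕ) = t := by
  have e : (y : ℤ) = y' + s * t := by linarith
  rw [Int.natCast_ediv, Int.natCast_ediv, e, Int.add_mul_ediv_left _ _ (by omega)]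
  ring

/-- Ranks are ordered first by the diagonal, then from left to right. -/
theorem rank_lt_rank_iff (hk : 0 < k) {x x' : ℤ} {y y' : ℕ} (hy : y < height n k)
    (hy' : y' < height n k) :
    rank n k (x + 1) ((y : ℤ) + 1) < rank n k (x' + 1) ((y' : ℤ) + 1) ↔
      (y : ℤ) - (n - k + 1 : ℕ) * x < y' - (n - k + 1 : ℕ) * x' ∨
      ((y : ℤ) - (n - k + 1 : ℕ) * x = y' - (n - k + 1 : ℕ) * x' ∧ x < x') := by
  rw [rank_eq, rank_eq]
  have h1 := row_div_lt hy
  have h2 := row_div_lt hy'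
  have h3 := natDiv_sub (s := n - k + 1) (y := y) (y' := y') (t := x - x') (by omega)
  generalize y / (n - k + 1) = α at h1 h3 ⊢
  generalize y' / (n - k + 1) = β at h2 h3 ⊢
  set I := (y : ℤ) - (n - k + 1 : ℕ) * x with hI
  set J := (y' : ℤ) - (n - k + 1 : ℕ) * x' with hJ
  rcases lt_trichotomy I J with h | h | h
  · have : (k : ℤ) * (I + 1) ≤ k * J := mul_le_mul_of_nonneg_left (by omega) (by omega)
    rw [mul_add] at this
    constructor
    · intro _; exact Or.inl h
    · intro _; omega
  · have h4 := h3 (by rw [hI, hJ] at h; linarith)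
    rw [h]
    omega
  · have : (k : ℤ) * (J + 1) ≤ k * I := mul_le_mul_of_nonneg_left (by omega) (by omega)
    rw [mul_add] at this
    omega

/-- Below the top row the correction terms in `γ` and in the rank match, so `γ` moves a box one step
up in its column, to the next diagonal. -/
theorem gammaPerm_rank (N : ℕ) (hk : 0 < k) (x : ℤ) {y : ℕ} (hy : y + 1 < height n k) :
    (gammaPerm n N hk).toPerm (rank n k (x + 1) ((y : ℤ) + 1)) =
      rank n k (x + 1) (((y + 1 : ℕ) : ℤ) + 1) := by
  obtain ⟨q₀, r, hr, rfl⟩ : ∃ q₀ r : ℕ, r < n - k + 1 ∧ y = (n - k + 1) * q₀ + r :=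
    ⟨y / (n - k + 1), y % (n - k + 1), Nat.mod_lt _ (by omega), (Nat.div_add_mod _ _).symm⟩
  have hq : q₀ < k := by
    have h1 : (n - k + 1) * q₀ < (n - k + 1) * k := by
      have : height n k = (n - k + 1) * k := mul_comm _ _
      omega
    exact Nat.lt_of_mul_lt_mul_left h1
  rw [rank_row hr, gammaPerm_apply N hk hr hq]
  obtain ⟨r', q₀', t, hr', hq', e, hc⟩ := gammaWindow_form N hr hq
  have key : (n - k + 1) * q₀ + r + 1 = (n - k + 1) * q₀' + r' → t = q₀' - q₀ →
      gammaWindow n k N (1 + r * k + q₀) + height n k * (q₀ - x) =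
      rank n k (x + 1) ((((n - k + 1) * q₀ + r + 1 : ℕ) : ℤ) + 1) := by
    intro h1 h2
    rw [h1, rank_row hr', e, h2]
    ring
  rcases hc with ⟨h1, h2, h3⟩ | ⟨h1, h2, h3, h4⟩ | ⟨h1, h2, h3, h4, h5⟩
  · exact key (by rw [h1, h2]; ring) (by rw [h2, h3]; ring)
  · exact key (by rw [h1, h2, h3]; ring) (by rw [h3, h4]; push_cast; ring)
  · exfalso
    have h6 : height n k = (n - k + 1) * (q₀ + 1) := by rw [h3]; exact mul_comm _ _
    rw [mul_add] at h6
    omega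

variable (π : ParkingFunction (height n k) k)

/-- Attacking is betweenness for ranks. -/
theorem isAttacking_iff_rank (N : ℕ) (hk : 0 < k) (a y : Fin (height n k)) (x : ℕ) :
    IsAttacking (height n k) k (π.path.col a, (a : ℕ)) (x, (y : ℕ)) ↔
      rank n k ((π.path.col a : ℤ) + 1) (((a : ℕ) : ℤ) + 1) <
        rank n k ((x : ℤ) + 1) (((y : ℕ) : ℤ) + 1) ∧
      (gammaPerm n N hk).toPerm.symm (rank n k ((x : ℤ) + 1) (((y : ℕ) : ℤ) + 1)) <
        rank n k ((π.path.col a : ℤ) + 1) (((a : ℕ) : ℤ) + 1) := by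
  rw [DyckPath.isAttacking_iff (K := height n k) (s := n - k + 1) rfl hk, rank_lt_rank_iff hk a.2 y.2]
  have ha := DyckPath.mul_col_le (D := π.path) (s := n - k + 1) rfl hk a
  have ha' : ((n - k + 1 : ℕ) : ℤ) * π.path.col a ≤ (a : ℕ) := by exact_mod_cast ha
  -- In row `0` the box below is not given by `γ⁻¹`, but both sides are false: labelled boxes have
  -- nonnegative diagonal index, which is too large for any box of this row to be attacked.
  rcases Nat.eq_zero_or_pos (y : ℕ) with hy | hy
  · have h1 : (0 : ℤ) ≤ ((n - k + 1 : ℕ) : ℤ) * x := by positivity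
    rw [hy]
    constructor
    · rintro (⟨h2, h3⟩ | ⟨h2, _⟩)
      · have h4 : ((n - k + 1 : ℕ) : ℤ) * 1 ≤ ((n - k + 1 : ℕ) : ℤ) * x :=
          mul_le_mul_of_nonneg_left (by omega) (by omega)
        push_cast at *
        omega
      · push_cast at *
        omega
    · rintro ⟨h2 | ⟨h2, h3⟩, _⟩
      · push_cast at *
        omega
      · have h4 : ((n - k + 1 : ℕ) : ℤ) * 1 ≤ ((n - k + 1 : ℕ) : ℤ) * x :=
          mul_le_mul_of_nonneg_left (by omega) (by omega)
        push_cast at *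
        omega
  · obtain ⟨y', hy'⟩ : ∃ y', (y : ℕ) = y' + 1 := ⟨y - 1, by omega⟩
    have hyK := y.2
    have h1 : (gammaPerm n N hk).toPerm.symm (rank n k ((x : ℤ) + 1) (((y : ℕ) : ℤ) + 1)) =
        rank n k ((x : ℤ) + 1) ((y' : ℤ) + 1) := by
      rw [Equiv.symm_apply_eq, gammaPerm_rank N hk _ (by omega), hy']
    rw [h1, rank_lt_rank_iff hk (by omega) a.2, hy']
    push_cast
    omega

open Classical in
/-- The positions of the coordinates of the intersection correspond to attacking pairs. -/
theorem ncard_freeIndex_omega (N : ℕ) (hk : 0 < k) (hN : k ≤ N) :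
    (freeIndex (omega hk π) (gammaPerm n N hk)).ncard =
      (Finset.univ.filter fun p : Fin (height n k) × Fin k × Fin (height n k) =>
        IsAttacking (height n k) k (π.path.col p.1, (p.1 : ℕ)) (p.2.1, (p.2.2 : ℕ)) ∧
        (π.path.col p.2.2 < p.2.1 ∨
          (π.path.col p.2.2 = p.2.1 ∧ π.label p.2.2 < π.label p.1))).card := by
  rw [(parkingWeight N hk hN π).ncard_freeIndex (height_pos hk), ← Set.ncard_coe_finset]
  symm
  set f : Fin (height n k) × Fin k × Fin (height n k) → ℤ × ℤ := fun p =>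
    (((π.label p.1 : ℕ) : ℤ) + 1, rank n k (((p.2.1 : ℕ) : ℤ) + 1) (((p.2.2 : ℕ) : ℤ) + 1)) with hf
  have hfinj : Function.Injective f := by
    rintro ⟨a, x, y⟩ ⟨a', x', y'⟩ h
    simp only [hf, Prod.mk.injEq] at h
    have h1 : a = a' := π.label.injective (Fin.ext (by omega))
    have h2 : y = y' := rank_row_inj hk _ _ y y' (by rw [h.2, sub_self]; exact dvd_zero _)
    subst h1 h2
    have h3 := h.2
    rw [rank_eq, rank_eq] at h3
    have h4 : (k : ℤ) * ((n - k + 1 : ℕ) * ((x : ℕ) : ℤ)) = k * ((n - k + 1 : ℕ) * ((x' : ℕ) : ℤ)) := by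
      linarith
    have h5 := mul_left_cancel₀ (by omega) (mul_left_cancel₀ (by omega) h4)
    have h6 : x = x' := Fin.ext (by exact_mod_cast h5)
    rw [h6]
  have hω : ∀ a : Fin (height n k), (omega hk π).toPerm (((π.label a : ℕ) : ℤ) + 1) =
      rank n k ((π.path.col a : ℤ) + 1) (((a : ℕ) : ℤ) + 1) := fun a => by
    have := omega_apply π hk a 0
    rwa [mul_zero, add_zero, add_zero] at this
  -- Labels differ by less than `K`, so the columns decide the comparison first and the labels only
  -- break ties.
  have hlt : ∀ (a y : Fin (height n k)) (x : ℤ),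
      ((π.label y : ℕ) : ℤ) + 1 + height n k * (π.path.col y - x) < ((π.label a : ℕ) : ℤ) + 1 ↔
      (π.path.col y : ℤ) < x ∨ ((π.path.col y : ℤ) = x ∧ π.label y < π.label a) := by
    intro a y x
    have h1 := (π.label y).2
    have h2 := (π.label a).2
    rcases lt_trichotomy (π.path.col y : ℤ) x with h | h | h
    · have : (height n k : ℤ) * (π.path.col y - x) ≤ height n k * (-1) :=
        mul_le_mul_of_nonneg_left (by omega) (by omega)
      constructor
      · intro _; exact Or.inl h
      · intro _; omega
    · rw [h, sub_self, mul_zero, Fin.lt_def]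
      omega
    · have : (height n k : ℤ) * 1 ≤ height n k * (π.path.col y - x) :=
        mul_le_mul_of_nonneg_left (by omega) (by omega)
      omega
  rw [← Set.ncard_image_of_injective _ hfinj]
  congr 1
  ext ⟨i, m⟩
  simp only [Finset.coe_filter, Finset.mem_univ, true_and, Set.mem_image, Set.mem_ofPred_eq,
    cellIndex]
  constructor
  · rintro ⟨⟨a, x, y⟩, ⟨hatt, hcol⟩, heq⟩
    simp only [hf, Prod.mk.injEq] at heq hatt hcol
    obtain ⟨rfl, rfl⟩ := heq
    rw [isAttacking_iff_rank π N hk] at hatt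
    have h1 := (π.label a).2
    rw [hω, omega_symm_rank, hlt]
    refine ⟨⟨by omega, by omega, hatt.1, ?_⟩, hatt.2⟩
    simpa using hcol
  · rintro ⟨⟨h1, h2, h3, h4⟩, h5⟩
    obtain ⟨l, rfl⟩ : ∃ l : Fin (height n k), i = ((l : ℕ) : ℤ) + 1 :=
      ⟨⟨(i - 1).toNat, by omega⟩, by simp; omega⟩
    obtain ⟨a, rfl⟩ := π.label.surjective l
    obtain ⟨y, x, rfl⟩ : ∃ (y : Fin (height n k)) (x : ℤ),
        m = rank n k (x + 1) (((y : ℕ) : ℤ) + 1) := by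
      obtain ⟨r, q₀, q, hr, hq, rfl⟩ := exists_position (n := n) hk m
      refine ⟨⟨(n - k + 1) * q₀ + r, row_lt_height hr hq⟩, q₀ - q, ?_⟩
      rw [rank_row hr]
      ring
    rw [omega_symm_rank, hlt] at h4
    rw [hω] at h3 h5
    have hx0 : 0 ≤ x := by omega
    obtain ⟨x, rfl⟩ := Int.eq_ofNat_of_zero_le hx0
    have hatt := (isAttacking_iff_rank π N hk a y x).2 ⟨h3, h5⟩
    -- From column `k` on all diagonal indices are negative, so no labelled box attacks there.
    have hxk : x < k := by
      have hcol := DyckPath.col_lt (D := π.path) (K := height n k) (s := n - k + 1) rfl hk a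
      by_contra hcon
      rw [DyckPath.isAttacking_iff (K := height n k) (s := n - k + 1) rfl hk] at hatt
      have h6 := DyckPath.mul_col_le (D := π.path) (s := n - k + 1) rfl hk a
      have h7 : ((n - k + 1 : ℕ) : ℤ) * π.path.col a ≤ (a : ℕ) := by exact_mod_cast h6
      have h8 : ((n - k + 1 : ℕ) : ℤ) * k ≤ (n - k + 1 : ℕ) * x :=
        mul_le_mul_of_nonneg_left (by omega) (by omega)
      have h9 := y.2
      have h10 := height_cast n k
      rw [mul_comm] at h10
      omega
    refine ⟨(a, ⟨x, hxk⟩, y), ⟨hatt, ?_⟩, rfl⟩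
    simp only
    omega

end Count

/-! ### Comparison with dinv -/

section Dinv

variable {n k : ℕ}

/-- The number of attacking pairs of labelled boxes. -/
def DyckPath.labelledAttackCount {K k : ℕ} (D : DyckPath K k) : ℕ :=
  (Finset.univ.filter fun p : Fin K × Fin K =>
    IsAttacking K k (D.col p.1, (p.1 : ℕ)) (D.col p.2, (p.2 : ℕ))).card

theorem exists_perm_lt_iff {m : ℕ} {f : Fin m → ℤ} (hf : Function.Injective f) :
    ∃ σ : Equiv.Perm (Fin m), ∀ i j, σ i < σ j ↔ f i < f j := by
  have h1 : StrictMono (f ∘ Tuple.sort f) :=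
    (Tuple.monotone_sort f).strictMono_of_injective (hf.comp (Tuple.sort f).injective)
  refine ⟨(Tuple.sort f).symm, fun i j => ?_⟩
  rw [← h1.lt_iff_lt]
  simp

/-- Labelling the boxes in the order of their ranks makes every attacking pair contribute. -/
theorem maxtdinv_eq (hk : 0 < k) (D : DyckPath (height n k) k) :
    D.maxtdinv = D.labelledAttackCount := by
  apply le_antisymm
  · refine Finset.sup_le fun σ _ => Finset.card_le_card fun p hp => ?_
    rw [Finset.mem_filter] at hp ⊢
    exact ⟨hp.1, hp.2.1⟩
  · obtain ⟨σ, hσ⟩ := exists_perm_lt_iff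
      (f := fun y : Fin (height n k) => rank n k ((D.col y : ℤ) + 1) (((y : ℕ) : ℤ) + 1))
      (fun y y' h => rank_row_inj hk _ _ y y' (by
        simp only at h
        rw [h, sub_self]; exact dvd_zero _))
    have hlab : D.IsLabelling σ := by
      intro i j hij hcol
      rw [hσ, rank_lt_rank_iff hk i.2 j.2, hcol]
      rw [Fin.lt_def] at hij
      omega
    refine le_trans ?_ (Finset.le_sup (f := D.tdinv)
      (Finset.mem_filter.2 ⟨Finset.mem_univ σ, hlab⟩))
    refine Finset.card_le_card fun p hp => ?_
    rw [Finset.mem_filter] at hp ⊢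
    refine ⟨hp.1, hp.2, ?_⟩
    rw [hσ, rank_lt_rank_iff hk p.1.2 p.2.2]
    have := (DyckPath.isAttacking_iff (K := height n k) (s := n - k + 1) rfl hk _ _ _ _).1 hp.2
    omega

open Classical in
-- Split by the kind of attacked box. The attacked labelled boxes with smaller label are exactly the
-- attacking pairs that `tdinv` misses, since no box attacks itself and labels are distinct.
theorem card_attacking_pairs (hk : 0 < k) (D : DyckPath (height n k) k)
    (σ : Equiv.Perm (Fin (height n k))) :
    (Finset.univ.filter fun p : Fin (height n k) × Fin k × Fin (height n k) =>
        IsAttacking (height n k) k (D.col p.1, (p.1 : ℕ)) (p.2.1, (p.2.2 : ℕ)) ∧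
        (D.col p.2.2 < p.2.1 ∨ (D.col p.2.2 = p.2.1 ∧ σ p.2.2 < σ p.1))).card + D.tdinv σ =
      D.attackCount + D.labelledAttackCount := by
  have h1 : (Finset.univ.filter fun p : Fin (height n k) × Fin k × Fin (height n k) =>
        IsAttacking (height n k) k (D.col p.1, (p.1 : ℕ)) (p.2.1, (p.2.2 : ℕ)) ∧
        (D.col p.2.2 < p.2.1 ∨ (D.col p.2.2 = p.2.1 ∧ σ p.2.2 < σ p.1))).card =
      D.attackCount + (Finset.univ.filter fun p : Fin (height n k) × Fin (height n k) =>
        IsAttacking (height n k) k (D.col p.1, (p.1 : ℕ)) (D.col p.2, (p.2 : ℕ)) ∧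
          σ p.2 < σ p.1).card := by
    rw [← Finset.card_filter_add_card_filter_not
      (p := fun p : Fin (height n k) × Fin k × Fin (height n k) => D.col p.2.2 < p.2.1)]
    congr 1
    · rw [Finset.filter_filter, DyckPath.attackCount]
      congr 1
      ext p
      simp only [Finset.mem_filter, Finset.mem_univ, true_and]
      tauto
    · rw [Finset.filter_filter]
      refine Finset.card_bij (fun p _ => (p.1, p.2.2)) ?_ ?_ ?_
      · rintro ⟨a, x, y⟩ hp
        simp only [Finset.mem_filter, Finset.mem_univ, true_and] at hp ⊢
        obtain ⟨⟨hp1, hp2⟩, hp3⟩ := hp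
        have hp4 := hp2.resolve_left hp3
        rw [hp4.1]
        exact ⟨hp1, hp4.2⟩
      · rintro ⟨a, x, y⟩ hp ⟨a', x', y'⟩ hp' h
        simp only [Finset.mem_filter, Finset.mem_univ, true_and, Prod.mk.injEq] at hp hp' h
        obtain ⟨rfl, rfl⟩ := h
        have e1 := (hp.1.2.resolve_left hp.2).1
        have e2 := (hp'.1.2.resolve_left hp'.2).1
        have : x = x' := Fin.ext (e1.symm.trans e2)
        rw [this]
      · rintro ⟨a, y⟩ hp
        simp only [Finset.mem_filter, Finset.mem_univ, true_and] at hp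
        refine ⟨(a, ⟨D.col y, DyckPath.col_lt (K := height n k) (s := n - k + 1) rfl hk y⟩, y),
          ?_, rfl⟩
        simp only [Finset.mem_filter, Finset.mem_univ, true_and]
        exact ⟨⟨hp.1, Or.inr hp.2⟩, lt_irrefl _⟩
  rw [h1, add_assoc]
  congr 1
  rw [DyckPath.labelledAttackCount, DyckPath.tdinv, add_comm,
    ← Finset.card_filter_add_card_filter_not
      (p := fun p : Fin (height n k) × Fin (height n k) => σ p.1 < σ p.2)
      (s := Finset.univ.filter fun p : Fin (height n k) × Fin (height n k) =>
        IsAttacking (height n k) k (D.col p.1, (p.1 : ℕ)) (D.col p.2, (p.2 : ℕ)))]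
  rw [Finset.filter_filter, Finset.filter_filter]
  congr 1
  · congr 1
    ext p
    simp only [Finset.mem_filter, Finset.mem_univ, true_and]
    refine and_congr_right fun h => ?_
    rw [not_lt]
    refine ⟨le_of_lt, fun h2 => lt_of_le_of_ne h2 fun h3 => ?_⟩
    have h4 := σ.injective h3
    rw [h4] at h
    rcases h with ⟨_, h⟩ | ⟨_, h⟩ <;> exact lt_irrefl _ h

theorem ncard_freeIndex_eq (π : ParkingFunction (height n k) k) (N : ℕ) (hk : 0 < k)
    (hN : k ≤ N) : ((freeIndex (omega hk π) (gammaPerm n N hk)).ncard : ℤ) =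
      (delta (height n k) k : ℤ) - π.dinv := by
  classical
  rw [ncard_freeIndex_omega π N hk hN]
  have h1 := card_attacking_pairs hk π.path π.label
  have h2 := DyckPath.pathdinv_add_attackCount (D := π.path) (K := height n k)
    (s := n - k + 1) rfl hk (by omega)
  have h3 := maxtdinv_eq hk π.path
  unfold ParkingFunction.dinv
  rw [h3]
  omega

end Dinv

end AffineSpringer

theorem theorem5p3 (n k N : ℕ) (hk : 0 < k) (hkn : k ≤ n) (hN : k ≤ N)
    (π : ParkingFunction (height n k) k) :
    ∃ d : ℕ, (d : ℤ) = (delta (height n k) k : ℤ) - π.dinv ∧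
      IsoAffineSpace (K := height n k)
        (fun R _ _ => varietyX n k N R ∩ schubertCell R (omega hk π)) d := by
  refine ⟨_, ncard_freeIndex_eq π N hk hN, ?_⟩
  have h : (fun (R : Type) [CommRing R] [Algebra ℂ R] =>
      varietyX n k N R ∩ schubertCell R (omega hk π)) =
      fun (R : Type) [CommRing R] [Algebra ℂ R] =>
      springerFiber ((gammaPerm n N hk).toGL R).val ∩ schubertCell R (omega hk π) := by
    funext R _ _
    ext x
    simp only [varietyX, gammaOp_eq N hk, Set.mem_inter_iff]
    -- The permutation `ω_π` is itself positive and normalized, so intersecting with the positive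
    -- cells changes nothing.
    exact ⟨fun hx => ⟨hx.1.1, hx.2⟩, fun hx => ⟨⟨hx.1, omega hk π, omega_isPositive π hk,
      omega_isNormalized π hk, hx.2⟩, hx.2⟩⟩
  rw [h]
  exact Weight.isoAffineSpace _ (height_pos hk) (parkingWeight N hk hN π)
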